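/- Let $1/2<\sigma<1$, $d\in\mathbb N$, $M>0$, and let $\mathbf X(p)=(X_1(p),\dots,X_d(p))$ ($p$ prime) be independent random vectors on a probability space, where the $X_j(p)$ are complex random variables with $|X_j(p)|\le M$ and $\mathbb E(X_j(p))=0$. For real $y\ge 2$ put $$L(\sigma,\mathbf X;y)=\prod_{p\le y}\prod_{j=1}^d\Big(1-\frac{X_j(p)}{p^{\sigma}}\Big)^{-1},$$ and let $\arg L(\sigma,\mathbf X;y)$ be the sum over $p\le y$ and $j$ of the principal arguments of the factors $(1-X_j(p)p^{-\sigma})^{-1}$ (a vanishing $1-X_j(p)p^{-\sigma}$ contributing $0$). Let $Z(p)=\sum_j\operatorname{Re}X_j(p)$ and $Y(p)=\sum_j\operatorname{Im}X_j(p)$. A sequence of real random variables $\{W(p)\}_p$ satisfies (ULD) with limit $W$, a real random variable with $\mathbb E(e^{tW})<\infty$ for all $t\in\mathbb R$, if for every $A>0$ and all large primes $p$ (how large may depend on $A$) one has $\mathbb E(e^{tW(p)})=\mathbb E(e^{tW})\,(1+O_A((\log p)^{-A}))$ uniformly for all $t\in\mathbb R$. For such $W$ write $$G_W(\sigma)=\int_0^\infty\frac{\log\mathbb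 E(e^{uW})}{u^{1/\sigma+1}}\,du,\qquad A_W(\sigma)=\left(\frac{\sigma^{2\sigma}}{(1-\sigma)^{2\sigma-1}G_W(\sigma)^{\sigma}}\right)^{1/(1-\sigma)},$$ and let $$r(y,\tau)=\left(\frac{\tau}{y^{1-\sigma}(\log y)^{-1}}\right)^{(\sigma-1/2)/(1-\sigma)},\qquad E(y,\tau)=\frac1{\sqrt{\log\tau}}+r(y,\tau).$$ (a) Suppose that $\{Z(p)\}_p$ satisfies (ULD) with limit $Z$, that $Z$ is not almost surely $0$, and that for each prime $p$ and each $j$ the factor is essentially bounded, i.e. $|1-X_j(p)p^{-\sigma}|\ge\delta$ almost surely for some $\delta=\delta(p,j)>0$ (this is automatic if $M<2^\sigma$). Then the integral $G_Z(\sigma)$ converges absolutely, $G_Z(\sigma)>0$, and there are positive constants $C,K$ and a $\tau_0$, depending on $\sigma$, on the family $\{\mathbf X(p)\}$ and on $Z$, but not on $\tau$ and $y$, such that for all $\tau\ge\tau_0$ $$\mathrm{Prob}\big(\log|L(\sigma,\mathbf X;y)|>\tau\big)\le\exp\Big(-A_Z(\sigma)\,\tau^{\frac1{1-\sigma}}(\log\tau)^{\frac{\sigma}{1-\sigma}}\big(1-C\,E(y,\tau)\big)\Big)\quad\text{for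 all } y\ge(\tau\log\tau)^{\frac1{1-\sigma}},$$ $$\mathrm{Prob}\big(\log|L(\sigma,\mathbf X;y)|>\tau\big)\ge\exp\Big(-A_Z(\sigma)\,\tau^{\frac1{1-\sigma}}(\log\tau)^{\frac{\sigma}{1-\sigma}}\big(1+C\,E(y,\tau)\big)\Big)\quad\text{for all such } y \text{ with } y\ge K(\tau\log\tau)^{\frac1{1-\sigma}}.$$ In particular, uniformly for $y\ge \max(1,K)\,(\tau\log\tau)^{1/(1-\sigma)}$, this probability equals $$\exp\Big(-A_Z(\sigma)\,\tau^{\frac1{1-\sigma}}(\log\tau)^{\frac{\sigma}{1-\sigma}}\Big(1+O\Big(\frac1{\sqrt{\log\tau}}+r(y,\tau)\Big)\Big)\Big).$$ (b) Suppose that $\{Y(p)\}_p$ satisfies (ULD) with limit $Y$, and that $Y$ is not almost surely $0$. Then the same conclusions hold with $Z$ replaced by $Y$ and with $\mathrm{Prob}(\arg L(\sigma,\mathbf X;y)>\tau)$ in place of $\mathrm{Prob}(\log|L(\sigma,\mathbf X;y)|>\tau)$. -/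

import Mathlib

open MeasureTheory ProbabilityTheory

noncomputable section

/-- The primes `p ≤ y`. -/
def primesUpTo (y : ℝ) : Finset Nat.Primes :=
  Finset.subtype Nat.Prime (Finset.Iic ⌊y⌋₊)

/-- The factor `(1 - X_j(p) p^{-s})⁻¹` of the random Euler product; `X p ω` is the vector
`(X_1(p), …, X_d(p))` at the sample point `ω`. -/
def eulerFactor {Ω : Type*} {d : ℕ} (X : Nat.Primes → Ω → Fin d → ℂ) (s : ℂ)
    (p : Nat.Primes) (j : Fin d) (ω : Ω) : ℂ :=
  (1 - X p ω j / ((p : ℕ) : ℂ) ^ s)⁻¹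

/-- The random Euler product `L(s, X; y) = ∏_{p ≤ y} ∏_j (1 - X_j(p) p^{-s})⁻¹`. -/
def eulerProduct {Ω : Type*} {d : ℕ} (X : Nat.Primes → Ω → Fin d → ℂ) (s : ℂ) (y : ℝ)
    (ω : Ω) : ℂ :=
  ∏ p ∈ primesUpTo y, ∏ j, eulerFactor X s p j ω

/-- `arg L(s, X; y)`: the sum of the principal arguments of the Euler factors, i.e. the imaginary
part of `-∑_{p ≤ y} ∑_j log (1 - X_j(p) p^{-s})`. It is not reduced modulo `2π`. -/
def eulerArg {Ω : Type*} {d : ℕ} (X : Nat.Primes → Ω → Fin d → ℂ) (s : ℂ) (y : ℝ)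
    (ω : Ω) : ℝ :=
  ∑ p ∈ primesUpTo y, ∑ j, (eulerFactor X s p j ω).arg

/-- The sequence `W(p)`, `p` prime, of real random variables satisfies the uniform limiting
distribution hypothesis with limit `Z` (which may live on another probability space): for every
`A > 0` and all large primes `p`, `E(e^{tW(p)}) = E(e^{tZ}) (1 + O_A((log p)^{-A}))`, uniformly in
`t ∈ ℝ`. Here `mgf Z ν t = E(e^{tZ})`. -/
def IsULDLimit {Ω Ω' : Type*} [MeasurableSpace Ω] [MeasurableSpace Ω'] (μ : Measure Ω)
    (W : Nat.Primes → Ω → ℝ) (ν : Measure Ω') (Z : Ω' → ℝ) : Prop :=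
  (∀ t : ℝ, Integrable (fun x => Real.exp (t * Z x)) ν) ∧
  ∀ A : ℝ, 0 < A → ∃ C : ℝ, ∃ P : ℕ, ∀ p : Nat.Primes, P ≤ (p : ℕ) → ∀ t : ℝ,
    Integrable (fun ω => Real.exp (t * W p ω)) μ ∧
    |mgf (W p) μ t - mgf Z ν t| ≤ mgf Z ν t * (C / Real.log (p : ℕ) ^ A)

/-- The integrand `log E(e^{uZ}) / u^{1/σ + 1}` of `G_Z(σ)`. -/
def cumulantIntegrand {Ω : Type*} [MeasurableSpace Ω] (ν : Measure Ω) (Z : Ω → ℝ)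
    (σ u : ℝ) : ℝ :=
  Real.log (mgf Z ν u) / u ^ (1 / σ + 1)

/-- `G_Z(σ) = ∫_0^∞ log E(e^{uZ}) / u^{1/σ + 1} du`. -/
def cumulantG {Ω : Type*} [MeasurableSpace Ω] (ν : Measure Ω) (Z : Ω → ℝ) (σ : ℝ) : ℝ :=
  ∫ u in Set.Ioi (0 : ℝ), cumulantIntegrand ν Z σ u

/-- `A_Z(σ) = (σ^{2σ} / ((1-σ)^{2σ-1} G_Z(σ)^σ))^{1/(1-σ)}`. -/
def cumulantA {Ω : Type*} [MeasurableSpace Ω] (ν : Measure Ω) (Z : Ω → ℝ) (σ : ℝ) : ℝ :=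
  (σ ^ (2 * σ) / ((1 - σ) ^ (2 * σ - 1) * cumulantG ν Z σ ^ σ)) ^ (1 / (1 - σ))

/-- `r(y, τ) = (τ / (y^{1-σ} (log y)⁻¹))^{(σ - 1/2)/(1-σ)}`. -/
def errorR (σ y τ : ℝ) : ℝ :=
  (τ / (y ^ (1 - σ) * (Real.log y)⁻¹)) ^ ((σ - 1 / 2) / (1 - σ))

/-- The tail `Φ τ y` equals
`exp (-A τ^{1/(1-σ)} (log τ)^{σ/(1-σ)} (1 + O(1/√(log τ) + r(y, τ))))` for large `τ`, uniformly in
`y`: the upper bound for `y ≥ (τ log τ)^{1/(1-σ)}`, the lower bound for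
`y ≥ K (τ log τ)^{1/(1-σ)}` with a suitable constant `K`. -/
def HasTailAsymptotic (σ A : ℝ) (Φ : ℝ → ℝ → ℝ) : Prop :=
  ∃ C : ℝ, ∃ K : ℝ, ∃ τ₀ : ℝ, 0 < C ∧ 0 < K ∧ ∀ τ : ℝ, τ₀ ≤ τ →
    ∀ y : ℝ, (τ * Real.log τ) ^ (1 / (1 - σ)) ≤ y →
      Φ τ y ≤ Real.exp (-A * τ ^ (1 / (1 - σ)) * Real.log τ ^ (σ / (1 - σ)) *
        (1 - C * (1 / √(Real.log τ) + errorR σ y τ))) ∧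
      (K * (τ * Real.log τ) ^ (1 / (1 - σ)) ≤ y →
        Real.exp (-A * τ ^ (1 / (1 - σ)) * Real.log τ ^ (σ / (1 - σ)) *
          (1 + C * (1 / √(Real.log τ) + errorR σ y τ))) ≤ Φ τ y)

end

/-!
Tail asymptotics for `log |L(σ, X; y)|` and `arg L(σ, X; y)`.

Both quantities are, up to a bounded error, the independent sum `T = ∑_{p ≤ y} p^{-σ} W(p)`, where
`W(p)` is `∑_j Re X_j(p)` or `∑_j Im X_j(p)`: expand `log (1 - z)⁻¹ = z + O(|z|²)` and use that
`∑ p^{-2σ}` converges (`exists_abs_sum_log_eulerFactor_sub_le`). A bounded error changes the level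
`τ` by `O(1)`, which is negligible.

The cumulant generating function of `T` is `Λ(s) = ∑_{p ≤ y} log E e^{s p^{-σ} W(p)}`. By (ULD) each
summand may be replaced by `f(s p^{-σ})`, where `f(u) = log E e^{uZ}` satisfies
`0 ≤ f(u) ≪ min (u, u²)`, and the prime number theorem turns the sum into
`s^{1/σ} / log s * (G_Z(σ) + O(1 / √(log s)))`; the primes `p > y` that are missing only matter for
the lower bound (`IsCumulantProfile.exists_sum_bounds_of_limit`). The relative error `1 / √(log s)`
requires the prime number theorem with an error term. It is obtained here from polynomial bounds
for `ζ` and its derivatives and for `1 / ζ` to the right of the line `Re s = 1`: these bound the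
Dirichlet series of `(Λ(n) - 1) log n` by a constant times `(1 + |t|)^{1/2}` uniformly for
`1 < Re s ≤ 2`, so that a Cesàro-weighted Perron integral converges absolutely and gives
`∑_{n ≤ x} (Λ(n) - 1) log n (1 - n / x) = O(x)`. Differencing these means yields
`ψ(x) = x + O(x / √(log x))` (`exists_abs_psi_sub_le`).

The tail of `T` is then governed by the minimum of `Λ(s) - s τ`, attained on the scale
`s = c (τ log τ)^{σ/(1-σ)}`, where the exponent is
`(G (1-σ)/σ c^{1/σ} - c) τ^{1/(1-σ)} (log τ)^{σ/(1-σ)}` to leading order and its minimum over `c` is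
`-A_Z(σ) τ^{1/(1-σ)} (log τ)^{σ/(1-σ)}` (`saddle_point`). The upper bound is Chernoff's inequality at
the minimum. For the lower bound one tilts the measure so that `T` has mean `τ + O(1)`
(`exists_exp_le_measureReal_gt`). Every tilted variance is at most `∑ p^{-2σ}` times a constant, so
under the tilted measure `T` stays in a bounded window above `τ` with probability at least `1/2`,
and the density there costs only `e^{O(s)}`. Such a tilt exists because `Λ(s₂)` exceeds
`s₂ (τ + O(1))` at a sufficiently large multiple `s₂` of the critical scale; this is where
`y ≥ K (τ log τ)^{1/(1-σ)}` is needed. The tilting parameter itself need not be located, since the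
exponent at any `s` is at least its minimum.
-/

/-! ### The entire function `(s - 1) ζ(s)` and partial summation for `ζ` -/

section ZetaContinuation

open Complex Filter Topology Finset

/-- The entire function `(s - 1) ζ(s)`, with its value `1` at `s = 1` filled in. -/
noncomputable def zetaEntire (s : ℂ) : ℂ :=
  Function.update (fun z : ℂ ↦ (z - 1) * riemannZeta z) 1 1 s

lemma zetaEntire_one : zetaEntire 1 = 1 := by simp [zetaEntire]

lemma zetaEntire_of_ne {s : ℂ} (hs : s ≠ 1) : zetaEntire s = (s - 1) * riemannZeta s := by
  simp [zetaEntire, hs]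

lemma riemannZeta_eq_zetaEntire_div {s : ℂ} (hs : s ≠ 1) :
    riemannZeta s = zetaEntire s / (s - 1) := by
  rw [zetaEntire_of_ne hs, mul_div_cancel_left₀ _ (sub_ne_zero.mpr hs)]

lemma differentiable_zetaEntire : Differentiable ℂ zetaEntire := by
  have hd : ∀ s : ℂ, s ≠ 1 → DifferentiableAt ℂ zetaEntire s := fun s hs ↦ by
    have : DifferentiableAt ℂ (fun z : ℂ ↦ (z - 1) * riemannZeta z) s :=
      (by fun_prop : DifferentiableAt ℂ (fun z : ℂ ↦ z - 1) s).mul (differentiableAt_riemannZeta hs)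
    refine this.congr_of_eventuallyEq ?_
    filter_upwards [eventually_ne_nhds hs] with z hz using zetaEntire_of_ne hz
  intro s
  rcases eq_or_ne s 1 with rfl | hs
  · refine (analyticAt_of_differentiable_on_punctured_nhds_of_continuousAt ?_ ?_).differentiableAt
    · filter_upwards [self_mem_nhdsWithin] with z hz using hd z hz
    · exact continuousAt_update_same.mpr riemannZeta_residue_one
  · exact hd s hs

lemma zetaEntire_ne_zero {s : ℂ} (hs : 1 ≤ s.re) : zetaEntire s ≠ 0 := by
  rcases eq_or_ne s 1 with rfl | h
  · simp [zetaEntire_one]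
  · rw [zetaEntire_of_ne h]
    exact mul_ne_zero (sub_ne_zero.mpr h) (riemannZeta_ne_zero_of_one_le_re hs)

/-- The local error `(s - 1) ((n + 1)^{-s} - ∫_n^{n+1} x^{-s} dx)` in comparing `ζ` with an
integral, written without the integral so that it is visibly entire. -/
noncomputable def zetaErrorTerm (n : ℕ) (s : ℂ) : ℂ :=
  (s - 1) * ((n + 1 : ℕ) : ℂ) ^ (-s) + (((n + 1 : ℕ) : ℂ) ^ (1 - s) - (n : ℂ) ^ (1 - s))

lemma hasDerivAt_ofReal_cpow_pos {x : ℝ} (hx : 0 < x) (c : ℂ) :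
    HasDerivAt (fun y : ℝ ↦ (y : ℂ) ^ c) (c * (x : ℂ) ^ (c - 1)) x := by
  have h := (hasDerivAt_id (x : ℂ)).cpow_const (c := c) (Or.inl (by simpa using hx))
  simpa using h.comp_ofReal

lemma norm_cpow_neg_sub_cpow_neg_le {n : ℝ} (hn : 0 < n) {x : ℝ} (hx : x ∈ Set.Icc n (n + 1))
    {s : ℂ} (hs : 0 ≤ s.re) :
    ‖((n + 1 : ℝ) : ℂ) ^ (-s) - (x : ℂ) ^ (-s)‖ ≤ ‖s‖ * n ^ (-s.re - 1) := by
  have key := Convex.norm_image_sub_le_of_norm_hasDerivWithin_le (𝕜 := ℝ)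
    (f := fun y : ℝ ↦ (y : ℂ) ^ (-s)) (f' := fun y : ℝ ↦ -s * (y : ℂ) ^ (-s - 1))
    (C := ‖s‖ * n ^ (-s.re - 1)) (s := Set.Icc n (n + 1)) (x := x) (y := n + 1)
    (fun y hy ↦ (hasDerivAt_ofReal_cpow_pos (hn.trans_le hy.1) (-s)).hasDerivWithinAt) ?_
    (convex_Icc _ _) hx ⟨by linarith, le_rfl⟩
  · refine key.trans ?_
    have h1 : ‖n + 1 - x‖ ≤ 1 := by
      rw [Real.norm_eq_abs, abs_le]; constructor <;> linarith [hx.1, hx.2]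
    exact mul_le_of_le_one_right (by positivity) h1
  · intro y hy
    rw [norm_mul, norm_neg, norm_cpow_eq_rpow_re_of_pos (hn.trans_le hy.1)]
    have : y ^ (-s - 1).re ≤ n ^ (-s.re - 1) := by
      simp only [sub_re, neg_re, one_re]
      exact Real.rpow_le_rpow_of_nonpos hn hy.1 (by linarith)
    gcongr

lemma norm_zetaErrorTerm_le {n : ℕ} (hn : 1 ≤ n) {s : ℂ} (hs : 0 ≤ s.re) :
    ‖zetaErrorTerm n s‖ ≤ ‖s - 1‖ * ‖s‖ * (n : ℝ) ^ (-s.re - 1) := by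
  have hn0 : (0 : ℝ) < n := by exact_mod_cast hn
  have key := Convex.norm_image_sub_le_of_norm_hasDerivWithin_le (𝕜 := ℝ)
    (f := fun y : ℝ ↦ (s - 1) * ((n + 1 : ℝ) : ℂ) ^ (-s) * y + (y : ℂ) ^ (1 - s))
    (f' := fun y : ℝ ↦ (s - 1) * ((n + 1 : ℝ) : ℂ) ^ (-s) * 1 + (1 - s) * (y : ℂ) ^ (1 - s - 1))
    (C := ‖s - 1‖ * (‖s‖ * (n : ℝ) ^ (-s.re - 1))) (s := Set.Icc (n : ℝ) (n + 1))
    (x := n) (y := n + 1)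
    (fun y hy ↦ (((hasDerivAt_id (y : ℂ)).comp_ofReal.const_mul _).add
      (hasDerivAt_ofReal_cpow_pos (hn0.trans_le hy.1) (1 - s))).hasDerivWithinAt) ?_
    (convex_Icc _ _) ⟨le_rfl, by linarith⟩ ⟨by linarith, le_rfl⟩
  · have e : zetaErrorTerm n s = ((s - 1) * ((n + 1 : ℝ) : ℂ) ^ (-s) * ((n + 1 : ℝ) : ℂ)
        + ((n + 1 : ℝ) : ℂ) ^ (1 - s)) - ((s - 1) * ((n + 1 : ℝ) : ℂ) ^ (-s) * ((n : ℝ) : ℂ)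
        + ((n : ℝ) : ℂ) ^ (1 - s)) := by
      simp only [zetaErrorTerm]; push_cast; ring
    rw [e]
    refine key.trans (le_of_eq ?_)
    rw [add_sub_cancel_left]; simp [mul_assoc]
  · intro y hy
    have e : (s - 1) * ((n + 1 : ℝ) : ℂ) ^ (-s) * 1 + (1 - s) * (y : ℂ) ^ (1 - s - 1)
        = (s - 1) * (((n + 1 : ℝ) : ℂ) ^ (-s) - (y : ℂ) ^ (-s)) := by
      rw [show 1 - s - 1 = -s by ring]; ring
    rw [e, norm_mul]
    gcongr
    exact norm_cpow_neg_sub_cpow_neg_le hn0 hy hs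

lemma differentiable_zetaErrorTerm {n : ℕ} (hn : 1 ≤ n) : Differentiable ℂ (zetaErrorTerm n) := by
  have h1 : ((n + 1 : ℕ) : ℂ) ≠ 0 := by exact_mod_cast (Nat.succ_ne_zero n)
  have h2 : (n : ℂ) ≠ 0 := by exact_mod_cast (by omega : n ≠ 0)
  unfold zetaErrorTerm
  intro s
  refine DifferentiableAt.add (DifferentiableAt.mul (by fun_prop) ?_) (DifferentiableAt.sub ?_ ?_)
  · exact DifferentiableAt.const_cpow (by fun_prop) (Or.inl h1)
  · exact DifferentiableAt.const_cpow (by fun_prop) (Or.inl h1)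
  · exact DifferentiableAt.const_cpow (by fun_prop) (Or.inl h2)

lemma summable_shift_rpow {a : ℝ} (ha : a < -1) (N : ℕ) :
    Summable fun n : ℕ ↦ ((N + n : ℕ) : ℝ) ^ a := by
  have := (summable_nat_add_iff N).mpr (Real.summable_nat_rpow.mpr ha)
  simpa [add_comm] using this

/-- Partial summation for `(s - 1) ζ(s)` in the half-plane of absolute convergence: the integrals
contained in the error terms telescope to `N^{1-s}`. -/
lemma zetaEntire_eq_of_one_lt {N : ℕ} (hN : 1 ≤ N) {s : ℂ} (hs : 1 < s.re) :
    zetaEntire s = (s - 1) * ∑ n ∈ range N, ((n + 1 : ℕ) : ℂ) ^ (-s) + (N : ℂ) ^ (1 - s)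
      + ∑' n : ℕ, zetaErrorTerm (N + n) s := by
  have hs1 : s ≠ 1 := by rintro rfl; simp at hs
  have hsum : Summable fun n : ℕ ↦ ((n + 1 : ℕ) : ℂ) ^ (-s) := by
    have h := (Complex.summable_one_div_nat_cpow (p := s)).mpr hs
    have := (summable_nat_add_iff 1).mpr h
    simpa [cpow_neg] using this
  have hz : riemannZeta s = ∑' n : ℕ, ((n + 1 : ℕ) : ℂ) ^ (-s) := by
    rw [zeta_eq_tsum_one_div_nat_add_one_cpow hs]
    simp [cpow_neg]
  have hsumN : Summable fun n : ℕ ↦ ((N + n + 1 : ℕ) : ℂ) ^ (-s) := by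
    have := (summable_nat_add_iff N).mpr hsum
    simpa [add_comm, add_left_comm] using this
  have htel : HasSum (fun n : ℕ ↦ ((N + n + 1 : ℕ) : ℂ) ^ (1 - s) - ((N + n : ℕ) : ℂ) ^ (1 - s))
      (0 - (N : ℂ) ^ (1 - s)) := by
    have hlim : Tendsto (fun n : ℕ ↦ ((N + n : ℕ) : ℂ) ^ (1 - s)) atTop (𝓝 0) := by
      rw [tendsto_zero_iff_norm_tendsto_zero]
      have h1 : Tendsto (fun n : ℕ ↦ ((N + n : ℕ) : ℝ) ^ (-(s.re - 1))) atTop (𝓝 0) :=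
        (tendsto_rpow_neg_atTop (by linarith)).comp
          (tendsto_natCast_atTop_atTop.comp (tendsto_atTop_mono (fun n ↦ Nat.le_add_left n N) tendsto_id))
      refine h1.congr fun n ↦ ?_
      rw [norm_natCast_cpow_of_pos (by omega)]
      simp
    have hsummable : Summable fun n : ℕ ↦
        ((N + n + 1 : ℕ) : ℂ) ^ (1 - s) - ((N + n : ℕ) : ℂ) ^ (1 - s) := by
      have h1 : Summable fun n : ℕ ↦ zetaErrorTerm (N + n) s := by
        refine Summable.of_norm_bounded
          ((summable_shift_rpow (by linarith : -s.re - 1 < -1) N).mul_left (‖s - 1‖ * ‖s‖)) fun n ↦ ?_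
        exact norm_zetaErrorTerm_le (by omega) (by linarith)
      refine (h1.sub (hsumN.mul_left (s - 1))).congr fun n ↦ ?_
      simp only [zetaErrorTerm]; ring
    refine (hsummable.hasSum_iff_tendsto_nat).mpr ?_
    have : ∀ M : ℕ, ∑ n ∈ range M, (((N + n + 1 : ℕ) : ℂ) ^ (1 - s) - ((N + n : ℕ) : ℂ) ^ (1 - s))
        = ((N + M : ℕ) : ℂ) ^ (1 - s) - (N : ℂ) ^ (1 - s) := fun M ↦ by
      have := Finset.sum_range_sub (fun n : ℕ ↦ ((N + n : ℕ) : ℂ) ^ (1 - s)) M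
      simpa [add_assoc] using this
    simp_rw [this]
    exact hlim.sub_const _
  have hsplit := hsum.sum_add_tsum_nat_add N
  have hE : ∑' n : ℕ, zetaErrorTerm (N + n) s
      = (s - 1) * ∑' n : ℕ, ((N + n + 1 : ℕ) : ℂ) ^ (-s) + (0 - (N : ℂ) ^ (1 - s)) := by
    rw [← htel.tsum_eq, ← tsum_mul_left, ← (hsumN.mul_left (s - 1)).tsum_add htel.summable]
    rfl
  rw [zetaEntire_of_ne hs1, hz, ← hsplit, hE]
  have : ∑' n : ℕ, ((n + N + 1 : ℕ) : ℂ) ^ (-s) = ∑' n : ℕ, ((N + n + 1 : ℕ) : ℂ) ^ (-s) := by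
    simp_rw [add_comm N]
  rw [this]; ring

/-- The partial-summation formula for `(s - 1) ζ(s)`, continued to `0 < Re s`. -/
lemma zetaEntire_eq {N : ℕ} (hN : 1 ≤ N) {s : ℂ} (hs : 0 < s.re) :
    zetaEntire s = (s - 1) * ∑ n ∈ range N, ((n + 1 : ℕ) : ℂ) ^ (-s) + (N : ℂ) ^ (1 - s)
      + ∑' n : ℕ, zetaErrorTerm (N + n) s := by
  have hopen : IsOpen {z : ℂ | 0 < z.re} := isOpen_lt continuous_const continuous_re
  have hN0 : (N : ℂ) ≠ 0 := by exact_mod_cast (by omega : N ≠ 0)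
  have hd : DifferentiableOn ℂ (fun z : ℂ ↦ (z - 1) * ∑ n ∈ range N, ((n + 1 : ℕ) : ℂ) ^ (-z)
      + (N : ℂ) ^ (1 - z) + ∑' n : ℕ, zetaErrorTerm (N + n) z) {z : ℂ | 0 < z.re} := by
    refine DifferentiableOn.add (Differentiable.differentiableOn ?_) ?_
    · intro z
      refine DifferentiableAt.add (DifferentiableAt.mul (by fun_prop) ?_)
        (DifferentiableAt.const_cpow (by fun_prop) (Or.inl hN0))
      refine DifferentiableAt.fun_sum fun n _ ↦ DifferentiableAt.const_cpow (by fun_prop) (Or.inl ?_)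
      exact_mod_cast Nat.succ_ne_zero n
    · intro z hz
      -- Summability is uniform on a bounded neighbourhood staying away from the imaginary axis.
      set U : Set ℂ := {w : ℂ | z.re / 2 < w.re} ∩ Metric.ball 0 (‖z‖ + 1) with hU
      have hUo : IsOpen U := (isOpen_lt continuous_const continuous_re).inter Metric.isOpen_ball
      have hz' : 0 < z.re := hz
      have hzU : z ∈ U := ⟨show z.re / 2 < z.re by linarith, by simp⟩
      have := differentiableOn_tsum_of_summable_norm (F := fun n : ℕ ↦ zetaErrorTerm (N + n))
        (u := fun n : ℕ ↦ (‖z‖ + 2) * (‖z‖ + 1) * ((N + n : ℕ) : ℝ) ^ (-(z.re / 2) - 1))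
        ((summable_shift_rpow (by linarith) N).mul_left _)
        (fun n ↦ (differentiable_zetaErrorTerm (by omega)).differentiableOn) hUo ?_
      · exact (this.differentiableAt (hUo.mem_nhds hzU)).differentiableWithinAt
      · intro n w hw
        have hw2 : ‖w‖ < ‖z‖ + 1 := by simpa using hw.2
        have hw1 : z.re / 2 < w.re := hw.1
        refine (norm_zetaErrorTerm_le (by omega) (by linarith)).trans ?_
        have h1 : ‖w - 1‖ ≤ ‖z‖ + 2 := (norm_sub_le _ _).trans (by rw [norm_one]; linarith)
        have h2 : ((N + n : ℕ) : ℝ) ^ (-w.re - 1) ≤ ((N + n : ℕ) : ℝ) ^ (-(z.re / 2) - 1) :=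
          Real.rpow_le_rpow_of_exponent_le (by exact_mod_cast (by omega : 1 ≤ N + n)) (by linarith)
        gcongr
  have hconv : Convex ℝ {z : ℂ | 0 < z.re} := convex_halfSpace_re_gt 0
  refine AnalyticOnNhd.eqOn_of_preconnected_of_eventuallyEq
    (differentiable_zetaEntire.differentiableOn.analyticOnNhd hopen) (hd.analyticOnNhd hopen)
    hconv.isPreconnected (z₀ := 2) (by simp) ?_ hs
  have : {z : ℂ | 1 < z.re} ∈ 𝓝 (2 : ℂ) :=
    (isOpen_lt continuous_const continuous_re).mem_nhds (by simp)
  filter_upwards [this] with z hz using zetaEntire_eq_of_one_lt hN hz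

end ZetaContinuation

/-! ### Upper bounds for `ζ` and its derivatives near `Re s = 1` -/

section ZetaBounds

open Complex Filter Topology Finset

/-- Convexity-type bound for `ζ` slightly to the left of the line `Re s = 1`. -/
lemma norm_riemannZeta_le {η : ℝ} (hη : 0 < η) (hη' : η ≤ 1 / 2) :
    ∃ C : ℝ, 0 < C ∧ ∀ s : ℂ, 1 - η ≤ s.re → 1 ≤ ‖s - 1‖ → 1 ≤ ‖s‖ →
      ‖riemannZeta s‖ ≤ C * ‖s‖ ^ (2 * η) := by
  have hsK : Summable fun n : ℕ ↦ ((n + 1 : ℕ) : ℝ) ^ (-1 - η) := by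
    simpa [add_comm] using summable_shift_rpow (by linarith : -1 - η < -1) 1
  set K : ℝ := ∑' n : ℕ, ((n + 1 : ℕ) : ℝ) ^ (-1 - η) with hK
  have hK0 : 0 ≤ K := tsum_nonneg fun n ↦ by positivity
  refine ⟨(2 * K + 1) * 2 ^ (2 * η), by positivity, fun s hs h1 h2 ↦ ?_⟩
  have hs1 : s ≠ 1 := by rintro rfl; simp at h1; linarith
  set N : ℕ := ⌈‖s‖⌉₊ with hN
  have hsN : ‖s‖ ≤ N := Nat.le_ceil _
  have hN1 : 1 ≤ N := by exact_mod_cast h2.trans hsN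
  have hNR : (1 : ℝ) ≤ N := by exact_mod_cast hN1
  have hN2 : (N : ℝ) ≤ 2 * ‖s‖ := by
    have := Nat.ceil_lt_add_one (norm_nonneg s); linarith
  have b1 : ‖∑ n ∈ range N, ((n + 1 : ℕ) : ℂ) ^ (-s)‖ ≤ K * (N : ℝ) ^ (2 * η) := by
    calc ‖∑ n ∈ range N, ((n + 1 : ℕ) : ℂ) ^ (-s)‖
        ≤ ∑ n ∈ range N, ((n + 1 : ℕ) : ℝ) ^ (-1 - η) * (N : ℝ) ^ (2 * η) := by
          refine (norm_sum_le _ _).trans (sum_le_sum fun n hn ↦ ?_)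
          have hn1 : (1 : ℝ) ≤ ((n + 1 : ℕ) : ℝ) := by exact_mod_cast Nat.succ_pos n
          have hnN : ((n + 1 : ℕ) : ℝ) ≤ N := by exact_mod_cast mem_range.mp hn
          rw [norm_natCast_cpow_of_pos (Nat.succ_pos n)]
          calc ((n + 1 : ℕ) : ℝ) ^ (-s).re ≤ ((n + 1 : ℕ) : ℝ) ^ ((-1 - η) + 2 * η) :=
                Real.rpow_le_rpow_of_exponent_le hn1 (by rw [neg_re]; linarith)
            _ = ((n + 1 : ℕ) : ℝ) ^ (-1 - η) * ((n + 1 : ℕ) : ℝ) ^ (2 * η) :=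
                Real.rpow_add (by linarith) _ _
            _ ≤ _ := by gcongr
      _ = (∑ n ∈ range N, ((n + 1 : ℕ) : ℝ) ^ (-1 - η)) * (N : ℝ) ^ (2 * η) := by rw [sum_mul]
      _ ≤ K * (N : ℝ) ^ (2 * η) := by
          gcongr
          exact hsK.sum_le_tsum _ fun n _ ↦ by positivity
  have b2 : ‖(N : ℂ) ^ (1 - s)‖ ≤ (N : ℝ) ^ (2 * η) := by
    rw [norm_natCast_cpow_of_pos (by omega)]
    exact Real.rpow_le_rpow_of_exponent_le hNR (by rw [sub_re, one_re]; linarith)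
  have b3 : ‖∑' n : ℕ, zetaErrorTerm (N + n) s‖ ≤ ‖s - 1‖ * (K * (N : ℝ) ^ (2 * η)) := by
    have hsN' : Summable fun n : ℕ ↦ ((N + n : ℕ) : ℝ) ^ (-1 - η) :=
      summable_shift_rpow (by linarith) N
    have hle : ∀ n : ℕ, ‖zetaErrorTerm (N + n) s‖
        ≤ ‖s - 1‖ * ((N : ℝ) ^ (2 * η)) * ((N + n : ℕ) : ℝ) ^ (-1 - η) := fun n ↦ by
      have hn1 : (N : ℝ) ≤ ((N + n : ℕ) : ℝ) := by push_cast; linarith [(n.cast_nonneg : (0 : ℝ) ≤ n)]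
      have hn0 : (0 : ℝ) < ((N + n : ℕ) : ℝ) := by linarith
      calc ‖zetaErrorTerm (N + n) s‖ ≤ ‖s - 1‖ * ‖s‖ * ((N + n : ℕ) : ℝ) ^ (-s.re - 1) :=
            norm_zetaErrorTerm_le (by omega) (by linarith)
        _ ≤ ‖s - 1‖ * N * ((N : ℝ) ^ (-1 + 2 * η) * ((N + n : ℕ) : ℝ) ^ (-1 - η)) := by
            gcongr
            calc ((N + n : ℕ) : ℝ) ^ (-s.re - 1) ≤ ((N + n : ℕ) : ℝ) ^ ((-1 + 2 * η) + (-1 - η)) :=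
                  Real.rpow_le_rpow_of_exponent_le (by linarith) (by linarith)
              _ = ((N + n : ℕ) : ℝ) ^ (-1 + 2 * η) * ((N + n : ℕ) : ℝ) ^ (-1 - η) :=
                  Real.rpow_add hn0 _ _
              _ ≤ _ := by
                  gcongr ?_ * _
                  exact Real.rpow_le_rpow_of_nonpos (by linarith) hn1 (by linarith)
        _ = ‖s - 1‖ * (N * (N : ℝ) ^ (-1 + 2 * η)) * ((N + n : ℕ) : ℝ) ^ (-1 - η) := by ring
        _ = _ := by
            congr 2
            rw [Real.rpow_add (by linarith), Real.rpow_neg_one, ← mul_assoc,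
              mul_inv_cancel₀ (by linarith), one_mul]
    refine (tsum_of_norm_bounded ((hsN'.mul_left _).hasSum) hle).trans ?_
    rw [tsum_mul_left, mul_assoc, mul_comm K]
    gcongr
    refine Summable.tsum_le_tsum (fun n ↦ ?_) hsN' hsK
    refine Real.rpow_le_rpow_of_nonpos (by positivity) ?_ (by linarith)
    push_cast; linarith
  rw [riemannZeta_eq_zetaEntire_div hs1, norm_div, div_le_iff₀ (by linarith),
    zetaEntire_eq hN1 (by linarith)]
  calc _ ≤ ‖s - 1‖ * (K * (N : ℝ) ^ (2 * η)) + (N : ℝ) ^ (2 * η)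
        + ‖s - 1‖ * (K * (N : ℝ) ^ (2 * η)) := by
        refine (norm_add_le _ _).trans (add_le_add ((norm_add_le _ _).trans (add_le_add ?_ b2)) b3)
        rw [norm_mul]; gcongr
    _ ≤ ‖s - 1‖ * (K * (N : ℝ) ^ (2 * η)) + ‖s - 1‖ * (N : ℝ) ^ (2 * η)
        + ‖s - 1‖ * (K * (N : ℝ) ^ (2 * η)) := by
        gcongr
        exact le_mul_of_one_le_left (by positivity) h1
    _ = (2 * K + 1) * (N : ℝ) ^ (2 * η) * ‖s - 1‖ := by ring
    _ ≤ (2 * K + 1) * (2 * ‖s‖) ^ (2 * η) * ‖s - 1‖ := by gcongr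
    _ = _ := by rw [Real.mul_rpow (by norm_num) (norm_nonneg s)]; ring

/-- On `1 ≤ Re s ≤ 2`, away from the real axis, `ζ`, `ζ'` and `ζ''` grow at most like
`|Im s| ^ (1 / 20)`. -/
lemma norm_riemannZeta_deriv_le :
    ∃ C : ℝ, 0 < C ∧ ∀ s : ℂ, 1 ≤ s.re → s.re ≤ 2 → 2 ≤ |s.im| →
      ‖riemannZeta s‖ ≤ C * |s.im| ^ (1 / 20 : ℝ) ∧
      ‖deriv riemannZeta s‖ ≤ C * |s.im| ^ (1 / 20 : ℝ) ∧
      ‖deriv (deriv riemannZeta) s‖ ≤ C * |s.im| ^ (1 / 20 : ℝ) := by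
  obtain ⟨C, hC, h⟩ := norm_riemannZeta_le (η := 1 / 40) (by norm_num) (by norm_num)
  refine ⟨3200 * (C * 3 ^ (1 / 20 : ℝ)), by positivity, fun s h1 h2 h3 ↦ ?_⟩
  have hb : ∀ w ∈ Metric.closedBall s (1 / 40),
      ‖riemannZeta w‖ ≤ C * 3 ^ (1 / 20 : ℝ) * |s.im| ^ (1 / 20 : ℝ) := by
    intro w hw
    rw [Metric.mem_closedBall, dist_eq_norm] at hw
    have hre := (abs_le.mp ((abs_re_le_norm (w - s)).trans hw))
    have him := (abs_le.mp ((abs_im_le_norm (w - s)).trans hw))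
    rw [sub_re] at hre
    rw [sub_im] at him
    have h4 : 1 ≤ |w.im| := by
      rcases le_abs'.mp h3 with h | h
      · exact le_abs'.mpr (Or.inl (by linarith [him.2]))
      · exact le_abs'.mpr (Or.inr (by linarith [him.1]))
    have h5 : ‖w‖ ≤ 3 * |s.im| := by
      have a1 : ‖w‖ ≤ ‖w - s‖ + ‖s‖ := by simpa using norm_add_le (w - s) s
      have a2 : ‖s‖ ≤ |s.re| + |s.im| := norm_le_abs_re_add_abs_im s
      rw [abs_of_nonneg (by linarith : 0 ≤ s.re)] at a2
      linarith
    have h6 := h w (by linarith [hre.1]) ?_ (h4.trans (abs_im_le_norm w))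
    · refine h6.trans ?_
      rw [mul_assoc, ← Real.mul_rpow (by norm_num) (abs_nonneg _)]
      norm_num
      gcongr
    · have := abs_im_le_norm (w - 1)
      rw [sub_im, one_im, sub_zero] at this
      exact h4.trans this
  set D := C * 3 ^ (1 / 20 : ℝ) * |s.im| ^ (1 / 20 : ℝ) with hD
  have hD0 : 0 ≤ D := by positivity
  have hne : ∀ w ∈ Metric.closedBall s (1 / 40), w ≠ 1 := by
    rintro w hw rfl
    rw [Metric.mem_closedBall, dist_eq_norm] at hw
    have him := (abs_im_le_norm (1 - s)).trans hw
    rw [sub_im, one_im, zero_sub, abs_neg] at him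
    linarith
  have hdc : DiffContOnCl ℂ riemannZeta (Metric.ball s (1 / 40)) := by
    apply DifferentiableOn.diffContOnCl
    rw [closure_ball s (by norm_num)]
    exact fun w hw ↦ (differentiableAt_riemannZeta (hne w hw)).differentiableWithinAt
  have hS : ∀ w ∈ Metric.sphere s (1 / 40), ‖riemannZeta w‖ ≤ D :=
    fun w hw ↦ hb w (Metric.sphere_subset_closedBall hw)
  have e0 := hb s (Metric.mem_closedBall_self (by norm_num))
  have e1 := norm_deriv_le_of_forall_mem_sphere_norm_le (by norm_num : (0 : ℝ) < 1 / 40) hdc hS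
  have e2 := norm_iteratedDeriv_le_of_forall_mem_sphere_norm_le 2
    (by norm_num : (0 : ℝ) < 1 / 40) hdc hS
  rw [iteratedDeriv_succ, iteratedDeriv_one] at e2
  norm_num [Nat.factorial] at e1 e2
  have e3 : 3200 * (C * 3 ^ (1 / 20 : ℝ)) * |s.im| ^ (1 / 20 : ℝ) = 3200 * D := by rw [hD]; ring
  rw [e3]
  refine ⟨by linarith, by linarith, by linarith⟩

/-- Mertens' inequality, from `3 + 4 cos θ + cos 2θ ≥ 0`. -/
lemma one_le_norm_riemannZeta_product {x : ℝ} (hx : 0 < x) (y : ℝ) :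
    1 ≤ ‖riemannZeta (1 + x) ^ 3 * riemannZeta (1 + x + I * y) ^ 4 *
      riemannZeta (1 + x + 2 * I * y)‖ := by
  have := DirichletCharacter.norm_LFunction_product_ge_one (N := 1) 1 hx y
  simpa [DirichletCharacter.LFunctionTrivChar, DirichletCharacter.LFunction_modOne_eq] using this

/-- The simple pole of `ζ` at `1`, as an upper bound on `(1, 2]`. -/
lemma norm_riemannZeta_one_add_le :
    ∃ C : ℝ, 0 < C ∧ ∀ x : ℝ, 0 < x → x ≤ 1 → ‖riemannZeta (1 + x)‖ ≤ C / x := by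
  have hc : ContinuousOn (fun x : ℝ ↦ zetaEntire (1 + x)) (Set.Icc 0 1) :=
    (differentiable_zetaEntire.continuous.comp (by fun_prop)).continuousOn
  obtain ⟨C, hC⟩ := isCompact_Icc.exists_bound_of_continuousOn hc
  refine ⟨max C 1, by positivity, fun x h0 h1 ↦ ?_⟩
  have hne : (1 + x : ℂ) ≠ 1 := by simpa using h0.ne'
  rw [riemannZeta_eq_zetaEntire_div hne, norm_div, add_sub_cancel_left, norm_real,
    Real.norm_of_nonneg h0.le]
  gcongr
  exact (hC x ⟨h0.le, h1⟩).trans (le_max_left _ _)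

end ZetaBounds

/-! ### Lower bound for `ζ` and the Dirichlet series of `(Λ(n) - 1) log n` -/

section LogDerivBounds

open Complex Filter Topology Finset ArithmeticFunction LSeries

/-- A polynomial lower bound for `ζ` to the right of the line `Re s = 1`. Mertens' inequality
gives it for `Re s - 1` not too small, and the bound on `ζ'` carries it to the line. -/
lemma norm_riemannZeta_ge :
    ∃ c : ℝ, 0 < c ∧ ∀ s : ℂ, 1 < s.re → s.re ≤ 2 → 2 ≤ |s.im| →
      c / (|s.im| ^ (1 / 20 : ℝ)) ^ 4 ≤ ‖riemannZeta s‖ := by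
  obtain ⟨C₁, hC₁, h₁⟩ := norm_riemannZeta_deriv_le
  obtain ⟨C₂, hC₂, h₂⟩ := norm_riemannZeta_one_add_le
  set a : ℝ := (2 * C₁ * C₂ ^ 3)⁻¹ with ha
  have ha0 : 0 < a := by positivity
  set δ : ℝ := min 1 (a / (16 * C₁ ^ 4)) with hδ
  have hδ0 : 0 < δ := by positivity
  have hδ1 : δ ≤ 1 := min_le_left _ _
  have hδa : 16 * C₁ ^ 4 * δ ≤ a := by
    have : δ ≤ a / (16 * C₁ ^ 4) := min_le_right _ _
    rw [le_div_iff₀ (by positivity)] at this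
    linarith
  refine ⟨C₁ * δ, by positivity, fun s hs1 hs2 ht ↦ ?_⟩
  set t := s.im with ht'
  set u : ℝ := |t| ^ (1 / 20 : ℝ) with hu
  have hu1 : 1 ≤ u := Real.one_le_rpow (by linarith) (by norm_num)
  have hu0 : 0 < u := by linarith
  -- Mertens' inequality in the form `a x³ / u ≤ |ζ(1 + x + it)|⁴`.
  have mertens : ∀ x : ℝ, 0 < x → x ≤ 1 → a * x ^ 3 / u ≤ ‖riemannZeta (1 + x + I * t)‖ ^ 4 := by
    intro x hx hx1
    have h := one_le_norm_riemannZeta_product hx t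
    rw [norm_mul, norm_mul, norm_pow, norm_pow] at h
    have e1 := h₂ x hx hx1
    have e2 : ‖riemannZeta (1 + x + 2 * I * t)‖ ≤ C₁ * (2 * u) := by
      have := (h₁ (1 + x + 2 * I * t) (by simp [hx.le]) (by simp; linarith)
        (by simp [abs_mul]; linarith)).1
      refine this.trans ?_
      have e : (1 + x + 2 * I * t : ℂ).im = 2 * t := by simp
      rw [e, abs_mul, Real.mul_rpow (by positivity) (abs_nonneg t), ← hu]
      have : |(2 : ℝ)| ^ (1 / 20 : ℝ) ≤ 2 := by
        rw [abs_two]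
        calc (2 : ℝ) ^ (1 / 20 : ℝ) ≤ 2 ^ (1 : ℝ) :=
              Real.rpow_le_rpow_of_exponent_le (by norm_num) (by norm_num)
          _ = 2 := Real.rpow_one 2
      gcongr
    set z := ‖riemannZeta (1 + x + I * t)‖ ^ 4
    have hz : 0 ≤ z := by positivity
    have h' : 1 ≤ (C₂ / x) ^ 3 * z * (C₁ * (2 * u)) := h.trans (by gcongr)
    have e : (C₂ / x) ^ 3 * z * (C₁ * (2 * u)) = z * u / (a * x ^ 3) := by
      rw [ha]; field_simp
    rw [e, one_le_div (by positivity)] at h'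
    rwa [div_le_iff₀ hu0]
  have hx0 : 0 < δ / u ^ 5 := by positivity
  have hx1 : δ / u ^ 5 ≤ 1 := (div_le_one (by positivity)).mpr (hδ1.trans (one_le_pow₀ hu1))
  have big : ∀ x : ℝ, δ / u ^ 5 ≤ x → x ≤ 1 →
      2 * (C₁ * δ / u ^ 4) ≤ ‖riemannZeta (1 + x + I * t)‖ := by
    intro x hx hx'
    refine le_of_pow_le_pow_left₀ (n := 4) (by norm_num) (norm_nonneg _) ?_
    refine le_trans ?_ (mertens x (by linarith) hx')
    calc (2 * (C₁ * δ / u ^ 4)) ^ 4 = 16 * C₁ ^ 4 * δ * (δ / u ^ 5) ^ 3 / u := by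
          field_simp; ring
      _ ≤ a * x ^ 3 / u := by gcongr
  have hs : s = 1 + ((s.re - 1 : ℝ) : ℂ) + I * t := by
    apply Complex.ext <;> simp [ht']
  rcases le_total (δ / u ^ 5) (s.re - 1) with h | h
  · rw [hs]
    refine le_trans ?_ (big _ h (by linarith))
    have : 0 ≤ C₁ * δ / u ^ 4 := by positivity
    linarith
  · set s₀ : ℂ := 1 + ((δ / u ^ 5 : ℝ) : ℂ) + I * t with hs₀
    have hb := big _ le_rfl hx1
    have hre0 : s₀.re = 1 + δ / u ^ 5 := by
      rw [hs₀, add_re, add_re, ofReal_re]; simp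
    have him0 : s₀.im = t := by
      rw [hs₀, add_im, add_im, ofReal_im]; simp
    -- the horizontal segment from `s` to `s₀`
    have hconv : Convex ℝ {z : ℂ | 1 ≤ z.re ∧ z.re ≤ 2 ∧ z.im = t} := by
      intro z hz w hw α β hα hβ hαβ
      obtain ⟨z1, z2, z3⟩ := hz
      obtain ⟨w1, w2, w3⟩ := hw
      refine ⟨?_, ?_, ?_⟩
      · simp only [add_re, real_smul, re_ofReal_mul]; nlinarith
      · simp only [add_re, real_smul, re_ofReal_mul]; nlinarith
      · simp only [add_im, real_smul, im_ofReal_mul, z3, w3]; rw [← add_mul, hαβ, one_mul]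
    have hmv := hconv.norm_image_sub_le_of_norm_deriv_le (𝕜 := ℂ) (f := riemannZeta)
      (C := C₁ * u) (x := s) (y := s₀) ?_ ?_ ⟨hs1.le, hs2, rfl⟩ ⟨by linarith, by linarith, him0⟩
    · have hdist : ‖s₀ - s‖ ≤ δ / u ^ 5 := by
        have : s₀ - s = ((δ / u ^ 5 - (s.re - 1) : ℝ) : ℂ) := by
          apply Complex.ext <;> simp [hs₀, ht']; ring
        rw [this, norm_real, Real.norm_of_nonneg (by linarith)]
        linarith
      have h3 : ‖riemannZeta s₀‖ - ‖riemannZeta s‖ ≤ C₁ * u * (δ / u ^ 5) :=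
        (norm_sub_norm_le _ _).trans (hmv.trans (by gcongr))
      have h4 : C₁ * u * (δ / u ^ 5) = C₁ * δ / u ^ 4 := by field_simp
      linarith
    · rintro z ⟨z1, z2, z3⟩
      refine differentiableAt_riemannZeta ?_
      rintro rfl
      rw [← z3] at ht
      norm_num at ht
    · rintro z ⟨z1, z2, z3⟩
      have := (h₁ z z1 z2 (by rw [z3]; exact ht)).2.1
      rwa [z3] at this

lemma LSeriesSummable_vonMangoldt_sub_one {s : ℂ} (hs : 1 < s.re) :
    LSeriesSummable (fun n ↦ (Λ n : ℂ) - 1) s :=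
  (LSeriesSummable_vonMangoldt hs).sub (LSeriesSummable_one_iff.mpr hs)

lemma abscissaOfAbsConv_vonMangoldt_sub_one_lt {s : ℂ} (hs : 1 < s.re) :
    abscissaOfAbsConv (fun n ↦ (Λ n : ℂ) - 1) < s.re := by
  refine lt_of_le_of_lt (abscissaOfAbsConv_le_of_forall_lt_LSeriesSummable (x := 1)
    fun y hy ↦ LSeriesSummable_vonMangoldt_sub_one (by simpa using hy)) ?_
  exact_mod_cast hs

/-- The Dirichlet series of `(Λ(n) - 1) log n`. -/
lemma LSeries_logMul_vonMangoldt_sub_one {s : ℂ} (hs : 1 < s.re) :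
    LSeries (logMul fun n ↦ (Λ n : ℂ) - 1) s
      = deriv (fun z ↦ deriv riemannZeta z / riemannZeta z + riemannZeta z) s := by
  have h := LSeries_deriv (abscissaOfAbsConv_vonMangoldt_sub_one_lt hs)
  rw [← neg_eq_iff_eq_neg.mpr h, ← deriv.fun_neg]
  refine Filter.EventuallyEq.deriv_eq ?_
  filter_upwards [(isOpen_lt continuous_const continuous_re).mem_nhds hs] with z hz
  have hz : 1 < z.re := hz
  have e : LSeries (fun n ↦ (Λ n : ℂ) - 1) z = LSeries (fun n ↦ (Λ n : ℂ)) z - LSeries 1 z :=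
    LSeries_sub (LSeriesSummable_vonMangoldt hz) (LSeriesSummable_one_iff.mpr hz)
  rw [e, LSeries_vonMangoldt_eq_deriv_riemannZeta_div hz, LSeries_one_eq_riemannZeta hz]
  ring

/-- Uniform growth of the Dirichlet series of `(Λ(n) - 1) log n` up to the line `Re s = 1`. At
`s = 1` the double poles cancel; for large `|Im s|` the exponent `1 / 2` matters only in that it
is less than `1`. -/
lemma norm_LSeries_logMul_vonMangoldt_sub_one_le :
    ∃ C : ℝ, 0 < C ∧ ∀ s : ℂ, 1 < s.re → s.re ≤ 2 →
      ‖LSeries (logMul fun n ↦ (Λ n : ℂ) - 1) s‖ ≤ C * (1 + |s.im|) ^ (1 / 2 : ℝ) := by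
  have hζd : ∀ s : ℂ, s ≠ 1 → DifferentiableAt ℂ (deriv riemannZeta) s := fun s hs ↦
    (differentiableOn_riemannZeta.deriv isOpen_compl_singleton).differentiableAt
      (isOpen_compl_singleton.mem_nhds hs)
  obtain ⟨C, hC, hbig⟩ : ∃ C : ℝ, 0 < C ∧ ∀ s : ℂ, 1 < s.re → s.re ≤ 2 → 2 ≤ |s.im| →
      ‖LSeries (logMul fun n ↦ (Λ n : ℂ) - 1) s‖ ≤ C * (1 + |s.im|) ^ (1 / 2 : ℝ) := by
    obtain ⟨C, hC, h₁⟩ := norm_riemannZeta_deriv_le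
    obtain ⟨c, hc, h₂⟩ := norm_riemannZeta_ge
    refine ⟨C / c + (C / c) ^ 2 + C, by positivity, fun s hs1 hs2 ht ↦ ?_⟩
    have hs : s ≠ 1 := by rintro rfl; simp at hs1
    have hζ := riemannZeta_ne_zero_of_one_lt_re hs1
    rw [LSeries_logMul_vonMangoldt_sub_one hs1, deriv_fun_add ((hζd s hs).fun_div
      (differentiableAt_riemannZeta hs) hζ) (differentiableAt_riemannZeta hs),
      deriv_fun_div (hζd s hs) (differentiableAt_riemannZeta hs) hζ]
    obtain ⟨b0, b1, b2⟩ := h₁ s hs1.le hs2 ht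
    have b3 := h₂ s hs1 hs2 ht
    set u : ℝ := |s.im| ^ (1 / 20 : ℝ) with hu
    have hu1 : 1 ≤ u := Real.one_le_rpow (by linarith) (by norm_num)
    have hu10 : u ^ 10 ≤ (1 + |s.im|) ^ (1 / 2 : ℝ) := by
      rw [hu, ← Real.rpow_natCast, ← Real.rpow_mul (abs_nonneg _)]
      norm_num
      exact Real.rpow_le_rpow (abs_nonneg _) (by linarith) (by norm_num)
    have hi : ‖riemannZeta s‖⁻¹ ≤ u ^ 4 / c := by
      rw [← inv_div]
      exact inv_anti₀ (by positivity) b3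
    have e : (deriv (deriv riemannZeta) s * riemannZeta s - deriv riemannZeta s * deriv riemannZeta s)
          / riemannZeta s ^ 2 + deriv riemannZeta s
        = deriv (deriv riemannZeta) s * (riemannZeta s)⁻¹
          - (deriv riemannZeta s * (riemannZeta s)⁻¹) ^ 2 + deriv riemannZeta s := by
      field_simp
    rw [e]
    calc _ ≤ (C * u) * (u ^ 4 / c) + ((C * u) * (u ^ 4 / c)) ^ 2 + C * u := by
          refine (norm_add_le _ _).trans (add_le_add ((norm_sub_le _ _).trans (add_le_add ?_ ?_)) b1)
          · rw [norm_mul, norm_inv]; gcongr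
          · rw [norm_pow, norm_mul, norm_inv]; gcongr
      _ = C / c * u ^ 5 + (C / c) ^ 2 * u ^ 10 + C * u ^ 1 := by ring
      _ ≤ C / c * u ^ 10 + (C / c) ^ 2 * u ^ 10 + C * u ^ 10 := by
          gcongr <;> first | exact hu1 | norm_num
      _ = (C / c + (C / c) ^ 2 + C) * u ^ 10 := by ring
      _ ≤ _ := by gcongr
  obtain ⟨C', hsmall⟩ : ∃ C' : ℝ, ∀ s : ℂ, 1 < s.re → s.re ≤ 2 → |s.im| ≤ 2 →
      ‖LSeries (logMul fun n ↦ (Λ n : ℂ) - 1) s‖ ≤ C' := by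
    -- On this rectangle the function is the derivative of `(E - 1) / (s - 1) + E' / E`, where
    -- `E = (s - 1) ζ(s)`.
    have hE := differentiable_zetaEntire
    have hE' : Differentiable ℂ (deriv zetaEntire) := by
      rw [← differentiableOn_univ] at hE ⊢
      exact hE.deriv isOpen_univ
    have hE'' : Differentiable ℂ (deriv (deriv zetaEntire)) := by
      rw [← differentiableOn_univ] at hE' ⊢
      exact hE'.deriv isOpen_univ
    have hS : Differentiable ℂ (dslope zetaEntire 1) := by
      rw [← differentiableOn_univ] at hE ⊢
      exact (differentiableOn_dslope Filter.univ_mem).mpr hE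
    have hS' : Differentiable ℂ (deriv (dslope zetaEntire 1)) := by
      rw [← differentiableOn_univ] at hS ⊢
      exact hS.deriv isOpen_univ
    have hcont : ContinuousOn (fun s ↦ deriv (dslope zetaEntire 1) s
        + (deriv (deriv zetaEntire) s * zetaEntire s - deriv zetaEntire s * deriv zetaEntire s)
          / zetaEntire s ^ 2) (Set.Icc 1 2 ×ℂ Set.Icc (-2) 2) := by
      refine hS'.continuous.continuousOn.add (ContinuousOn.div ?_ ?_ fun s hs ↦ ?_)
      · exact ((hE''.continuous.mul hE.continuous).sub
          (hE'.continuous.mul hE'.continuous)).continuousOn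
      · exact (hE.continuous.pow 2).continuousOn
      · exact pow_ne_zero _ (zetaEntire_ne_zero hs.1.1)
    obtain ⟨C', hC'⟩ := (isCompact_Icc.reProdIm isCompact_Icc).exists_bound_of_continuousOn hcont
    refine ⟨C', fun s hs1 hs2 ht ↦ ?_⟩
    have e : LSeries (logMul fun n ↦ (Λ n : ℂ) - 1) s = deriv (dslope zetaEntire 1) s
        + (deriv (deriv zetaEntire) s * zetaEntire s - deriv zetaEntire s * deriv zetaEntire s)
          / zetaEntire s ^ 2 := by
      rw [LSeries_logMul_vonMangoldt_sub_one hs1, ← deriv_fun_div (hE' s) (hE s)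
        (zetaEntire_ne_zero hs1.le), ← deriv_fun_add (hS s)
        ((hE' s).fun_div (hE s) (zetaEntire_ne_zero hs1.le))]
      refine Filter.EventuallyEq.deriv_eq ?_
      filter_upwards [(isOpen_lt continuous_const continuous_re).mem_nhds hs1] with z hz
      have hz : 1 < z.re := hz
      have hz1 : z ≠ 1 := by rintro rfl; simp at hz
      have hz2 : z - 1 ≠ 0 := sub_ne_zero.mpr hz1
      have hzE := zetaEntire_ne_zero hz.le
      have hd : deriv riemannZeta z
          = (deriv zetaEntire z * (z - 1) - zetaEntire z) / (z - 1) ^ 2 := by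
        have : riemannZeta =ᶠ[𝓝 z] fun w ↦ zetaEntire w / (w - 1) := by
          filter_upwards [eventually_ne_nhds hz1] with w hw using riemannZeta_eq_zetaEntire_div hw
        rw [this.deriv_eq, deriv_fun_div (hE z) (by fun_prop) hz2]
        simp
      rw [hd, riemannZeta_eq_zetaEntire_div hz1, dslope_of_ne _ hz1, slope_def_field,
        zetaEntire_one]
      field_simp
      ring
    rw [e]
    exact hC' s ⟨⟨hs1.le, hs2⟩, abs_le.mp ht⟩
  refine ⟨max C C', by positivity, fun s hs1 hs2 ↦ ?_⟩
  have h1 : (1 : ℝ) ≤ (1 + |s.im|) ^ (1 / 2 : ℝ) :=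
    Real.one_le_rpow (by linarith [abs_nonneg s.im]) (by norm_num)
  rcases le_total 2 |s.im| with h | h
  · refine (hbig s hs1 hs2 h).trans ?_
    gcongr; exact le_max_left _ _
  · refine (hsmall s hs1 hs2 h).trans ((le_max_right C C').trans ?_)
    exact le_mul_of_one_le_right (by positivity) h1

end LogDerivBounds

/-! ### Cesàro-weighted Perron integrals -/

section Perron

open Complex Filter Topology Finset ArithmeticFunction LSeries

/-- The Mellin transform of the Cesàro kernel `max (1 - v) 0`. -/
lemma hasMellin_cesaro {s : ℂ} (hs : 0 < s.re) :
    HasMellin (fun v : ℝ ↦ ((max (1 - v) 0 : ℝ) : ℂ)) s (1 / (s * (s + 1))) := by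
  have h := hasMellin_sub (hasMellin_one_Ioc hs).1 (hasMellin_cpow_Ioc 1 (s := s) (by simp; linarith)).1
  have hs0 : s ≠ 0 := by rintro rfl; simp at hs
  have hs1 : s + 1 ≠ 0 := fun h0 ↦ by
    have := congrArg re h0; simp at this; linarith
  rw [(hasMellin_one_Ioc hs).2, (hasMellin_cpow_Ioc 1 (s := s) (by simp; linarith)).2] at h
  have e : 1 / s - 1 / (s + 1) = 1 / (s * (s + 1)) := by field_simp; ring
  rw [e] at h
  have hfun : ∀ v ∈ Set.Ioi (0 : ℝ), (Set.Ioc 0 1).indicator (fun _ ↦ (1 : ℂ)) v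
      - (Set.Ioc 0 1).indicator (fun t : ℝ ↦ (t : ℂ) ^ (1 : ℂ)) v
      = ((max (1 - v) 0 : ℝ) : ℂ) := by
    intro v hv
    by_cases h1 : v ≤ 1
    · have : v ∈ Set.Ioc (0 : ℝ) 1 := ⟨hv, h1⟩
      rw [Set.indicator_of_mem this, Set.indicator_of_mem this, max_eq_left (by linarith)]
      simp
    · have : v ∉ Set.Ioc (0 : ℝ) 1 := fun h ↦ h1 h.2
      rw [Set.indicator_of_notMem this, Set.indicator_of_notMem this,
        max_eq_right (by linarith [not_le.mp h1])]
      simp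
  obtain ⟨hc, hm⟩ := h
  refine ⟨?_, ?_⟩
  · unfold MellinConvergent at hc ⊢
    refine hc.congr_fun (fun v hv ↦ ?_) measurableSet_Ioi
    simp only [hfun v hv]
  · rw [← hm]
    unfold mellin
    refine setIntegral_congr_fun measurableSet_Ioi fun v hv ↦ ?_
    simp only [hfun v hv]

lemma norm_cesaro_mellin_le {σ : ℝ} (hσ : 1 ≤ σ) (t : ℝ) :
    ‖1 / (((σ : ℂ) + t * I) * ((σ : ℂ) + t * I + 1))‖ ≤ 2 * (1 + |t|) ^ (-2 : ℝ) := by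
  have h1 : ∀ z : ℂ, 1 ≤ z.re → z.im = t → Real.sqrt (1 + t ^ 2) ≤ ‖z‖ := fun z hz hzt ↦ by
    rw [norm_def, normSq_apply, hzt]
    exact Real.sqrt_le_sqrt (by nlinarith)
  have e1 := h1 (σ + t * I) (by simpa using hσ) (by simp)
  have e2 := h1 (σ + t * I + 1) (by simp; linarith) (by simp)
  rw [norm_div, norm_one, norm_mul, Real.rpow_neg (by positivity), ← div_eq_mul_inv,
    div_le_div_iff₀ (mul_pos ((Real.sqrt_pos.mpr (by positivity)).trans_le e1)
      ((Real.sqrt_pos.mpr (by positivity)).trans_le e2)) (by positivity)]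
  have h3 := mul_le_mul e1 e2 (Real.sqrt_nonneg _) (norm_nonneg _)
  rw [Real.mul_self_sqrt (by positivity)] at h3
  have h4 : (1 + |t|) ^ (2 : ℝ) ≤ 2 * (1 + t ^ 2) := by
    rw [Real.rpow_two]; nlinarith [sq_abs t, sq_nonneg (1 - |t|)]
  linarith

lemma integrable_one_add_abs_rpow {r : ℝ} (hr : 1 < r) :
    Integrable fun t : ℝ ↦ (1 + |t|) ^ (-r) := by
  have := integrable_one_add_norm (E := ℝ) (μ := volume) (r := r) (by simpa using hr)
  simpa [Real.norm_eq_abs] using this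

lemma integrable_cesaro_mellin {σ : ℝ} (hσ : 1 ≤ σ) :
    Integrable fun t : ℝ ↦ 1 / (((σ : ℂ) + t * I) * ((σ : ℂ) + t * I + 1)) := by
  refine ((integrable_one_add_abs_rpow (r := 2) (by norm_num)).const_mul 2).mono'
    (Continuous.aestronglyMeasurable ?_) (ae_of_all _ (norm_cesaro_mellin_le hσ))
  refine continuous_const.div (by fun_prop) fun t h0 ↦ ?_
  rcases mul_eq_zero.mp h0 with h | h
  all_goals
    have := congrArg re h
    simp at this
    linarith

lemma cesaro_eq_integral {σ : ℝ} (hσ : 1 ≤ σ) {v : ℝ} (hv : 0 < v) :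
    ((max (1 - v) 0 : ℝ) : ℂ) = (1 / (2 * Real.pi) : ℝ) * ∫ t : ℝ, (v : ℂ) ^ (-((σ : ℂ) + t * I)) *
      (1 / (((σ : ℂ) + t * I) * ((σ : ℂ) + t * I + 1))) := by
  have hre : ∀ t : ℝ, 0 < ((σ : ℂ) + t * I).re := fun t ↦ by simp; linarith
  have hmel : ∀ t : ℝ, mellin (fun v : ℝ ↦ ((max (1 - v) 0 : ℝ) : ℂ)) ((σ : ℂ) + t * I)
      = 1 / (((σ : ℂ) + t * I) * ((σ : ℂ) + t * I + 1)) := fun t ↦ (hasMellin_cesaro (hre t)).2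
  have h := mellinInv_mellin_eq σ (fun v : ℝ ↦ ((max (1 - v) 0 : ℝ) : ℂ)) hv
    (hasMellin_cesaro (by simp; linarith)).1 ?_ (Continuous.continuousAt (by fun_prop))
  · rw [← h]
    simp only [mellinInv, hmel, smul_eq_mul, real_smul]
  · unfold VerticalIntegrable
    simp_rw [hmel]
    exact integrable_cesaro_mellin hσ

/-- A Cesàro-weighted partial sum is bounded by the Dirichlet series on a vertical line. -/
lemma norm_cesaro_sum_le {b : ℕ → ℂ} (hb0 : b 0 = 0) {σ : ℝ} (hσ : 1 ≤ σ)
    (hb : LSeriesSummable b σ) {x : ℝ} (hx : 0 < x) {C : ℝ}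
    (hC : ∀ t : ℝ, ‖LSeries b (σ + t * I)‖ ≤ C * (1 + |t|) ^ (1 / 2 : ℝ)) :
    ‖∑' n : ℕ, b n * ((max (1 - n / x) 0 : ℝ) : ℂ)‖
      ≤ x ^ σ * (C * ∫ t : ℝ, (1 + |t|) ^ (-(3 / 2) : ℝ)) := by
  set k : ℝ → ℂ := fun t ↦ 1 / (((σ : ℂ) + t * I) * ((σ : ℂ) + t * I + 1)) with hk
  set F : ℕ → ℝ → ℂ := fun n t ↦ term b (σ + t * I) n * ((x : ℂ) ^ ((σ : ℂ) + t * I) * k t) with hF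
  have hxn : ∀ t : ℝ, ‖(x : ℂ) ^ ((σ : ℂ) + t * I)‖ = x ^ σ := fun t ↦ by
    rw [norm_cpow_eq_rpow_re_of_pos hx]; simp
  have hterm : ∀ (n : ℕ) (t : ℝ), ‖term b (σ + t * I) n‖ = ‖term b σ n‖ := fun n t ↦ by
    simp [norm_term_eq]
  have hFn : ∀ n t, ‖F n t‖ = ‖term b σ n‖ * (x ^ σ * ‖k t‖) := fun n t ↦ by
    simp only [hF, norm_mul, hterm, hxn]
  have hx0 : (x : ℂ) ≠ 0 := by exact_mod_cast hx.ne'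
  have hxc : Continuous fun t : ℝ ↦ (x : ℂ) ^ ((σ : ℂ) + t * I) :=
    Continuous.const_cpow (by fun_prop) (Or.inl hx0)
  have hki : Integrable k := integrable_cesaro_mellin hσ
  have hterm_meas : ∀ n, Continuous fun t : ℝ ↦ term b (σ + t * I) n := fun n ↦ by
    rcases eq_or_ne n 0 with rfl | hn
    · simpa using continuous_const
    · simp_rw [term_of_ne_zero hn]
      have hn0 : (n : ℂ) ≠ 0 := by exact_mod_cast hn
      refine continuous_const.div (Continuous.const_cpow (by fun_prop) (Or.inl hn0)) fun t ↦ ?_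
      simp [cpow_eq_zero_iff, hn]
  have hFi : ∀ n, Integrable (F n) := fun n ↦ by
    refine (((hki.norm.const_mul (x ^ σ)).const_mul ‖term b σ n‖)).mono' ?_
      (ae_of_all _ fun t ↦ (hFn n t).le)
    exact (hterm_meas n).aestronglyMeasurable.mul
      (hxc.aestronglyMeasurable.mul hki.aestronglyMeasurable)
  have hsum : Summable fun n ↦ ∫ t, ‖F n t‖ := by
    simp_rw [hFn, integral_const_mul]
    exact (summable_norm_iff.mpr hb).mul_right _
  have hterms : ∀ n : ℕ, b n * ((max (1 - n / x) 0 : ℝ) : ℂ)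
      = (1 / (2 * Real.pi) : ℝ) * ∫ t, F n t := fun n ↦ by
    rcases eq_or_ne n 0 with rfl | hn
    · simp [hb0, hF]
    · have hn' : (0 : ℝ) < n := by exact_mod_cast Nat.pos_of_ne_zero hn
      rw [cesaro_eq_integral hσ (div_pos hn' hx), mul_left_comm, ← integral_const_mul]
      congr 2
      ext t
      have e : ((n / x : ℝ) : ℂ) ^ (-((σ : ℂ) + t * I))
          = ((n : ℂ) ^ ((σ : ℂ) + t * I))⁻¹ * (x : ℂ) ^ ((σ : ℂ) + t * I) := by
        rw [div_eq_mul_inv, ofReal_mul, mul_cpow_ofReal_nonneg hn'.le (by positivity), ofReal_inv,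
          inv_cpow _ _ (by rw [arg_ofReal_of_nonneg hx.le]; exact Real.pi_pos.ne), cpow_neg,
          cpow_neg, inv_inv, ofReal_natCast]
      simp only [hF, hk, term_of_ne_zero hn, e]
      ring
  simp_rw [hterms]
  rw [tsum_mul_left, integral_tsum_of_summable_integral_norm hFi hsum]
  have hL : ∀ t, ∑' n, F n t = LSeries b (σ + t * I) * ((x : ℂ) ^ ((σ : ℂ) + t * I) * k t) :=
    fun t ↦ by simp only [hF, LSeries, tsum_mul_right]
  simp_rw [hL]
  have hpt : ∀ t : ℝ, ‖LSeries b (σ + t * I) * ((x : ℂ) ^ ((σ : ℂ) + t * I) * k t)‖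
      ≤ 2 * (x ^ σ * C) * (1 + |t|) ^ (-(3 / 2) : ℝ) := fun t ↦ by
    have hC0 : 0 ≤ C * (1 + |t|) ^ (1 / 2 : ℝ) := (norm_nonneg _).trans (hC t)
    rw [norm_mul, norm_mul, hxn]
    calc _ ≤ (C * (1 + |t|) ^ (1 / 2 : ℝ)) * (x ^ σ * (2 * (1 + |t|) ^ (-2 : ℝ))) := by
          gcongr
          · exact hC t
          · exact norm_cesaro_mellin_le hσ t
      _ = 2 * (x ^ σ * C) * ((1 + |t|) ^ (1 / 2 : ℝ) * (1 + |t|) ^ (-2 : ℝ)) := by ring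
      _ = _ := by
          rw [← Real.rpow_add (by positivity)]; norm_num
  have hint := norm_integral_le_of_norm_le
    ((integrable_one_add_abs_rpow (r := 3 / 2) (by norm_num)).const_mul (2 * (x ^ σ * C)))
    (ae_of_all _ hpt)
  rw [integral_const_mul] at hint
  rw [norm_mul, norm_real, Real.norm_of_nonneg (by positivity)]
  have hpi : 1 / (2 * Real.pi) ≤ 1 / 2 := by
    apply one_div_le_one_div_of_le (by norm_num)
    linarith [Real.pi_gt_three]
  calc _ ≤ 1 / 2 * (2 * (x ^ σ * C) * ∫ t : ℝ, (1 + |t|) ^ (-(3 / 2) : ℝ)) := by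
        gcongr
    _ = _ := by ring

/-- The Cesàro means of `(Λ(n) - 1) log n` are bounded: the smoothed prime number theorem with
relative error `1 / log x`. -/
lemma abs_sum_vonMangoldt_sub_one_mul_log_le :
    ∃ C : ℝ, 0 < C ∧ ∀ x : ℝ, 3 ≤ x →
      |∑ n ∈ Ioc 0 ⌊x⌋₊, (Λ n - 1) * Real.log n * (x - n)| ≤ C * x ^ 2 := by
  obtain ⟨C, hC, h⟩ := norm_LSeries_logMul_vonMangoldt_sub_one_le
  set J : ℝ := ∫ t : ℝ, (1 + |t|) ^ (-(3 / 2) : ℝ) with hJ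
  have hJ0 : 0 ≤ J := integral_nonneg fun t ↦ by positivity
  refine ⟨Real.exp 1 * (C * J) + 1, by positivity, fun x hx ↦ ?_⟩
  have hx0 : 0 < x := by linarith
  have hlog : 1 ≤ Real.log x := by
    rw [Real.le_log_iff_exp_le hx0]
    linarith [Real.exp_one_lt_d9]
  -- On the line `Re s = 1 + 1 / log x` the factor `x ^ σ` is `e x`.
  set σ : ℝ := 1 + 1 / Real.log x with hσ
  have hσ1 : 1 < σ := by
    have : 0 < 1 / Real.log x := by positivity
    linarith
  have hσ2 : σ ≤ 2 := by
    have : 1 / Real.log x ≤ 1 := (div_le_one (by linarith)).mpr hlog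
    linarith
  have hxσ : x ^ σ = Real.exp 1 * x := by
    rw [hσ, Real.rpow_add hx0, Real.rpow_one, Real.rpow_def_of_pos hx0,
      mul_one_div_cancel (by linarith), mul_comm]
  set b : ℕ → ℂ := logMul fun n ↦ (Λ n : ℂ) - 1 with hb
  have key := norm_cesaro_sum_le (b := b) (by simp [hb, logMul]) hσ1.le
    (LSeriesSummable_logMul_of_lt_re (abscissaOfAbsConv_vonMangoldt_sub_one_lt (by simpa using hσ1)))
    hx0 (C := C) (fun t ↦ by
      have := h (σ + t * I) (by simpa using hσ1) (by simpa using hσ2)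
      simpa using this)
  have hsum : ∑' n : ℕ, b n * ((max (1 - n / x) 0 : ℝ) : ℂ)
      = ((∑ n ∈ Ioc 0 ⌊x⌋₊, (Λ n - 1) * Real.log n * (x - n) : ℝ) : ℂ) / x := by
    rw [tsum_eq_sum (s := Ioc 0 ⌊x⌋₊), ofReal_sum, Finset.sum_div]
    · refine sum_congr rfl fun n hn ↦ ?_
      have hn1 := (Nat.le_floor_iff hx0.le).mp (mem_Ioc.mp hn).2
      rw [max_eq_left (by rw [sub_nonneg, div_le_one hx0]; exact hn1)]
      have hxc : (x : ℂ) ≠ 0 := by exact_mod_cast hx0.ne'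
      simp only [hb, logMul]
      push_cast
      field_simp
    · intro n hn
      rcases Nat.eq_zero_or_pos n with rfl | hpos
      · simp [hb, logMul]
      · have : x < n := by
          by_contra! hle
          exact hn (mem_Ioc.mpr ⟨hpos, Nat.le_floor hle⟩)
        rw [max_eq_right (by rw [sub_nonpos, one_le_div hx0]; exact this.le)]
        simp
  rw [hsum, norm_div, norm_real, norm_real, Real.norm_of_nonneg hx0.le, div_le_iff₀ hx0, hxσ,
    Real.norm_eq_abs] at key
  calc _ ≤ _ := key
    _ = Real.exp 1 * (C * J) * x ^ 2 := by ring
    _ ≤ _ := by gcongr; linarith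

end Perron

/-! ### The prime number theorem with an error term -/

section PrimeNumberTheorem

open Filter Topology Finset ArithmeticFunction Chebyshev Asymptotics

lemma sum_log_ge (N : ℕ) : (N : ℝ) * Real.log N - N ≤ ∑ n ∈ Ioc 0 N, Real.log n := by
  rcases Nat.eq_zero_or_pos N with rfl | hN
  · simp
  have e : ∑ n ∈ Ioc 0 N, Real.log n = Real.log (N.factorial : ℝ) := by
    clear hN
    induction N with
    | zero => simp
    | succ k ih =>
      rw [sum_Ioc_succ_top (Nat.zero_le k), ih, Nat.factorial_succ, Nat.cast_mul,
        Real.log_mul (by positivity) (by positivity), add_comm]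
  have hN' : (0 : ℝ) < N := by exact_mod_cast hN
  have h := Real.pow_div_factorial_le_exp (N : ℝ) hN'.le N
  have h2 := Real.log_le_log (by positivity) h
  rw [Real.log_exp, Real.log_div (by positivity) (by positivity), Real.log_pow] at h2
  rw [e]; linarith

/-- Differencing the Cesàro means over a window of length `h`. -/
lemma exists_abs_sum_window_le :
    ∃ C : ℝ, 0 < C ∧ ∀ x h : ℝ, 3 ≤ x → 0 ≤ h →
      |∑ n ∈ Ioc 0 ⌊x + h⌋₊, (Λ n - 1) * Real.log n * (max (x + h - n) 0 - max (x - n) 0)|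
        ≤ C * (x + h) ^ 2 := by
  obtain ⟨C, hC, H⟩ := abs_sum_vonMangoldt_sub_one_mul_log_le
  have hmax : ∀ z w : ℝ, 0 ≤ z → z ≤ w →
      ∑ n ∈ Ioc 0 ⌊w⌋₊, (Λ n - 1) * Real.log n * max (z - n) 0
        = ∑ n ∈ Ioc 0 ⌊z⌋₊, (Λ n - 1) * Real.log n * (z - n) := fun z w hz hzw ↦ by
    have hsub : Ioc 0 ⌊z⌋₊ ⊆ Ioc 0 ⌊w⌋₊ := Ioc_subset_Ioc_right (Nat.floor_mono hzw)
    rw [← sum_subset hsub]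
    · refine sum_congr rfl fun n hn ↦ ?_
      rw [max_eq_left]
      exact sub_nonneg.mpr ((Nat.le_floor_iff hz).mp (mem_Ioc.mp hn).2)
    · intro n hn hn'
      have : z < n := by
        by_contra! hle
        exact hn' (mem_Ioc.mpr ⟨(mem_Ioc.mp hn).1, Nat.le_floor hle⟩)
      rw [max_eq_right (by linarith), mul_zero]
  refine ⟨2 * C, by positivity, fun x h hx hh ↦ ?_⟩
  simp_rw [mul_sub]
  rw [sum_sub_distrib, hmax _ _ (by linarith) le_rfl, hmax x _ (by linarith) (by linarith)]
  refine (abs_sub _ _).trans ((add_le_add (H _ (by linarith)) (H x hx)).trans ?_)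
  nlinarith [mul_nonneg hC.le hh, mul_nonneg (mul_nonneg hC.le hh) (by linarith : 0 ≤ x),
    mul_nonneg (mul_nonneg hC.le hh) hh]

/-- The prime number theorem for `ψ` with relative error `1 / √(log x)`. -/
theorem exists_abs_psi_sub_le :
    ∃ C x₀ : ℝ, 0 < C ∧ 3 ≤ x₀ ∧ ∀ x : ℝ, x₀ ≤ x → |ψ x - x| ≤ C * (x / √(Real.log x)) := by
  obtain ⟨C, hC, H⟩ := exists_abs_sum_window_le
  refine ⟨20 + 16 * C, Real.exp 16, by positivity, ?_, fun x hx ↦ ?_⟩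
  · linarith [Real.add_one_le_exp (16 : ℝ)]
  have hx17 : 17 ≤ x := by linarith [Real.add_one_le_exp (16 : ℝ)]
  have hx0 : 0 < x := by linarith
  have hlog : 16 ≤ Real.log x := (Real.le_log_iff_exp_le hx0).mpr hx
  set l : ℝ := √(Real.log x) with hl
  have hl2 : l ^ 2 = Real.log x := Real.sq_sqrt (by linarith)
  have hl4 : 4 ≤ l := Real.le_sqrt_of_sq_le (by linarith)
  have hl0 : 0 < l := by linarith
  have hlx : l ≤ x := by
    have := Real.log_le_sub_one_of_pos hx0
    nlinarith
  set h : ℝ := x / l with hh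
  have hh0 : 0 < h := by positivity
  have hhl : h * l = x := div_mul_cancel₀ x hl0.ne'
  have hh1 : 1 ≤ h := (one_le_div hl0).mpr hlx
  have hh4 : 4 * h ≤ x := by nlinarith
  set F : ℝ := ∑ n ∈ Ioc 0 ⌊x⌋₊, Λ n * Real.log n with hF
  have hlogn : ∀ n : ℕ, 0 ≤ Real.log n := fun n ↦ Real.log_natCast_nonneg n
  -- Lower bound for `F`, from the window `(x - h, x]`.
  have hlow : x * l ^ 2 - (4 + C) * (x * l) ≤ F := by
    have hw := H (x - h) h (by linarith) hh0.le
    simp only [sub_add_cancel] at hw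
    set N := ⌊x - h⌋₊ with hN
    have hNle : (N : ℝ) ≤ x - h := Nat.floor_le (by linarith)
    have hNge : x - 2 * h ≤ N := by linarith [(Nat.lt_floor_add_one (x - h)).le]
    have e : ∑ n ∈ Ioc 0 ⌊x⌋₊, (Λ n - 1) * Real.log n * (max (x - n) 0 - max (x - h - n) 0)
        = ∑ n ∈ Ioc 0 ⌊x⌋₊, Λ n * Real.log n * (max (x - n) 0 - max (x - h - n) 0)
          - ∑ n ∈ Ioc 0 ⌊x⌋₊, Real.log n * (max (x - n) 0 - max (x - h - n) 0) := by
      rw [← sum_sub_distrib]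
      exact sum_congr rfl fun n _ ↦ by ring
    rw [e] at hw
    have a1 : ∑ n ∈ Ioc 0 ⌊x⌋₊, Λ n * Real.log n * (max (x - n) 0 - max (x - h - n) 0) ≤ F * h := by
      rw [hF, sum_mul]
      refine sum_le_sum fun n _ ↦ ?_
      refine mul_le_mul_of_nonneg_left ?_ (mul_nonneg vonMangoldt_nonneg (hlogn n))
      have : max (x - n) 0 ≤ max (x - h - n) 0 + h :=
        max_le (by linarith [le_max_left (x - h - n) 0]) (by linarith [le_max_right (x - h - n) 0])
      linarith
    have a2 : (∑ n ∈ Ioc 0 N, Real.log n) * h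
        ≤ ∑ n ∈ Ioc 0 ⌊x⌋₊, Real.log n * (max (x - n) 0 - max (x - h - n) 0) := by
      rw [sum_mul]
      refine (sum_le_sum fun n hn ↦ ?_).trans (sum_le_sum_of_subset_of_nonneg
        (Ioc_subset_Ioc_right (Nat.floor_mono (by linarith : x - h ≤ x))) fun n _ _ ↦ ?_)
      · refine mul_le_mul_of_nonneg_left ?_ (hlogn n)
        have := (Nat.le_floor_iff (by linarith)).mp (mem_Ioc.mp hn).2
        rw [max_eq_left (by linarith), max_eq_left (by linarith)]; linarith
      · refine mul_nonneg (hlogn n) (sub_nonneg.mpr (max_le_max (by linarith) le_rfl))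
    have a3 : (x - 2 * h) * (l ^ 2 - 2) ≤ ∑ n ∈ Ioc 0 N, Real.log n := by
      refine le_trans ?_ (sum_log_ge N)
      have hN2 : x / 2 ≤ N := by linarith
      have : l ^ 2 - 1 ≤ Real.log N := by
        have := Real.log_le_log (by linarith) hN2
        rw [Real.log_div (by linarith) (by norm_num)] at this
        linarith [Real.log_two_lt_d9]
      have h2 : (x - 2 * h) * (l ^ 2 - 2) ≤ N * (l ^ 2 - 2) :=
        mul_le_mul_of_nonneg_right hNge (by nlinarith)
      have h3 : (N : ℝ) * (l ^ 2 - 1) ≤ N * Real.log N := by gcongr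
      linarith
    have a4 := mul_le_mul_of_nonneg_right a3 hh0.le
    have a5 := (abs_le.mp hw).1
    have a6 : ((x - 2 * h) * (l ^ 2 - 2) - C * (x * l)) * h ≤ F * h := by
      have : C * (x * l) * h = C * x ^ 2 := by
        rw [show C * (x * l) * h = C * x * (h * l) by ring, hhl]; ring
      rw [sub_mul, this]; linarith
    have a7 := le_of_mul_le_mul_right a6 hh0
    have e2 : (x - 2 * h) * (l ^ 2 - 2) = x * l ^ 2 - 2 * x - 2 * (h * l) * l + 4 * h := by ring
    rw [e2, hhl] at a7
    nlinarith
  -- Upper bound for `F`, from the window `(x, x + h]`.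
  have hup : F ≤ x * l ^ 2 + (3 + 4 * C) * (x * l) := by
    have hw := H x h (by linarith) hh0.le
    have e : ∑ n ∈ Ioc 0 ⌊x + h⌋₊, (Λ n - 1) * Real.log n * (max (x + h - n) 0 - max (x - n) 0)
        = ∑ n ∈ Ioc 0 ⌊x + h⌋₊, Λ n * Real.log n * (max (x + h - n) 0 - max (x - n) 0)
          - ∑ n ∈ Ioc 0 ⌊x + h⌋₊, Real.log n * (max (x + h - n) 0 - max (x - n) 0) := by
      rw [← sum_sub_distrib]
      exact sum_congr rfl fun n _ ↦ by ring
    rw [e] at hw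
    have a1 : F * h
        ≤ ∑ n ∈ Ioc 0 ⌊x + h⌋₊, Λ n * Real.log n * (max (x + h - n) 0 - max (x - n) 0) := by
      rw [hF, sum_mul]
      refine (sum_le_sum fun n hn ↦ ?_).trans (sum_le_sum_of_subset_of_nonneg
        (Ioc_subset_Ioc_right (Nat.floor_mono (by linarith : x ≤ x + h))) fun n _ _ ↦ ?_)
      · refine mul_le_mul_of_nonneg_left ?_ (mul_nonneg vonMangoldt_nonneg (hlogn n))
        have := (Nat.le_floor_iff (by linarith)).mp (mem_Ioc.mp hn).2
        rw [max_eq_left (by linarith), max_eq_left (by linarith)]; linarith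
      · refine mul_nonneg (mul_nonneg vonMangoldt_nonneg (hlogn n))
          (sub_nonneg.mpr (max_le_max (by linarith) le_rfl))
    have a2 : ∑ n ∈ Ioc 0 ⌊x + h⌋₊, Real.log n * (max (x + h - n) 0 - max (x - n) 0)
        ≤ (x + h) * (l ^ 2 + 1) * h := by
      calc _ ≤ ∑ n ∈ Ioc 0 ⌊x + h⌋₊, (l ^ 2 + 1) * h := by
            refine sum_le_sum fun n hn ↦ ?_
            have hn1 := (Nat.le_floor_iff (by linarith)).mp (mem_Ioc.mp hn).2
            have hn0 : (0 : ℝ) < n := by exact_mod_cast (mem_Ioc.mp hn).1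
            refine mul_le_mul ?_ ?_ ?_ (by positivity)
            · have := Real.log_le_log hn0 (by linarith : (n : ℝ) ≤ 2 * x)
              rw [Real.log_mul (by norm_num) (by linarith)] at this
              linarith [Real.log_two_lt_d9]
            · have : max (x + h - n) 0 ≤ max (x - n) 0 + h :=
                max_le (by linarith [le_max_left (x - n) 0]) (by linarith [le_max_right (x - n) 0])
              linarith
            · exact sub_nonneg.mpr (max_le_max (by linarith) le_rfl)
        _ = (⌊x + h⌋₊ : ℝ) * ((l ^ 2 + 1) * h) := by simp
        _ ≤ (x + h) * ((l ^ 2 + 1) * h) := by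
            gcongr; exact Nat.floor_le (by linarith)
        _ = _ := by ring
    have a5 := (abs_le.mp hw).2
    have a6 : F * h ≤ ((x + h) * (l ^ 2 + 1) + 4 * C * (x * l)) * h := by
      have : 4 * C * (x * l) * h = 4 * C * x ^ 2 := by
        rw [show 4 * C * (x * l) * h = 4 * C * x * (h * l) by ring, hhl]; ring
      rw [add_mul, this]
      have : C * (x + h) ^ 2 ≤ C * (2 * x) ^ 2 := by gcongr; linarith
      linarith
    have a7 := le_of_mul_le_mul_right a6 hh0
    have e2 : (x + h) * (l ^ 2 + 1) = x * l ^ 2 + x + (h * l) * l + h := by ring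
    rw [e2, hhl] at a7
    nlinarith
  rw [abs_le]
  constructor
  · have h1 : F ≤ ψ x * l ^ 2 := by
      rw [hF, psi, sum_mul]
      refine sum_le_sum fun n hn ↦ mul_le_mul_of_nonneg_left ?_ vonMangoldt_nonneg
      rw [hl2]
      refine Real.log_le_log (by exact_mod_cast (mem_Ioc.mp hn).1) ?_
      exact (Nat.le_floor_iff (by linarith)).mp (mem_Ioc.mp hn).2
    have h2 : (x - (4 + C) * h) * l ^ 2 ≤ ψ x * l ^ 2 := by
      have : (x - (4 + C) * h) * l ^ 2 = x * l ^ 2 - (4 + C) * ((h * l) * l) := by ring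
      rw [this, hhl]; linarith
    have h3 := le_of_mul_le_mul_right h2 (by positivity)
    nlinarith
  · set w : ℝ := x * Real.exp (-l) with hw
    have hw0 : 0 < w := by positivity
    have hwx : w ≤ x := mul_le_of_le_one_right hx0.le (Real.exp_le_one_iff.mpr (by linarith))
    have hlogw : Real.log w = l ^ 2 - l := by
      rw [hw, Real.log_mul hx0.ne' (Real.exp_pos _).ne', Real.log_exp, hl2]; ring
    have hwh : w ≤ h := by
      rw [hw, hh, Real.exp_neg, ← div_eq_mul_inv]
      gcongr
      linarith [Real.add_one_le_exp l]
    have hψw : ψ w ≤ 6 * h := by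
      refine (psi_le_const_mul_self hw0.le).trans ?_
      have : Real.log 4 ≤ 2 := by
        rw [show (4 : ℝ) = 2 ^ 2 by norm_num, Real.log_pow]; push_cast
        linarith [Real.log_two_lt_d9]
      nlinarith
    have h1 : (ψ x - ψ w) * (l ^ 2 - l) ≤ F := by
      have hsub : Ioc 0 ⌊w⌋₊ ⊆ Ioc 0 ⌊x⌋₊ := Ioc_subset_Ioc_right (Nat.floor_mono hwx)
      rw [psi, psi, ← sum_sdiff_eq_sub hsub, sum_mul]
      refine (sum_le_sum fun n hn ↦ ?_).trans (sum_le_sum_of_subset_of_nonneg sdiff_subset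
        fun n _ _ ↦ mul_nonneg vonMangoldt_nonneg (hlogn n))
      refine mul_le_mul_of_nonneg_left ?_ vonMangoldt_nonneg
      rw [← hlogw]
      refine Real.log_le_log hw0 ?_
      obtain ⟨h1, h2⟩ := mem_sdiff.mp hn
      by_contra! hle
      exact h2 (mem_Ioc.mpr ⟨(mem_Ioc.mp h1).1, Nat.le_floor hle.le⟩)
    have h2 : (ψ x - ψ w) * (l ^ 2 - l) ≤ (x + 2 * (4 + 4 * C) * h) * (l ^ 2 - l) := by
      refine h1.trans (hup.trans ?_)
      have : (x + 2 * (4 + 4 * C) * h) * (l ^ 2 - l)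
          = x * l ^ 2 - x * l + 2 * (4 + 4 * C) * ((h * l) * l) - 2 * (4 + 4 * C) * (h * l) := by ring
      rw [this, hhl]
      nlinarith [mul_nonneg hC.le (mul_nonneg hx0.le (by linarith : 0 ≤ l - 2)),
        mul_nonneg hx0.le (by linarith : 0 ≤ l - 2)]
    have h3 := le_of_mul_le_mul_right h2 (by nlinarith)
    nlinarith

/-- The prime number theorem for `π` with relative error `1 / √(log x)`. -/
theorem exists_abs_primeCounting_sub_le :
    ∃ C x₀ : ℝ, 0 < C ∧ 3 ≤ x₀ ∧ ∀ x : ℝ, x₀ ≤ x →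
      |(Nat.primeCounting ⌊x⌋₊ : ℝ) - x / Real.log x| ≤ C * (x / (Real.log x * √(Real.log x))) := by
  obtain ⟨C₁, x₁, hC₁, hx₁, h₁⟩ := exists_abs_psi_sub_le
  obtain ⟨C₂, h₂⟩ := psi_sub_theta_le_mul_sqrt
  obtain ⟨C₃, h₃⟩ := isBigO_iff.mp primeCounting_sub_theta_div_log_isBigO
  obtain ⟨x₃, h₃⟩ := eventually_atTop.mp h₃
  refine ⟨C₁ + |C₂| + |C₃|, max x₁ x₃, by positivity, hx₁.trans (le_max_left _ _), fun x hx ↦ ?_⟩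
  have a1 := h₁ x ((le_max_left _ _).trans hx)
  have a2 := h₂ x
  have a3 := h₃ x ((le_max_right _ _).trans hx)
  have hx3 : 3 ≤ x := hx₁.trans ((le_max_left _ _).trans hx)
  have hx0 : 0 < x := by linarith
  have hlog : 1 ≤ Real.log x := by
    rw [Real.le_log_iff_exp_le hx0]
    linarith [Real.exp_one_lt_d9]
  set L := Real.log x with hL
  have hLx : L ≤ x := by linarith [Real.log_le_sub_one_of_pos hx0]
  have hs1 : 1 ≤ √L := Real.one_le_sqrt.mpr hlog
  have hsL : √L * √L = L := Real.mul_self_sqrt (by linarith)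
  have hsx : √x * √x = x := Real.mul_self_sqrt hx0.le
  have hsLx : √L ≤ √x := Real.sqrt_le_sqrt hLx
  -- `θ` against `x`
  have hsq : √x ≤ x / √L := by
    rw [le_div_iff₀ (by linarith)]
    nlinarith
  have b1 : |θ x - x| ≤ (C₁ + |C₂|) * (x / √L) := by
    have hθ := theta_le_psi x
    have hc : C₂ * √x ≤ |C₂| * (x / √L) :=
      (mul_le_mul_of_nonneg_right (le_abs_self _) (Real.sqrt_nonneg _)).trans (by gcongr)
    rw [abs_le] at a1 ⊢
    rw [add_mul]
    have : 0 ≤ |C₂| * (x / √L) := by positivity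
    constructor <;> linarith [a1.1, a1.2]
  have b2 : |θ x / L - x / L| ≤ (C₁ + |C₂|) * (x / (L * √L)) := by
    rw [← sub_div, abs_div, abs_of_pos (by linarith : 0 < L), div_le_iff₀ (by linarith)]
    refine b1.trans (le_of_eq ?_)
    field_simp
  have b3 : |(Nat.primeCounting ⌊x⌋₊ : ℝ) - θ x / L| ≤ |C₃| * (x / (L * √L)) := by
    rw [Real.norm_eq_abs] at a3
    refine a3.trans ?_
    rw [Real.norm_of_nonneg (by positivity)]
    refine mul_le_mul (le_abs_self _) ?_ (by positivity) (abs_nonneg _)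
    gcongr
    rw [sq]
    gcongr
    nlinarith
  have := abs_sub_le (Nat.primeCounting ⌊x⌋₊ : ℝ) (θ x / L) (x / L)
  linarith

end PrimeNumberTheorem

/-! ### Sums over primes as integrals of the counting function -/

section PrimeSums

open Filter Topology Set

lemma mem_primesUpTo {y : ℝ} {p : Nat.Primes} : p ∈ primesUpTo y ↔ ((p : ℕ) : ℝ) ≤ y := by
  have h : p ∈ primesUpTo y ↔ (p : ℕ) ∈ Finset.Iic ⌊y⌋₊ :=
    Finset.mem_subtype (p := Nat.Prime)
  rw [h, Finset.mem_Iic, Nat.le_floor_iff' p.2.ne_zero]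

lemma card_primesUpTo (y : ℝ) : (primesUpTo y).card = Nat.primeCounting ⌊y⌋₊ := by
  refine (Finset.card_subtype Nat.Prime (Finset.Iic ⌊y⌋₊)).trans ?_
  rw [Nat.primeCounting, Nat.primeCounting', Nat.count_eq_card_filter_range]
  congr 1
  ext n
  simp

lemma card_primesUpTo_le {y : ℝ} (hy : 0 ≤ y) : ((primesUpTo y).card : ℝ) ≤ y := by
  refine le_trans ?_ (Nat.floor_le hy)
  have h : (primesUpTo y).card ≤ (Finset.Ioc 0 ⌊y⌋₊).card :=
    Finset.card_le_card_of_injOn (fun p : Nat.Primes ↦ (p : ℕ))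
      (fun p hp ↦ Finset.mem_coe.mpr (Finset.mem_Ioc.mpr
        ⟨p.2.pos, Nat.le_floor (mem_primesUpTo.mp hp)⟩)) fun p _ q _ h ↦ Subtype.ext h
  rw [Nat.card_Ioc] at h
  exact_mod_cast h

lemma filter_primesUpTo (y t : ℝ) :
    (primesUpTo y).filter (fun p : Nat.Primes ↦ ((p : ℕ) : ℝ) ≤ t) = primesUpTo (min y t) := by
  ext p
  simp [mem_primesUpTo]

/-- Chebyshev's upper bound. -/
lemma card_primesUpTo_le_div_log {t : ℝ} (ht : 2 ≤ t) :
    ((primesUpTo t).card : ℝ) ≤ 5 * (t / Real.log t) := by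
  have hlog : 0 < Real.log t := Real.log_pos (by linarith)
  have h := Chebyshev.pi_le_log4_mul_div (x := t) (by linarith)
  rw [card_primesUpTo]
  have h4 : Real.log 4 ≤ 3 / 2 := by
    rw [show (4 : ℝ) = 2 ^ 2 by norm_num, Real.log_pow]; push_cast
    linarith [Real.log_two_lt_d9]
  have hs : Real.log √t = Real.log t / 2 := Real.log_sqrt (by linarith)
  have hsq : √t ≤ 2 * (t / Real.log t) := by
    rw [← mul_div_assoc, le_div_iff₀ hlog]
    have h1 := Real.log_le_sub_one_of_pos (Real.sqrt_pos.mpr (by linarith : 0 < t))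
    have h2 := Real.mul_self_sqrt (by linarith : 0 ≤ t)
    nlinarith [Real.sqrt_nonneg t]
  rw [hs] at h
  have e : Real.log 4 * t / (Real.log t / 2) = 2 * Real.log 4 * (t / Real.log t) := by
    field_simp
  rw [e] at h
  have : 2 * Real.log 4 * (t / Real.log t) ≤ 3 * (t / Real.log t) := by
    gcongr; linarith
  linarith

lemma le_rpow_inv_iff {x s w σ : ℝ} (hx : 0 < x) (hs : 0 < s) (hw : 0 < w) (hσ : 0 < σ) :
    x ≤ (s / w) ^ (1 / σ) ↔ w ≤ x ^ (-σ) * s := by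
  have h1 : x ≤ (s / w) ^ (1 / σ) ↔ x ^ σ ≤ s / w := by
    rw [one_div]
    exact Real.le_rpow_inv_iff_of_pos hx.le (by positivity) hσ
  rw [h1, Real.rpow_neg hx.le, inv_mul_eq_div, le_div_iff₀ hw, le_div_iff₀ (by positivity), mul_comm]

/-- Layer-cake formula: a sum over primes of `f(s p^{-σ})`, with `f(u) = ∫_0^u g`, is an integral
of `g` against the prime counting function. -/
lemma sum_primes_eq_integral {g : ℝ → ℝ} (hg : ∀ u, IntegrableOn g (Ioc 0 u)) {s σ : ℝ}
    (hs : 0 < s) (hσ : 0 < σ) (y : ℝ) :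
    IntegrableOn (fun w ↦ g w * ((primesUpTo (min y ((s / w) ^ (1 / σ)))).card : ℝ)) (Ioi 0) ∧
    ∑ p ∈ primesUpTo y, ∫ w in Ioc 0 (((p : ℕ) : ℝ) ^ (-σ) * s), g w
      = ∫ w in Ioi 0, g w * ((primesUpTo (min y ((s / w) ^ (1 / σ)))).card : ℝ) := by
  have key : ∀ w ∈ Ioi (0 : ℝ), ∑ p ∈ primesUpTo y,
      (Ioc 0 (((p : ℕ) : ℝ) ^ (-σ) * s)).indicator g w
        = g w * ((primesUpTo (min y ((s / w) ^ (1 / σ)))).card : ℝ) := by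
    intro w hw
    rw [← filter_primesUpTo, Finset.card_filter, Nat.cast_sum, Finset.mul_sum]
    refine Finset.sum_congr rfl fun p _ ↦ ?_
    have hp : (0 : ℝ) < (p : ℕ) := by exact_mod_cast p.2.pos
    by_cases h : w ≤ ((p : ℕ) : ℝ) ^ (-σ) * s
    · rw [indicator_of_mem (show w ∈ Ioc 0 _ from ⟨hw, h⟩),
        if_pos ((le_rpow_inv_iff hp hs hw hσ).mpr h)]
      simp
    · rw [indicator_of_notMem (fun h' ↦ h h'.2),
        if_neg (fun h' ↦ h ((le_rpow_inv_iff hp hs hw hσ).mp h'))]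
      simp
  have hint : ∀ p ∈ primesUpTo y, IntegrableOn
      (fun w ↦ (Ioc 0 (((p : ℕ) : ℝ) ^ (-σ) * s)).indicator g w) (Ioi 0) := fun p _ ↦ by
    refine Integrable.integrableOn ?_
    exact (integrable_indicator_iff measurableSet_Ioc).mpr (hg _)
  constructor
  · refine IntegrableOn.congr_fun (integrable_finsetSum _ hint) (fun w hw ↦ ?_) measurableSet_Ioi
    exact key w hw
  · rw [← setIntegral_congr_fun measurableSet_Ioi key, integral_finsetSum _ hint]
    refine Finset.sum_congr rfl fun p _ ↦ ?_
    rw [setIntegral_indicator measurableSet_Ioc]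
    congr 2
    ext w
    simp +contextual

/-- Bounding the prime counting function by `x` in the layer-cake formula. -/
lemma sum_primes_le {g : ℝ → ℝ} (hg : ∀ u, IntegrableOn g (Ioc 0 u)) (hg0 : ∀ w, 0 < w → 0 ≤ g w)
    {s σ : ℝ} (hs : 0 < s) (hσ : 0 < σ) (y : ℝ)
    (hgi : IntegrableOn (fun w ↦ g w * w ^ (-(1 / σ))) (Ioi 0)) :
    ∑ p ∈ primesUpTo y, ∫ w in Ioc 0 (((p : ℕ) : ℝ) ^ (-σ) * s), g w
      ≤ s ^ (1 / σ) * ∫ w in Ioi 0, g w * w ^ (-(1 / σ)) := by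
  obtain ⟨h1, h2⟩ := sum_primes_eq_integral hg hs hσ y
  rw [h2, ← integral_const_mul]
  refine setIntegral_mono_on h1 (hgi.const_mul _) measurableSet_Ioi fun w hw ↦ ?_
  have hw : 0 < w := hw
  have hc : ((primesUpTo (min y ((s / w) ^ (1 / σ)))).card : ℝ) ≤ (s / w) ^ (1 / σ) := by
    refine le_trans ?_ (card_primesUpTo_le (by positivity))
    exact_mod_cast Finset.card_le_card fun p hp ↦
      mem_primesUpTo.mpr ((mem_primesUpTo.mp hp).trans (min_le_right _ _))
  calc _ ≤ g w * (s / w) ^ (1 / σ) := mul_le_mul_of_nonneg_left hc (hg0 w hw)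
    _ = _ := by rw [Real.div_rpow hs.le hw.le, Real.rpow_neg hw.le]; ring

/-- The prime number theorem at `(s / w) ^ α`, for fixed `α` and large `s`, uniformly in `w`: the
slowly varying factor `log (s / w)` may be replaced by `log s` at the cost of a small power of
`w`. -/
lemma exists_abs_card_primesUpTo_sub_le {α ε : ℝ} (hα : 1 ≤ α) (hε : 0 < ε) :
    ∃ C s₀ : ℝ, 0 < C ∧ 3 ≤ s₀ ∧ ∀ s, s₀ ≤ s → ∀ w, 0 < w →
      |((primesUpTo ((s / w) ^ α)).card : ℝ) - (s / w) ^ α / (α * Real.log s)|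
        ≤ C * ((s / w) ^ α / (Real.log s * √(Real.log s)) * (w ^ ε + w ^ (-ε))) := by
  obtain ⟨C, x₀, hC, hx₀, H⟩ := exists_abs_primeCounting_sub_le
  refine ⟨4 * C + 2 / ε + 16 / ε ^ 2, x₀ ^ 2, by positivity, by nlinarith, fun s hs w hw ↦ ?_⟩
  have hs0 : 0 < s := by nlinarith
  have hlx : 1 ≤ Real.log x₀ := by
    rw [Real.le_log_iff_exp_le (by linarith)]
    linarith [Real.exp_one_lt_d9]
  set l := Real.log s with hl
  have hl2 : 2 * Real.log x₀ ≤ l := by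
    have := Real.log_le_log (by positivity) hs
    rwa [Real.log_pow, Nat.cast_ofNat] at this
  have hl1 : 2 ≤ l := by linarith
  set t := (s / w) ^ α with ht
  have ht0 : 0 < t := by positivity
  have hlt : Real.log t = α * (l - Real.log w) := by
    rw [ht, Real.log_rpow (by positivity), Real.log_div hs0.ne' hw.ne']
  set m := Real.log w with hm
  set Q := w ^ ε + w ^ (-ε) with hQ
  have hwε : w ^ ε = Real.exp (ε * m) := by rw [Real.rpow_def_of_pos hw, mul_comm]
  have hwε' : w ^ (-ε) = Real.exp (-(ε * m)) := by
    rw [Real.rpow_def_of_pos hw, mul_neg, mul_comm]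
  have hQe : Real.exp (ε * |m|) ≤ Q := by
    rw [hQ, hwε, hwε']
    rcases abs_cases m with ⟨h, _⟩ | ⟨h, _⟩
    · rw [h]; linarith [Real.exp_pos (-(ε * m))]
    · rw [h, mul_neg]; linarith [Real.exp_pos (ε * m)]
  have hQ1 : 1 ≤ Q := (Real.one_le_exp (by positivity)).trans hQe
  have hsl : √l * √l = l := Real.mul_self_sqrt (by linarith)
  have hsl1 : 1 ≤ √l := Real.one_le_sqrt.mpr (by linarith)
  have hsll : √l ≤ l := by nlinarith
  set D := t / (l * √l) with hD
  have hD0 : 0 < D := by positivity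
  have hDQ : D ≤ D * Q := le_mul_of_one_le_right hD0.le hQ1
  rcases le_total |m| (l / 2) with h | h
  · have hml := (abs_le.mp h).2
    have hlt2 : l / 2 ≤ Real.log t := by rw [hlt]; nlinarith
    have htx : x₀ ≤ t := by
      rw [← Real.log_le_log_iff (by linarith) ht0]; linarith
    have h1 := H t htx
    rw [← card_primesUpTo] at h1
    have h2 : t / (Real.log t * √(Real.log t)) ≤ 4 * D := by
      have hs4 : √l / 2 ≤ √(Real.log t) := by
        apply Real.le_sqrt_of_sq_le
        rw [div_pow, sq, hsl]; linarith
      have hltp : 0 ≤ Real.log t := by linarith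
      calc t / (Real.log t * √(Real.log t)) ≤ t / (l / 2 * (√l / 2)) := by gcongr
        _ = 4 * D := by rw [hD]; field_simp; norm_num
    have h3 : |t / Real.log t - t / (α * l)| ≤ 2 / ε * (D * Q) := by
      have hltp : 0 < Real.log t := by linarith
      have e : t / Real.log t - t / (α * l) = t * m / (Real.log t * l) := by
        rw [div_sub_div _ _ hltp.ne' (by positivity), div_eq_div_iff (by positivity) (by positivity),
          hlt]
        ring
      rw [e, abs_div, abs_mul, abs_of_pos ht0, abs_of_pos (by positivity : 0 < Real.log t * l)]
      have hmQ : |m| ≤ Q / ε := by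
        rw [le_div_iff₀ hε]
        linarith [Real.add_one_le_exp (ε * |m|)]
      calc t * |m| / (Real.log t * l) ≤ t * (Q / ε) / (l / 2 * l) := by gcongr
        _ = 2 / ε * (t / (l * l) * Q) := by field_simp
        _ ≤ 2 / ε * (D * Q) := by
            rw [hD]; gcongr
    have h4 := abs_sub_le ((primesUpTo t).card : ℝ) (t / Real.log t) (t / (α * l))
    have h5 : C * (t / (Real.log t * √(Real.log t))) ≤ C * (4 * (D * Q)) := by
      gcongr; linarith
    have h6 : 0 ≤ 16 / ε ^ 2 * (D * Q) := by positivity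
    rw [add_mul, add_mul]
    linarith
  · have h1 : |((primesUpTo t).card : ℝ) - t / (α * l)| ≤ t := by
      have a1 := card_primesUpTo_le ht0.le
      have a2 : (0 : ℝ) ≤ ((primesUpTo t).card : ℝ) := Nat.cast_nonneg _
      have a3 : t / (α * l) ≤ t := div_le_self ht0.le (by nlinarith)
      have a4 : 0 ≤ t / (α * l) := by positivity
      rw [abs_le]; constructor <;> linarith
    have h2 : l * √l ≤ 8 / ε ^ 2 * Q := by
      have b1 : (ε * (l / 2)) ^ 2 / 2 ≤ Real.exp (ε * (l / 2)) := by
        have := Real.quadratic_le_exp_of_nonneg (x := ε * (l / 2)) (by positivity)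
        nlinarith [mul_pos hε (by linarith : 0 < l / 2)]
      have b2 : Real.exp (ε * (l / 2)) ≤ Q := le_trans (by gcongr) hQe
      have b3 : l * √l ≤ 8 / ε ^ 2 * ((ε * (l / 2)) ^ 2 / 2) := by
        have : 8 / ε ^ 2 * ((ε * (l / 2)) ^ 2 / 2) = l * l := by field_simp; norm_num
        rw [this]; gcongr
      refine b3.trans ?_
      gcongr; linarith
    have h3 : t ≤ 8 / ε ^ 2 * (D * Q) := by
      calc t = D * (l * √l) := by rw [hD]; field_simp
        _ ≤ D * (8 / ε ^ 2 * Q) := by gcongr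
        _ = _ := by ring
    have h6 : 0 ≤ 8 / ε ^ 2 * (D * Q) := by positivity
    have h7 : 0 ≤ 2 / ε * (D * Q) := by positivity
    have h8 : 0 ≤ 4 * C * (D * Q) := by positivity
    have h9 : 16 / ε ^ 2 * (D * Q) = 2 * (8 / ε ^ 2 * (D * Q)) := by ring
    rw [add_mul, add_mul, h9]
    linarith

end PrimeSums

/-! ### Sums over primes of a cumulant generating function -/

section CumulantSums

open Filter Topology Set

/-- Analytic properties of the cumulant generating function `f` of a bounded centred real random
variable, on the half-line `u ≥ 0`: its derivative `g` is continuous, nonnegative and at most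
`K min (1, u)`. -/
structure IsCumulantProfile (f g : ℝ → ℝ) (K : ℝ) : Prop where
  K_pos : 0 < K
  cont : Continuous g
  hasDerivAt : ∀ u, HasDerivAt f (g u) u
  zero : f 0 = 0
  nonneg : ∀ u, 0 ≤ u → 0 ≤ g u
  le_const : ∀ u, 0 ≤ u → g u ≤ K
  le_lin : ∀ u, 0 ≤ u → g u ≤ K * u

lemma rpow_three_halves {l : ℝ} (hl : 0 ≤ l) : l ^ (3 / 2 : ℝ) = l * √l := by
  rw [Real.sqrt_eq_rpow, ← Real.rpow_one_add' hl (by norm_num)]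
  norm_num

lemma integrableOn_mul_rpow {g : ℝ → ℝ} {K a : ℝ}
    (hm : AEStronglyMeasurable g (volume.restrict (Ioi 0)))
    (h1 : ∀ w, 0 < w → |g w| ≤ K) (h2 : ∀ w, 0 < w → |g w| ≤ K * w) (ha : -2 < a) (ha' : a < -1) :
    IntegrableOn (fun w ↦ g w * w ^ a) (Ioi 0) := by
  have hmeas : AEStronglyMeasurable (fun w ↦ g w * w ^ a) (volume.restrict (Ioi 0)) :=
    hm.mul (by fun_prop : Measurable fun w : ℝ ↦ w ^ a).aestronglyMeasurable
  rw [← Ioc_union_Ioi_eq_Ioi (zero_le_one (α := ℝ))]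
  refine IntegrableOn.union ?_ ?_
  · have hi : IntegrableOn (fun w : ℝ ↦ K * w ^ (a + 1)) (Ioc 0 1) := by
      refine Integrable.const_mul ?_ K
      exact (intervalIntegrable_iff_integrableOn_Ioc_of_le zero_le_one).mp
        (intervalIntegral.intervalIntegrable_rpow' (by linarith))
    refine Integrable.mono' hi (hmeas.mono_set Ioc_subset_Ioi_self) ?_
    filter_upwards [ae_restrict_mem measurableSet_Ioc] with w hw
    have hw0 : 0 < w := hw.1
    rw [norm_mul, Real.norm_eq_abs, Real.norm_of_nonneg (by positivity)]
    calc |g w| * w ^ a ≤ K * w * w ^ a := by gcongr; exact h2 w hw0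
      _ = K * w ^ (a + 1) := by rw [Real.rpow_add_one hw0.ne']; ring
  · have hi : IntegrableOn (fun w : ℝ ↦ K * w ^ a) (Ioi 1) :=
      (integrableOn_Ioi_rpow_of_lt ha' one_pos).const_mul K
    refine Integrable.mono' hi (hmeas.mono_set (Ioi_subset_Ioi zero_le_one)) ?_
    filter_upwards [ae_restrict_mem measurableSet_Ioi] with w hw
    have hw0 : 0 < w := lt_trans one_pos hw
    rw [norm_mul, Real.norm_eq_abs, Real.norm_of_nonneg (by positivity)]
    gcongr
    exact h1 w hw0

namespace IsCumulantProfile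

variable {f g : ℝ → ℝ} {K : ℝ}

lemma eq_integral (h : IsCumulantProfile f g K) {u : ℝ} (hu : 0 ≤ u) :
    ∫ w in Ioc 0 u, g w = f u := by
  rw [← intervalIntegral.integral_of_le hu, intervalIntegral.integral_eq_sub_of_hasDerivAt
    (fun x _ ↦ h.hasDerivAt x) (h.cont.intervalIntegrable _ _), h.zero, sub_zero]

lemma integrableOn_Ioc (h : IsCumulantProfile f g K) (u : ℝ) : IntegrableOn g (Ioc 0 u) :=
  h.cont.integrableOn_Ioc

lemma f_nonneg (h : IsCumulantProfile f g K) {u : ℝ} (hu : 0 ≤ u) : 0 ≤ f u := by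
  rw [← h.eq_integral hu]
  exact setIntegral_nonneg measurableSet_Ioc fun w hw ↦ h.nonneg w hw.1.le

lemma f_le_of_bound (h : IsCumulantProfile f g K) {u B : ℝ} (hu : 0 ≤ u)
    (hB : ∀ w ∈ Ioc 0 u, g w ≤ B) : f u ≤ B * u := by
  rw [← h.eq_integral hu]
  calc ∫ w in Ioc 0 u, g w ≤ ∫ _ in Ioc 0 u, B :=
        setIntegral_mono_on (h.integrableOn_Ioc u) (by simp) measurableSet_Ioc hB
    _ = B * u := by simp [hu, mul_comm]

lemma f_le_const (h : IsCumulantProfile f g K) {u : ℝ} (hu : 0 ≤ u) : f u ≤ K * u :=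
  h.f_le_of_bound hu fun w hw ↦ h.le_const w hw.1.le

lemma f_le_sq (h : IsCumulantProfile f g K) {u : ℝ} (hu : 0 ≤ u) : f u ≤ K * u ^ 2 := by
  have := h.f_le_of_bound (B := K * u) hu fun w hw ↦
    (h.le_lin w hw.1.le).trans (mul_le_mul_of_nonneg_left hw.2 h.K_pos.le)
  linarith

lemma integrableOn_g_mul_rpow (h : IsCumulantProfile f g K) {a : ℝ} (ha : -2 < a) (ha' : a < -1) :
    IntegrableOn (fun w ↦ g w * w ^ a) (Ioi 0) :=
  integrableOn_mul_rpow h.cont.aestronglyMeasurable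
    (fun w hw ↦ by rw [abs_of_nonneg (h.nonneg w hw.le)]; exact h.le_const w hw.le)
    (fun w hw ↦ by rw [abs_of_nonneg (h.nonneg w hw.le)]; exact h.le_lin w hw.le) ha ha'

lemma continuous_f (h : IsCumulantProfile f g K) : Continuous f :=
  continuous_iff_continuousAt.mpr fun u ↦ (h.hasDerivAt u).continuousAt

lemma integrableOn_f_div_rpow (h : IsCumulantProfile f g K) {α : ℝ} (hα : 1 < α) (hα' : α < 2) :
    IntegrableOn (fun u ↦ f u / u ^ (α + 1)) (Ioi 0) := by
  have hm : AEStronglyMeasurable (fun u ↦ f u * u⁻¹) (volume.restrict (Ioi 0)) :=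
    h.continuous_f.aestronglyMeasurable.mul measurable_inv.aestronglyMeasurable
  refine (integrableOn_mul_rpow (K := K) (a := -α) hm (fun w hw ↦ ?_) (fun w hw ↦ ?_)
    (by linarith) (by linarith)).congr_fun (fun w hw ↦ ?_) measurableSet_Ioi
  · rw [abs_of_nonneg (mul_nonneg (h.f_nonneg hw.le) (by positivity)), ← div_eq_mul_inv,
      div_le_iff₀ hw]
    exact h.f_le_const hw.le
  · rw [abs_of_nonneg (mul_nonneg (h.f_nonneg hw.le) (by positivity)), ← div_eq_mul_inv,
      div_le_iff₀ hw]
    have := h.f_le_sq hw.le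
    linarith
  · have hw : 0 < w := hw
    show f w * w⁻¹ * w ^ (-α) = f w / w ^ (α + 1)
    rw [Real.rpow_neg hw.le, Real.rpow_add_one hw.ne']
    field_simp

/-- Integration by parts in the integral defining `G`. -/
lemma integral_f_div_rpow (h : IsCumulantProfile f g K) {α : ℝ} (hα : 1 < α) (hα' : α < 2) :
    ∫ u in Ioi 0, f u / u ^ (α + 1) = (1 / α) * ∫ w in Ioi 0, g w * w ^ (-α) := by
  have hα0 : α ≠ 0 := by positivity
  have hint1 : IntegrableOn (f * fun u ↦ u ^ (-α - 1)) (Ioi 0) := by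
    refine (h.integrableOn_f_div_rpow hα hα').congr_fun (fun u hu ↦ ?_) measurableSet_Ioi
    have hu : 0 < u := hu
    show f u / u ^ (α + 1) = f u * u ^ (-α - 1)
    rw [show -α - 1 = -(α + 1) by ring, Real.rpow_neg hu.le, div_eq_mul_inv]
  have hint2 : IntegrableOn (g * fun u ↦ -(1 / α) * u ^ (-α)) (Ioi 0) := by
    refine IntegrableOn.congr_fun ((h.integrableOn_g_mul_rpow (a := -α) (by linarith)
      (by linarith)).const_mul (-(1 / α))) (fun u _ ↦ ?_) measurableSet_Ioi
    simp only [Pi.mul_apply]; ring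
  have hlim0 : Tendsto (f * fun u ↦ -(1 / α) * u ^ (-α)) (𝓝[>] 0) (𝓝 0) := by
    have h0 : Tendsto (fun u : ℝ ↦ 1 / α * (K * u ^ (2 - α))) (𝓝[>] 0) (𝓝 0) := by
      have : Tendsto (fun u : ℝ ↦ u ^ (2 - α)) (𝓝[>] 0) (𝓝 0) := by
        have := (Real.continuousAt_rpow_const 0 (2 - α) (Or.inr (by linarith))).tendsto
        rw [Real.zero_rpow (by linarith)] at this
        exact this.mono_left nhdsWithin_le_nhds
      simpa using (this.const_mul K).const_mul (1 / α)
    refine squeeze_zero_norm' ?_ h0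
    filter_upwards [self_mem_nhdsWithin] with u hu
    have hu : 0 < u := hu
    simp only [Pi.mul_apply, norm_mul, norm_neg]
    rw [Real.norm_of_nonneg (h.f_nonneg hu.le), Real.norm_of_nonneg (by positivity : 0 ≤ 1 / α),
      Real.norm_of_nonneg (by positivity)]
    calc f u * (1 / α * u ^ (-α)) ≤ K * u ^ 2 * (1 / α * u ^ (-α)) := by
          gcongr; exact h.f_le_sq hu.le
      _ = 1 / α * (K * (u ^ (2 : ℝ) * u ^ (-α))) := by rw [Real.rpow_two]; ring
      _ = _ := by rw [← Real.rpow_add hu, ← sub_eq_add_neg]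
  have hlim1 : Tendsto (f * fun u ↦ -(1 / α) * u ^ (-α)) atTop (𝓝 0) := by
    have h0 : Tendsto (fun u : ℝ ↦ 1 / α * (K * u ^ (-(α - 1)))) atTop (𝓝 0) := by
      have := tendsto_rpow_neg_atTop (by linarith : 0 < α - 1)
      simpa using (this.const_mul K).const_mul (1 / α)
    refine squeeze_zero_norm' ?_ h0
    filter_upwards [eventually_gt_atTop 0] with u hu
    simp only [Pi.mul_apply, norm_mul, norm_neg]
    rw [Real.norm_of_nonneg (h.f_nonneg hu.le), Real.norm_of_nonneg (by positivity : 0 ≤ 1 / α),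
      Real.norm_of_nonneg (by positivity)]
    calc f u * (1 / α * u ^ (-α)) ≤ K * u * (1 / α * u ^ (-α)) := by
          gcongr; exact h.f_le_const hu.le
      _ = 1 / α * (K * (u ^ (-α) * u)) := by ring
      _ = _ := by rw [← Real.rpow_add_one hu.ne']; congr 3; ring
  have key := integral_Ioi_mul_deriv_eq_deriv_mul (u := f) (u' := g)
    (v := fun u ↦ -(1 / α) * u ^ (-α)) (v' := fun u ↦ u ^ (-α - 1)) (a := 0) (a' := 0) (b' := 0)
    (fun x _ ↦ h.hasDerivAt x) (fun x hx ↦ ?_) hint1 hint2 hlim0 hlim1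
  · have e1 : ∫ u in Ioi 0, f u / u ^ (α + 1) = ∫ u in Ioi 0, f u * u ^ (-α - 1) := by
      refine setIntegral_congr_fun measurableSet_Ioi fun u hu ↦ ?_
      have hu : 0 < u := hu
      show f u / u ^ (α + 1) = f u * u ^ (-α - 1)
      rw [show -α - 1 = -(α + 1) by ring, Real.rpow_neg hu.le, div_eq_mul_inv]
    rw [e1, key, ← integral_const_mul, sub_zero, zero_sub, ← integral_neg]
    congr 1
    ext u
    ring
  · have hx : 0 < x := hx
    have := (Real.hasDerivAt_rpow_const (x := x) (p := -α) (Or.inl hx.ne')).const_mul (-(1 / α))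
    convert this using 1
    field_simp

/-- The sum of `f(s p^{-σ})` over the primes, from the prime number theorem. The lower bound has
an extra term for the primes beyond `y`. -/
lemma exists_sum_bounds (h : IsCumulantProfile f g K) {σ : ℝ} (hσ : 1 / 2 < σ) (hσ' : σ < 1) :
    ∃ C s₀ : ℝ, 0 < C ∧ 3 ≤ s₀ ∧ ∀ s, s₀ ≤ s → ∀ y,
      (∑ p ∈ primesUpTo y, f (((p : ℕ) : ℝ) ^ (-σ) * s)
        ≤ s ^ (1 / σ) / Real.log s * (∫ u in Ioi 0, f u / u ^ (1 / σ + 1))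
          + C * (s ^ (1 / σ) / (Real.log s * √(Real.log s)))) ∧
      (2 ≤ y → s ^ (1 / σ) / Real.log s * (∫ u in Ioi 0, f u / u ^ (1 / σ + 1))
          - C * (s ^ (1 / σ) / (Real.log s * √(Real.log s)))
          - C * (s ^ (1 / σ) / Real.log y * (s * y ^ (-σ)) ^ (2 - 1 / σ))
        ≤ ∑ p ∈ primesUpTo y, f (((p : ℕ) : ℝ) ^ (-σ) * s)) := by
  have hσ0 : 0 < σ := by linarith
  set α : ℝ := 1 / σ with hα
  have hα1 : 1 < α := (one_lt_div hσ0).mpr hσ'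
  have hα2 : α < 2 := (div_lt_iff₀ hσ0).mpr (by linarith)
  obtain ⟨ε, hε, hε1, hε2⟩ : ∃ ε : ℝ, 0 < ε ∧ ε < α - 1 ∧ ε < 2 - α :=
    ⟨min (α - 1) (2 - α) / 2, by
      have : 0 < min (α - 1) (2 - α) := lt_min (by linarith) (by linarith)
      linarith, by
      have : 0 < min (α - 1) (2 - α) := lt_min (by linarith) (by linarith)
      linarith [min_le_left (α - 1) (2 - α)], by
      have : 0 < min (α - 1) (2 - α) := lt_min (by linarith) (by linarith)
      linarith [min_le_right (α - 1) (2 - α)]⟩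
  obtain ⟨C, s₀, hC, hs₀, H⟩ := exists_abs_card_primesUpTo_sub_le hα1.le hε
  set I : ℝ := ∫ w in Ioi 0, g w * w ^ (-α) with hI
  have hi0 := h.integrableOn_g_mul_rpow (a := -α) (by linarith) (by linarith)
  have hi1 := h.integrableOn_g_mul_rpow (a := -α + ε) (by linarith) (by linarith)
  have hi2 := h.integrableOn_g_mul_rpow (a := -α - ε) (by linarith) (by linarith)
  set J : ℝ := (∫ w in Ioi 0, g w * w ^ (-α + ε)) + ∫ w in Ioi 0, g w * w ^ (-α - ε) with hJ
  have hJ0 : 0 ≤ J := add_nonneg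
    (setIntegral_nonneg measurableSet_Ioi fun w (hw : 0 < w) ↦
      mul_nonneg (h.nonneg w hw.le) (by positivity))
    (setIntegral_nonneg measurableSet_Ioi fun w (hw : 0 < w) ↦
      mul_nonneg (h.nonneg w hw.le) (by positivity))
  have hG := h.integral_f_div_rpow hα1 hα2
  refine ⟨C * J + 5 * K / (2 - α) + 1, s₀, ?_, hs₀, fun s hs y ↦ ?_⟩
  · have := h.K_pos
    have : 0 < 2 - α := by linarith
    positivity
  have hK := h.K_pos
  have hα2' : 0 < 2 - α := by linarith
  have hs0 : 0 < s := by linarith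
  have hl : 1 ≤ Real.log s := by
    rw [Real.le_log_iff_exp_le hs0]; linarith [Real.exp_one_lt_d9]
  set l := Real.log s with hl'
  have hl0 : 0 < l := by linarith
  have hsl0 : 0 < √l := Real.sqrt_pos.mpr hl0
  obtain ⟨hint, hsum⟩ := sum_primes_eq_integral h.integrableOn_Ioc hs0 hσ0 y
  have hsum' : ∑ p ∈ primesUpTo y, f (((p : ℕ) : ℝ) ^ (-σ) * s)
      = ∫ w in Ioi 0, g w * ((primesUpTo (min y ((s / w) ^ α))).card : ℝ) := by
    rw [← hsum]
    exact Finset.sum_congr rfl fun p _ ↦ (h.eq_integral (by positivity)).symm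
  rw [hsum', hG, ← hI]
  have hdiv : ∀ w : ℝ, 0 < w → (s / w) ^ α = s ^ α * w ^ (-α) := fun w hw ↦ by
    rw [Real.div_rpow hs0.le hw.le, Real.rpow_neg hw.le, div_eq_mul_inv]
  -- the main term and the error term of the prime number theorem, integrated against `g`
  have hmain : ∀ c : ℝ, IntegrableOn (fun w ↦ g w * ((s / w) ^ α / (α * l)
        + c * ((s / w) ^ α / (l * √l) * (w ^ ε + w ^ (-ε))))) (Ioi 0) ∧
      ∫ w in Ioi 0, g w * ((s / w) ^ α / (α * l)
        + c * ((s / w) ^ α / (l * √l) * (w ^ ε + w ^ (-ε))))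
      = s ^ α / l * (1 / α * I) + c * J * (s ^ α / (l * √l)) := by
    intro c
    have e : ∀ w ∈ Ioi (0 : ℝ), s ^ α / (α * l) * (g w * w ^ (-α))
        + (c * (s ^ α / (l * √l)) * (g w * w ^ (-α + ε))
          + c * (s ^ α / (l * √l)) * (g w * w ^ (-α - ε)))
        = g w * ((s / w) ^ α / (α * l)
        + c * ((s / w) ^ α / (l * √l) * (w ^ ε + w ^ (-ε)))) := by
      intro w hw
      have hw : 0 < w := hw
      rw [hdiv w hw, Real.rpow_add hw, sub_eq_add_neg, Real.rpow_add hw]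
      ring
    have i1 := hi0.const_mul (s ^ α / (α * l))
    have i2 := hi1.const_mul (c * (s ^ α / (l * √l)))
    have i3 := hi2.const_mul (c * (s ^ α / (l * √l)))
    have i23 : IntegrableOn (fun w ↦ c * (s ^ α / (l * √l)) * (g w * w ^ (-α + ε))
        + c * (s ^ α / (l * √l)) * (g w * w ^ (-α - ε))) (Ioi 0) := i2.add i3
    refine ⟨IntegrableOn.congr_fun (i1.add i23) e measurableSet_Ioi, ?_⟩
    rw [← setIntegral_congr_fun measurableSet_Ioi e]
    rw [integral_add i1 i23, integral_add i2 i3, integral_const_mul, integral_const_mul,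
      integral_const_mul, ← hI, hJ]
    field_simp
  have hrate : 0 ≤ s ^ α / (l * √l) := by positivity
  constructor
  · obtain ⟨m1, m2⟩ := hmain C
    have : ∫ w in Ioi 0, g w * ((primesUpTo (min y ((s / w) ^ α))).card : ℝ)
        ≤ s ^ α / l * (1 / α * I) + C * J * (s ^ α / (l * √l)) := by
      rw [← m2]
      refine setIntegral_mono_on hint m1 measurableSet_Ioi fun w hw ↦ ?_
      have hw : 0 < w := hw
      refine mul_le_mul_of_nonneg_left ?_ (h.nonneg w hw.le)
      have h1 := (abs_le.mp (H s hs w hw)).2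
      have h2 : ((primesUpTo (min y ((s / w) ^ α))).card : ℝ)
          ≤ ((primesUpTo ((s / w) ^ α)).card : ℝ) := by
        exact_mod_cast Finset.card_le_card fun p hp ↦
          mem_primesUpTo.mpr ((mem_primesUpTo.mp hp).trans (min_le_right _ _))
      linarith
    refine this.trans ?_
    gcongr
    have : 0 ≤ 5 * K / (2 - α) := by positivity
    linarith
  · intro hy
    obtain ⟨m1, m2⟩ := hmain (-C)
    have hy0 : 0 < y := by linarith
    have hly : 0 < Real.log y := Real.log_pos (by linarith)
    set w₀ : ℝ := s * y ^ (-σ) with hw₀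
    have hw₀0 : 0 < w₀ := by positivity
    -- primes beyond `y` are counted only for `w < s y^{-σ}`
    set T : ℝ → ℝ := (Ioc 0 w₀).indicator fun w ↦ 5 * K * (s ^ α / Real.log y) * w ^ (1 - α) with hT
    have hTi' : IntegrableOn (fun w : ℝ ↦ 5 * K * (s ^ α / Real.log y) * w ^ (1 - α)) (Ioc 0 w₀) := by
      refine Integrable.const_mul ?_ _
      exact (intervalIntegrable_iff_integrableOn_Ioc_of_le hw₀0.le).mp
        (intervalIntegral.intervalIntegrable_rpow' (by linarith))
    have hTi : IntegrableOn T (Ioi 0) :=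
      ((integrable_indicator_iff measurableSet_Ioc).mpr hTi').integrableOn
    have hTint : ∫ w in Ioi 0, T w = 5 * K / (2 - α) * (s ^ α / Real.log y * w₀ ^ (2 - α)) := by
      rw [hT, setIntegral_indicator measurableSet_Ioc]
      have : Ioi (0 : ℝ) ∩ Ioc 0 w₀ = Ioc 0 w₀ := by ext; simp +contextual
      rw [this, integral_const_mul, ← intervalIntegral.integral_of_le hw₀0.le,
        integral_rpow (Or.inl (by linarith)), show 1 - α + 1 = 2 - α by ring,
        Real.zero_rpow hα2'.ne', sub_zero]
      ring
    have hlow : (∫ w in Ioi 0, g w * ((s / w) ^ α / (α * l)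
        + -C * ((s / w) ^ α / (l * √l) * (w ^ ε + w ^ (-ε))))) - ∫ w in Ioi 0, T w
        ≤ ∫ w in Ioi 0, g w * ((primesUpTo (min y ((s / w) ^ α))).card : ℝ) := by
      rw [← integral_sub m1 hTi]
      refine setIntegral_mono_on (m1.sub hTi) hint measurableSet_Ioi fun w hw ↦ ?_
      have hw : 0 < w := hw
      have h1 := (abs_le.mp (H s hs w hw)).1
      have hgw := h.nonneg w hw.le
      have h2 : g w * ((s / w) ^ α / (α * l)
          + -C * ((s / w) ^ α / (l * √l) * (w ^ ε + w ^ (-ε))))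
          ≤ g w * ((primesUpTo ((s / w) ^ α)).card : ℝ) :=
        mul_le_mul_of_nonneg_left (by linarith) hgw
      rcases le_or_gt ((s / w) ^ α) y with hle | hgt
      · rw [min_eq_right hle]
        have : 0 ≤ T w := indicator_nonneg (fun v hv ↦ by
          have : 0 < v := hv.1
          positivity) w
        linarith
      · rw [min_eq_left hgt.le]
        have hww : w ≤ w₀ := by
          rw [hw₀, mul_comm]
          exact (le_rpow_inv_iff hy0 hs0 hw hσ0).mp hgt.le
        have hTw : T w = 5 * K * (s ^ α / Real.log y) * w ^ (1 - α) :=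
          indicator_of_mem (show w ∈ Ioc 0 w₀ from ⟨hw, hww⟩) _
        have h3 : ((primesUpTo ((s / w) ^ α)).card : ℝ) ≤ 5 * ((s / w) ^ α / Real.log y) := by
          refine (card_primesUpTo_le_div_log (by linarith)).trans ?_
          gcongr
        have h4 : g w * ((primesUpTo ((s / w) ^ α)).card : ℝ) ≤ T w := by
          calc _ ≤ K * w * (5 * ((s / w) ^ α / Real.log y)) := by
                gcongr
                exact h.le_lin w hw.le
            _ = 5 * K * (s ^ α / Real.log y) * (w * w ^ (-α)) := by rw [hdiv w hw]; ring
            _ = T w := by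
                rw [hTw, ← Real.rpow_one_add' hw.le (by linarith), ← sub_eq_add_neg]
        have h5 : 0 ≤ g w * ((primesUpTo y).card : ℝ) := mul_nonneg hgw (Nat.cast_nonneg _)
        linarith
    rw [m2, hTint] at hlow
    have hD : 0 ≤ s ^ α / Real.log y * w₀ ^ (2 - α) := by positivity
    have e1 : C * J * (s ^ α / (l * √l)) ≤ (C * J + 5 * K / (2 - α) + 1) * (s ^ α / (l * √l)) := by
      gcongr
      have : 0 ≤ 5 * K / (2 - α) := by positivity
      linarith
    have e2 : 5 * K / (2 - α) * (s ^ α / Real.log y * w₀ ^ (2 - α))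
        ≤ (C * J + 5 * K / (2 - α) + 1) * (s ^ α / Real.log y * w₀ ^ (2 - α)) := by
      gcongr
      have : 0 ≤ C * J := by positivity
      linarith
    linarith

end IsCumulantProfile

end CumulantSums

/-! ### Replacing the summands by their limit -/

section LimitReplacement

open Filter Topology Set

/-- The primes with `s p^{-σ} ≤ ε`, where the quadratic bound is used. -/
lemma sum_primes_sq_of_le {σ s ε : ℝ} (hσ : 1 / 2 < σ) (hσ' : σ < 1) (hs : 0 < s)
    (hε : 0 < ε) (y : ℝ) :
    ∑ p ∈ primesUpTo y, (if ((p : ℕ) : ℝ) ^ (-σ) * s ≤ ε then (((p : ℕ) : ℝ) ^ (-σ) * s) ^ 2 else 0)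
      ≤ s ^ (1 / σ) * (2 / (2 - 1 / σ) * ε ^ (2 - 1 / σ)) := by
  have hσ0 : 0 < σ := by linarith
  set α : ℝ := 1 / σ with hα
  have hα1 : 1 < α := (one_lt_div hσ0).mpr hσ'
  have hα2 : α < 2 := (div_lt_iff₀ hσ0).mpr (by linarith)
  set g : ℝ → ℝ := (Ioc 0 ε).indicator fun w ↦ 2 * w with hg
  have hgi : Integrable g := by
    rw [hg, integrable_indicator_iff measurableSet_Ioc]
    exact Continuous.integrableOn_Ioc (by fun_prop)
  have e : ∀ w, g w * w ^ (-α) = (Ioc 0 ε).indicator (fun w ↦ 2 * w ^ (1 - α)) w := fun w ↦ by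
    by_cases hw : w ∈ Ioc 0 ε
    · rw [hg, indicator_of_mem hw, indicator_of_mem hw, sub_eq_add_neg,
        Real.rpow_one_add' hw.1.le (by linarith)]
      ring
    · rw [hg, indicator_of_notMem hw, indicator_of_notMem hw, zero_mul]
  have hi : IntegrableOn (fun w : ℝ ↦ 2 * w ^ (1 - α)) (Ioc 0 ε) := by
    refine Integrable.const_mul ?_ _
    exact (intervalIntegrable_iff_integrableOn_Ioc_of_le hε.le).mp
      (intervalIntegral.intervalIntegrable_rpow' (by linarith))
  have key := sum_primes_le (g := g) (fun u ↦ hgi.integrableOn)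
    (fun w _ ↦ indicator_nonneg (fun v hv ↦ by linarith [hv.1]) w) hs hσ0 y ?_
  · refine le_trans (Finset.sum_le_sum fun p _ ↦ ?_) (key.trans (le_of_eq ?_))
    · have hu : 0 ≤ ((p : ℕ) : ℝ) ^ (-σ) * s := by positivity
      set u := ((p : ℕ) : ℝ) ^ (-σ) * s
      split_ifs with h
      · have : ∫ w in Ioc 0 u, g w = ∫ w in Ioc 0 u, 2 * w := by
          refine setIntegral_congr_fun measurableSet_Ioc fun w hw ↦ ?_
          exact indicator_of_mem (show w ∈ Ioc 0 ε from ⟨hw.1, hw.2.trans h⟩) _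
        rw [this, ← intervalIntegral.integral_of_le hu, intervalIntegral.integral_const_mul,
          integral_id]
        linarith
      · exact setIntegral_nonneg measurableSet_Ioc fun w _ ↦
          indicator_nonneg (fun v hv ↦ by linarith [hv.1]) w
    · simp_rw [← hα, e]
      rw [setIntegral_indicator measurableSet_Ioc]
      have : Ioi (0 : ℝ) ∩ Ioc 0 ε = Ioc 0 ε := by ext; simp +contextual
      rw [this, integral_const_mul, ← intervalIntegral.integral_of_le hε.le,
        integral_rpow (Or.inl (by linarith)), show 1 - α + 1 = 2 - α by ring,
        Real.zero_rpow (by linarith), sub_zero]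
      ring
  · simp_rw [← hα, e]
    exact ((integrable_indicator_iff measurableSet_Ioc).mpr hi).integrableOn

/-- The primes with `s p^{-σ} ≥ 2 R`, where the linear bound is used. -/
lemma sum_primes_of_ge {σ s R : ℝ} (hσ : 0 < σ) (hσ' : σ < 1) (hs : 0 < s) (hR : 0 < R) (y : ℝ) :
    ∑ p ∈ primesUpTo y,
        (if 2 * R ≤ ((p : ℕ) : ℝ) ^ (-σ) * s then ((p : ℕ) : ℝ) ^ (-σ) * s else 0)
      ≤ s ^ (1 / σ) * (2 / (1 / σ - 1) * R ^ (1 - 1 / σ)) := by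
  set α : ℝ := 1 / σ with hα
  have hα1 : 1 < α := (one_lt_div hσ).mpr hσ'
  set g : ℝ → ℝ := (Ioi R).indicator fun _ ↦ 2 with hg
  have e : ∀ w, g w * w ^ (-α) = (Ioi R).indicator (fun w ↦ 2 * w ^ (-α)) w := fun w ↦ by
    by_cases hw : w ∈ Ioi R
    · rw [hg, indicator_of_mem hw, indicator_of_mem hw]
    · rw [hg, indicator_of_notMem hw, indicator_of_notMem hw, zero_mul]
  have hg0 : ∀ w, 0 ≤ g w := fun w ↦ indicator_nonneg (fun _ _ ↦ by norm_num) w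
  have key := sum_primes_le (g := g) (fun u ↦ ?_) (fun w _ ↦ hg0 w) hs hσ y ?_
  · refine le_trans (Finset.sum_le_sum fun p _ ↦ ?_) (key.trans (le_of_eq ?_))
    · set u := ((p : ℕ) : ℝ) ^ (-σ) * s
      split_ifs with h
      · rw [hg, setIntegral_indicator measurableSet_Ioi]
        have : Ioc 0 u ∩ Ioi R = Ioc R u := by
          ext w
          constructor
          · exact fun hw ↦ ⟨hw.2, hw.1.2⟩
          · exact fun hw ↦ ⟨⟨hR.trans hw.1, hw.2⟩, hw.1⟩
        rw [this, setIntegral_const, Real.volume_real_Ioc, max_eq_left (by linarith), smul_eq_mul]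
        linarith
      · exact setIntegral_nonneg measurableSet_Ioc fun w _ ↦ hg0 w
    · simp_rw [← hα, e]
      rw [setIntegral_indicator measurableSet_Ioi]
      have : Ioi (0 : ℝ) ∩ Ioi R = Ioi R := by
        rw [Ioi_inter_Ioi, sup_eq_right.mpr hR.le]
      rw [this, integral_const_mul, integral_Ioi_rpow_of_lt (by linarith) hR,
        show -α + 1 = 1 - α by ring, show α - 1 = -(1 - α) by ring]
      rw [div_neg]
      ring
  · have : IntegrableOn (fun _ : ℝ ↦ (2 : ℝ)) (Ioc 0 u) := by simp
    exact this.indicator measurableSet_Ioi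
  · simp_rw [← hα, e]
    exact ((integrable_indicator_iff measurableSet_Ioi).mpr
      ((integrableOn_Ioi_rpow_of_lt (by linarith) hR).const_mul 2)).integrableOn

lemma sum_primes_const_of_ge {σ s ε : ℝ} (hσ : 0 < σ) (hs : 0 < s) (hε : 0 < ε) {δ : ℝ}
    (hδ : 0 ≤ δ) (y : ℝ) :
    ∑ p ∈ primesUpTo y, (if ε ≤ ((p : ℕ) : ℝ) ^ (-σ) * s then δ else 0)
      ≤ δ * (s / ε) ^ (1 / σ) := by
  have e : ∑ p ∈ primesUpTo y, (if ε ≤ ((p : ℕ) : ℝ) ^ (-σ) * s then δ else 0)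
      = δ * ((primesUpTo (min y ((s / ε) ^ (1 / σ)))).card : ℝ) := by
    rw [← filter_primesUpTo, ← Finset.sum_filter, Finset.sum_const, nsmul_eq_mul, mul_comm]
    congr 4
    ext p
    exact (le_rpow_inv_iff (by exact_mod_cast p.2.pos) hs hε hσ).symm
  rw [e]
  gcongr
  refine le_trans ?_ (card_primesUpTo_le (by positivity))
  exact_mod_cast Finset.card_le_card fun p hp ↦
    mem_primesUpTo.mpr ((mem_primesUpTo.mp hp).trans (min_le_right _ _))

/-- Replacing each `F p` by its limit `f` changes the sum over primes by a relative
`O((log s)^{-1/2})`. The hypothesis on rates is used for `(log s)^{-b} ≤ s p^{-σ} ≤ √s`, and the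
quadratic and linear bounds outside this range. -/
lemma exists_sum_abs_sub_le {F : Nat.Primes → ℝ → ℝ} {f : ℝ → ℝ} {K σ : ℝ} (hK : 0 ≤ K)
    (hσ : 1 / 2 < σ) (hσ' : σ < 1)
    (h1 : ∀ p u, 0 ≤ u → |F p u - f u| ≤ K * u) (h2 : ∀ p u, 0 ≤ u → |F p u - f u| ≤ K * u ^ 2)
    (h3 : ∀ A : ℝ, 0 < A → ∃ C P : ℝ, ∀ p : Nat.Primes, P ≤ ((p : ℕ) : ℝ) → ∀ u, 0 ≤ u →
      |F p u - f u| ≤ C / Real.log (p : ℕ) ^ A) :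
    ∃ C s₀ : ℝ, 0 < C ∧ 3 ≤ s₀ ∧ ∀ s, s₀ ≤ s → ∀ y,
      ∑ p ∈ primesUpTo y, |F p (((p : ℕ) : ℝ) ^ (-σ) * s) - f (((p : ℕ) : ℝ) ^ (-σ) * s)|
        ≤ C * (s ^ (1 / σ) / (Real.log s * √(Real.log s))) := by
  have hσ0 : 0 < σ := by linarith
  have hα1 : 1 < 1 / σ := (one_lt_div hσ0).mpr hσ'
  have hα2 : 1 / σ < 2 := (div_lt_iff₀ hσ0).mpr (by linarith)
  set α : ℝ := 1 / σ with hα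
  set b : ℝ := 3 / 2 / (2 - α) with hb
  have hb0 : 0 < b := div_pos (by norm_num) (by linarith)
  have hbα : b * (2 - α) = 3 / 2 := div_mul_cancel₀ _ (by linarith)
  set A : ℝ := b * α + 3 / 2 with hA
  have hA0 : 0 < A := by positivity
  obtain ⟨C, P, H⟩ := h3 A hA0
  have hev : ∀ᶠ s : ℝ in atTop, Real.log s ^ (3 / 2 : ℝ) ≤ s ^ ((α - 1) / 2) := by
    have := (isLittleO_log_rpow_rpow_atTop (3 / 2 : ℝ) (by linarith : 0 < (α - 1) / 2)).bound one_pos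
    filter_upwards [this, eventually_gt_atTop 1] with s hs hs1
    rw [one_mul, Real.norm_of_nonneg (Real.rpow_nonneg (Real.log_nonneg hs1.le) _),
      Real.norm_of_nonneg (by positivity)] at hs
    exact hs
  obtain ⟨s₁, hs₁⟩ := eventually_atTop.mp hev
  refine ⟨K * (2 / (2 - α)) + K * (2 / (α - 1) * 2) + |C| * 2 ^ A + 1, max (max 3 s₁) (P ^ 2), ?_,
    (le_max_left _ _).trans (le_max_left _ _), fun s hs y ↦ ?_⟩
  · have : 0 < 2 - α := by linarith
    have : 0 < α - 1 := by linarith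
    positivity
  have hs3 : 3 ≤ s := (le_max_left _ _).trans ((le_max_left _ _).trans hs)
  have hss : s₁ ≤ s := (le_max_right _ _).trans ((le_max_left _ _).trans hs)
  have hsP : P ^ 2 ≤ s := (le_max_right _ _).trans hs
  have hs0 : 0 < s := by linarith
  have hl1 : 1 ≤ Real.log s := by
    rw [Real.le_log_iff_exp_le hs0]; linarith [Real.exp_one_lt_d9]
  set l := Real.log s with hl
  have hl0 : 0 < l := by linarith
  set ε : ℝ := l ^ (-b) with hε
  have hε0 : 0 < ε := by positivity
  set δ : ℝ := |C| * (2 ^ A * l ^ (-A)) with hδ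
  have hδ0 : 0 ≤ δ := by positivity
  have hsq0 : 0 < √s := Real.sqrt_pos.mpr hs0
  have hpt : ∀ p ∈ primesUpTo y,
      |F p (((p : ℕ) : ℝ) ^ (-σ) * s) - f (((p : ℕ) : ℝ) ^ (-σ) * s)|
      ≤ K * (if ((p : ℕ) : ℝ) ^ (-σ) * s ≤ ε then (((p : ℕ) : ℝ) ^ (-σ) * s) ^ 2 else 0)
        + K * (if 2 * (√s / 2) ≤ ((p : ℕ) : ℝ) ^ (-σ) * s then ((p : ℕ) : ℝ) ^ (-σ) * s else 0)
        + (if ε ≤ ((p : ℕ) : ℝ) ^ (-σ) * s then δ else 0) := by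
    intro p _
    have hp0 : (0 : ℝ) < (p : ℕ) := by exact_mod_cast p.2.pos
    have hu : 0 ≤ ((p : ℕ) : ℝ) ^ (-σ) * s := by positivity
    set u := ((p : ℕ) : ℝ) ^ (-σ) * s with hu'
    have t1 : 0 ≤ K * (if u ≤ ε then u ^ 2 else 0) := by split_ifs <;> positivity
    have t2 : 0 ≤ K * (if 2 * (√s / 2) ≤ u then u else 0) := by split_ifs <;> positivity
    have t3 : 0 ≤ (if ε ≤ u then δ else 0) := by split_ifs <;> positivity
    rcases le_total u ε with hle | hge
    · rw [if_pos hle] at t1 ⊢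
      have := h2 p u hu
      linarith
    rcases le_or_gt (√s) u with hge' | hlt
    · rw [if_pos (by linarith : 2 * (√s / 2) ≤ u)] at t2 ⊢
      have := h1 p u hu
      linarith
    · rw [if_pos hge] at t3 ⊢
      -- here `p ≥ s ^ (α / 2) ≥ √s`
      have hps : (s / √s) ^ α ≤ (p : ℕ) := by
        by_contra! hlt'
        exact absurd ((le_rpow_inv_iff hp0 hs0 hsq0 hσ0).mp hlt'.le) (not_le.mpr hlt)
      have hss' : s / √s = √s := Real.div_sqrt
      rw [hss'] at hps
      have hsq1 : 1 ≤ √s := Real.one_le_sqrt.mpr (by linarith)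
      have hps' : √s ≤ (p : ℕ) := by
        refine le_trans ?_ hps
        calc √s = √s ^ (1 : ℝ) := (Real.rpow_one _).symm
          _ ≤ _ := Real.rpow_le_rpow_of_exponent_le hsq1 hα1.le
      have hPp : P ≤ (p : ℕ) := (Real.le_sqrt_of_sq_le hsP).trans hps'
      have hlogp : l / 2 ≤ Real.log (p : ℕ) := by
        rw [hl, ← Real.log_sqrt hs0.le]
        exact Real.log_le_log hsq0 hps'
      have h4 := H p hPp u hu
      have h5 : C / Real.log (p : ℕ) ^ A ≤ δ := by
        calc C / Real.log (p : ℕ) ^ A ≤ |C| / (l / 2) ^ A := by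
              have : 0 < (l / 2) ^ A := by positivity
              gcongr
              exact le_abs_self C
          _ = δ := by
              rw [hδ, Real.div_rpow hl0.le (by norm_num), Real.rpow_neg hl0.le]
              field_simp
      linarith
  refine (Finset.sum_le_sum hpt).trans ?_
  rw [Finset.sum_add_distrib, Finset.sum_add_distrib, ← Finset.mul_sum, ← Finset.mul_sum]
  have b1 := sum_primes_sq_of_le hσ hσ' hs0 hε0 y
  have b2 := sum_primes_of_ge hσ0 hσ' hs0 (by positivity : 0 < √s / 2) y
  have b3 := sum_primes_const_of_ge hσ0 hs0 hε0 hδ0 y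
  rw [← hα] at b1 b2 b3
  rw [← rpow_three_halves hl0.le]
  set D := s ^ α / l ^ (3 / 2 : ℝ) with hD
  have hD0 : 0 < D := by positivity
  have c1 : s ^ α * (2 / (2 - α) * ε ^ (2 - α)) = 2 / (2 - α) * D := by
    rw [hε, ← Real.rpow_mul hl0.le, neg_mul, hbα, Real.rpow_neg hl0.le, hD]
    ring
  have c2 : s ^ α * (2 / (α - 1) * (√s / 2) ^ (1 - α)) ≤ 2 / (α - 1) * 2 * D := by
    have hα1' : 0 < α - 1 := by linarith
    have e1 : (√s / 2) ^ (1 - α) ≤ 2 * (l ^ (3 / 2 : ℝ))⁻¹ := by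
      rw [Real.div_rpow hsq0.le (by norm_num), Real.sqrt_eq_rpow, ← Real.rpow_mul hs0.le,
        div_eq_mul_inv, ← Real.rpow_neg (by norm_num), mul_comm]
      have a1 : (2 : ℝ) ^ (-(1 - α)) ≤ 2 := by
        calc (2 : ℝ) ^ (-(1 - α)) ≤ 2 ^ (1 : ℝ) :=
              Real.rpow_le_rpow_of_exponent_le (by norm_num) (by linarith)
          _ = 2 := Real.rpow_one 2
      have a2 : s ^ (1 / 2 * (1 - α)) ≤ (l ^ (3 / 2 : ℝ))⁻¹ := by
        rw [show 1 / 2 * (1 - α) = -((α - 1) / 2) by ring, Real.rpow_neg hs0.le]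
        exact inv_anti₀ (by positivity) (hs₁ s hss)
      gcongr
    calc s ^ α * (2 / (α - 1) * (√s / 2) ^ (1 - α))
        ≤ s ^ α * (2 / (α - 1) * (2 * (l ^ (3 / 2 : ℝ))⁻¹)) := by gcongr
      _ = _ := by rw [hD]; ring
  have c3 : δ * (s / ε) ^ α = |C| * 2 ^ A * D := by
    have : l ^ (-A) * (ε ^ α)⁻¹ = (l ^ (3 / 2 : ℝ))⁻¹ := by
      rw [hε, ← Real.rpow_mul hl0.le, ← Real.rpow_neg hl0.le, ← Real.rpow_neg hl0.le,
        ← Real.rpow_add hl0, hA]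
      congr 1; ring
    rw [Real.div_rpow hs0.le hε0.le, hδ, hD, div_eq_mul_inv, div_eq_mul_inv, ← this]
    ring
  rw [c1] at b1
  rw [c3] at b3
  have d1 := mul_le_mul_of_nonneg_left b1 hK
  have d2 := mul_le_mul_of_nonneg_left (b2.trans c2) hK
  have : (K * (2 / (2 - α)) + K * (2 / (α - 1) * 2) + |C| * 2 ^ A + 1) * D
      = K * (2 / (2 - α) * D) + K * (2 / (α - 1) * 2 * D) + |C| * 2 ^ A * D + D := by ring
  linarith

/-- Asymptotics of `∑_{p ≤ y} F_p(s p^{-σ})` for functions `F_p` tending to a cumulant generating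
function `f`. -/
lemma IsCumulantProfile.exists_sum_bounds_of_limit {F : Nat.Primes → ℝ → ℝ} {f g : ℝ → ℝ}
    {K K' σ : ℝ} (h : IsCumulantProfile f g K) (hK : 0 ≤ K') (hσ : 1 / 2 < σ) (hσ' : σ < 1)
    (h1 : ∀ p u, 0 ≤ u → |F p u - f u| ≤ K' * u)
    (h2 : ∀ p u, 0 ≤ u → |F p u - f u| ≤ K' * u ^ 2)
    (h3 : ∀ A : ℝ, 0 < A → ∃ C P : ℝ, ∀ p : Nat.Primes, P ≤ ((p : ℕ) : ℝ) → ∀ u, 0 ≤ u →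
      |F p u - f u| ≤ C / Real.log (p : ℕ) ^ A) :
    ∃ C s₀ : ℝ, 0 < C ∧ 3 ≤ s₀ ∧ ∀ s, s₀ ≤ s → ∀ y,
      (∑ p ∈ primesUpTo y, F p (((p : ℕ) : ℝ) ^ (-σ) * s)
        ≤ s ^ (1 / σ) / Real.log s * (∫ u in Ioi 0, f u / u ^ (1 / σ + 1))
          + C * (s ^ (1 / σ) / (Real.log s * √(Real.log s)))) ∧
      (2 ≤ y → s ^ (1 / σ) / Real.log s * (∫ u in Ioi 0, f u / u ^ (1 / σ + 1))
          - C * (s ^ (1 / σ) / (Real.log s * √(Real.log s)))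
          - C * (s ^ (1 / σ) / Real.log y * (s * y ^ (-σ)) ^ (2 - 1 / σ))
        ≤ ∑ p ∈ primesUpTo y, F p (((p : ℕ) : ℝ) ^ (-σ) * s)) := by
  obtain ⟨C₁, s₁, hC₁, hs₁, H₁⟩ := h.exists_sum_bounds hσ hσ'
  obtain ⟨C₂, s₂, hC₂, hs₂, H₂⟩ := exists_sum_abs_sub_le hK hσ hσ' h1 h2 h3
  refine ⟨C₁ + C₂, max s₁ s₂, by positivity, hs₁.trans (le_max_left _ _), fun s hs y ↦ ?_⟩
  obtain ⟨a1, a2⟩ := H₁ s ((le_max_left _ _).trans hs) y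
  have a3 := H₂ s ((le_max_right _ _).trans hs) y
  have a4 := (Finset.abs_sum_le_sum_abs (fun p : Nat.Primes ↦ F p (((p : ℕ) : ℝ) ^ (-σ) * s)
    - f (((p : ℕ) : ℝ) ^ (-σ) * s)) (primesUpTo y)).trans a3
  rw [Finset.sum_sub_distrib, abs_le] at a4
  have hs3 : 3 ≤ s := hs₁.trans ((le_max_left _ _).trans hs)
  constructor
  · rw [add_mul]; linarith [a4.2]
  · intro hy
    have := a2 hy
    have hly : 0 < Real.log y := Real.log_pos (by linarith)
    have : 0 ≤ C₂ * (s ^ (1 / σ) / Real.log y * (s * y ^ (-σ)) ^ (2 - 1 / σ)) := by positivity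
    rw [add_mul, add_mul]; linarith [a4.1]

end LimitReplacement

/-! ### Optimization of the exponent -/

section TailOptimization

open Filter Topology Set

/-- On the scale `s = c (τ log τ)^{σ/(1-σ)}` the exponent `s τ` and the size `s^{1/σ} / log s` of
the cumulant generating function are both constant multiples of
`τ^{1/(1-σ)} (log τ)^{σ/(1-σ)}`. The relative error `1 / √(log τ)` absorbs `log log τ / log τ`. -/
lemma exists_scale_bounds {σ : ℝ} (hσ : 0 < σ) (hσ' : σ < 1) {c₁ c₂ : ℝ} (hc₁ : 0 < c₁) (s₀ : ℝ) :
    ∃ C τ₀ : ℝ, 0 < C ∧ 3 ≤ τ₀ ∧ ∀ τ, τ₀ ≤ τ → ∀ c, c₁ ≤ c → c ≤ c₂ →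
      s₀ ≤ c * (τ * Real.log τ) ^ (σ / (1 - σ)) ∧
      |(c * (τ * Real.log τ) ^ (σ / (1 - σ))) ^ (1 / σ)
          / Real.log (c * (τ * Real.log τ) ^ (σ / (1 - σ)))
        - c ^ (1 / σ) * ((1 - σ) / σ) * (τ ^ (1 / (1 - σ)) * Real.log τ ^ (σ / (1 - σ)))|
        ≤ C * (τ ^ (1 / (1 - σ)) * Real.log τ ^ (σ / (1 - σ)) / √(Real.log τ)) ∧
      (c * (τ * Real.log τ) ^ (σ / (1 - σ))) ^ (1 / σ)
          / (Real.log (c * (τ * Real.log τ) ^ (σ / (1 - σ)))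
            * √(Real.log (c * (τ * Real.log τ) ^ (σ / (1 - σ)))))
        ≤ C * (τ ^ (1 / (1 - σ)) * Real.log τ ^ (σ / (1 - σ)) / √(Real.log τ)) := by
  have hσ1 : 0 < 1 - σ := by linarith
  set κ : ℝ := σ / (1 - σ) with hκ
  have hκ0 : 0 < κ := div_pos hσ hσ1
  have hβ : 1 / (1 - σ) = κ + 1 := by rw [hκ]; field_simp; ring
  have hκσ : κ * (1 / σ) = κ + 1 := by rw [hκ]; field_simp; ring
  have hκi : (1 - σ) / σ = 1 / κ := by rw [hκ]; field_simp
  set m : ℝ := |Real.log c₁| + |Real.log c₂| with hm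
  have hm0 : 0 ≤ m := by positivity
  set C₁ : ℝ := m + 2 * κ with hC₁
  have hC₁0 : 0 < C₁ := by positivity
  -- `log τ` is large enough for `log s ≥ κ log τ / 2` and for `s ≥ s₀`
  set L₀ : ℝ := (2 * C₁ / κ) ^ 2 + 2 * |Real.log (max s₀ 1)| / κ + 2 with hL₀
  refine ⟨|c₂| ^ (1 / σ) * (2 * C₁ / κ ^ 2) + |c₂| ^ (1 / σ) * (2 / κ * (1 / √(κ / 2))) + 1,
    Real.exp L₀, by positivity, ?_, fun τ hτ c hc hc' ↦ ?_⟩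
  · have h1 := Real.add_one_le_exp L₀
    have : 0 ≤ (2 * C₁ / κ) ^ 2 := by positivity
    have : 0 ≤ 2 * |Real.log (max s₀ 1)| / κ := by positivity
    linarith
  have hτ0 : 0 < τ := (Real.exp_pos _).trans_le hτ
  have hc0 : 0 < c := hc₁.trans_le hc
  have hL : L₀ ≤ Real.log τ := (Real.le_log_iff_exp_le hτ0).mpr hτ
  set L := Real.log τ with hLd
  have hq1 : 0 ≤ (2 * C₁ / κ) ^ 2 := by positivity
  have hq2 : 0 ≤ 2 * |Real.log (max s₀ 1)| / κ := by positivity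
  have hL2 : 2 ≤ L := by linarith
  have hL0 : 0 < L := by linarith
  have hsq0 : 0 < √L := Real.sqrt_pos.mpr hL0
  have hsqsq : √L * √L = L := Real.mul_self_sqrt hL0.le
  set s := c * (τ * L) ^ κ with hs
  have hs0 : 0 < s := by positivity
  have hlogs : Real.log s = κ * L + (Real.log c + κ * Real.log L) := by
    rw [hs, Real.log_mul hc0.ne' (by positivity), Real.log_rpow (by positivity),
      Real.log_mul hτ0.ne' hL0.ne']
    ring
  have hdev : |Real.log c + κ * Real.log L| ≤ C₁ * √L := by
    have h1 : |Real.log c| ≤ m := by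
      have a1 := Real.log_le_log hc₁ hc
      have a2 := Real.log_le_log hc0 hc'
      rw [hm, abs_le]
      constructor
      · linarith [neg_abs_le (Real.log c₁), abs_nonneg (Real.log c₂)]
      · linarith [le_abs_self (Real.log c₂), abs_nonneg (Real.log c₁)]
    have h2 : |Real.log L| ≤ 2 * √L := by
      rw [abs_of_nonneg (Real.log_nonneg (by linarith)), ← hsqsq, Real.log_mul hsq0.ne' hsq0.ne',
        hsqsq]
      linarith [Real.log_le_sub_one_of_pos hsq0]
    have h3 : 1 ≤ √L := Real.one_le_sqrt.mpr (by linarith)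
    calc |Real.log c + κ * Real.log L| ≤ |Real.log c| + κ * |Real.log L| := by
          refine (abs_add_le _ _).trans (le_of_eq ?_)
          rw [abs_mul, abs_of_pos hκ0]
      _ ≤ m * √L + κ * (2 * √L) := by
          gcongr
          exact h1.trans (le_mul_of_one_le_right hm0 h3)
      _ = C₁ * √L := by rw [hC₁]; ring
  have hC₁L : C₁ * √L ≤ κ * L / 2 := by
    have h1 : 2 * C₁ / κ ≤ √L := Real.le_sqrt_of_sq_le (by linarith)
    rw [div_le_iff₀ hκ0] at h1
    nlinarith
  have hlogs2 : κ * L / 2 ≤ Real.log s := by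
    rw [hlogs]; linarith [(abs_le.mp hdev).1]
  have hlogs0 : 0 < Real.log s := lt_of_lt_of_le (by positivity) hlogs2
  set N := τ ^ (1 / (1 - σ)) * L ^ κ with hN
  have hN0 : 0 < N := by positivity
  have hsα : s ^ (1 / σ) = c ^ (1 / σ) * (N * L) := by
    rw [hs, Real.mul_rpow hc0.le (by positivity), ← Real.rpow_mul (by positivity), hκσ, hN, hβ,
      Real.mul_rpow hτ0.le hL0.le, Real.rpow_add_one hL0.ne']
    ring
  have hcc : c ^ (1 / σ) ≤ |c₂| ^ (1 / σ) :=
    Real.rpow_le_rpow hc0.le (hc'.trans (le_abs_self _)) (by positivity)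
  have hcp : 0 < c ^ (1 / σ) := by positivity
  refine ⟨?_, ?_, ?_⟩
  · refine (le_max_left s₀ 1).trans ?_
    rw [← Real.log_le_log_iff (by positivity) hs0]
    refine le_trans ?_ hlogs2
    have h1 : 2 * |Real.log (max s₀ 1)| / κ ≤ L := by linarith
    rw [div_le_iff₀ hκ0] at h1
    linarith [le_abs_self (Real.log (max s₀ 1))]
  · have e : s ^ (1 / σ) / Real.log s - c ^ (1 / σ) * ((1 - σ) / σ) * N
        = -(c ^ (1 / σ) * N * (Real.log c + κ * Real.log L) / (κ * Real.log s)) := by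
      rw [hsα, hκi]
      have : Real.log c + κ * Real.log L = Real.log s - κ * L := by rw [hlogs]; ring
      rw [this]
      field_simp
      ring
    rw [e, abs_neg, abs_div, abs_mul, abs_of_pos (by positivity : 0 < c ^ (1 / σ) * N),
      abs_of_pos (by positivity : 0 < κ * Real.log s)]
    calc c ^ (1 / σ) * N * |Real.log c + κ * Real.log L| / (κ * Real.log s)
        ≤ |c₂| ^ (1 / σ) * N * (C₁ * √L) / (κ * (κ * L / 2)) := by gcongr
      _ = |c₂| ^ (1 / σ) * (2 * C₁ / κ ^ 2) * (N / √L) := by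
          rw [show κ * (κ * L / 2) = κ * (κ * (√L * √L) / 2) by rw [hsqsq]]
          field_simp
      _ ≤ _ := by
          gcongr
          have : 0 ≤ |c₂| ^ (1 / σ) * (2 / κ * (1 / √(κ / 2))) := by positivity
          linarith
  · rw [hsα]
    have h1 : √(κ / 2) * √L ≤ √(Real.log s) := by
      rw [← Real.sqrt_mul (by positivity)]
      exact Real.sqrt_le_sqrt (by linarith)
    calc c ^ (1 / σ) * (N * L) / (Real.log s * √(Real.log s))
        ≤ |c₂| ^ (1 / σ) * (N * L) / ((κ * L / 2) * (√(κ / 2) * √L)) := by gcongr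
      _ = |c₂| ^ (1 / σ) * (2 / κ * (1 / √(κ / 2))) * (N / √L) := by
          field_simp
      _ ≤ _ := by
          gcongr
          have : 0 ≤ |c₂| ^ (1 / σ) * (2 * C₁ / κ ^ 2) := by positivity
          linarith

/-- The saddle point `c` for the exponent `c - G (1-σ)/σ c^{1/σ}`. -/
lemma saddle_point {σ G : ℝ} (hσ : 0 < σ) (hσ' : σ < 1) (hG : 0 < G) :
    ∃ c₀ : ℝ, 0 < c₀ ∧ G * (c₀ ^ (1 / σ) * ((1 - σ) / σ)) = σ * c₀ ∧
      (σ ^ (2 * σ) / ((1 - σ) ^ (2 * σ - 1) * G ^ σ)) ^ (1 / (1 - σ)) = (1 - σ) * c₀ ∧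
      ∀ c, 0 ≤ c → c - G * (c ^ (1 / σ) * ((1 - σ) / σ)) ≤ (1 - σ) * c₀ := by
  have hσ1 : 0 < 1 - σ := by linarith
  set c₀ : ℝ := (σ ^ 2 / (G * (1 - σ))) ^ (σ / (1 - σ)) with hc₀
  have hB : 0 < σ ^ 2 / (G * (1 - σ)) := by positivity
  have hc₀0 : 0 < c₀ := by positivity
  have h1 : c₀ ^ (1 / σ) = c₀ * (σ ^ 2 / (G * (1 - σ))) := by
    rw [hc₀, ← Real.rpow_mul hB.le, ← Real.rpow_add_one hB.ne']
    congr 1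
    field_simp
    ring
  have h2 : G * (c₀ ^ (1 / σ) * ((1 - σ) / σ)) = σ * c₀ := by
    rw [h1]; field_simp
  refine ⟨c₀, hc₀0, h2, ?_, fun c hc ↦ ?_⟩
  · apply Real.log_injOn_pos (by simp only [mem_Ioi]; positivity) (by simp only [mem_Ioi]; positivity)
    rw [Real.log_rpow (by positivity), Real.log_div (by positivity) (by positivity),
      Real.log_mul (by positivity) (by positivity), Real.log_rpow hσ, Real.log_rpow hσ1,
      Real.log_rpow hG, Real.log_mul hσ1.ne' hc₀0.ne', hc₀, Real.log_rpow hB,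
      Real.log_div (by positivity) (by positivity), Real.log_mul hG.ne' hσ1.ne', Real.log_pow]
    field_simp
    push_cast
    ring
  · -- Bernoulli's inequality for `c / c₀`
    set x := c / c₀ with hx
    have hx0 : 0 ≤ x := by positivity
    have hcx : c = c₀ * x := by rw [hx]; field_simp
    have hb := one_add_mul_self_le_rpow_one_add (s := x - 1) (by linarith) (p := 1 / σ)
      ((one_le_div hσ).mpr hσ'.le)
    rw [add_sub_cancel] at hb
    have h3 : G * (c ^ (1 / σ) * ((1 - σ) / σ)) = σ * c₀ * x ^ (1 / σ) := by
      rw [hcx, Real.mul_rpow hc₀0.le hx0, ← h2]; ring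
    rw [h3, hcx]
    have h4 : σ * c₀ * (1 + 1 / σ * (x - 1)) ≤ σ * c₀ * x ^ (1 / σ) := by gcongr
    have h5 : σ * c₀ * (1 + 1 / σ * (x - 1)) = σ * c₀ + c₀ * (x - 1) := by field_simp
    linarith

/-- For `y ≥ (τ log τ)^{1/(1-σ)}` put `q = (τ log τ)^{1/(1-σ)} / y ≤ 1`. On the critical scale, the
loss in the cumulant generating function caused by omitting the primes `p > y` has relative size
`q^{2σ-1}`, which `r(y, τ)` dominates. -/
lemma truncation_bounds {σ τ y c : ℝ} (hσ : 1 / 2 < σ) (hσ' : σ < 1) (hτ : 3 ≤ τ) (hc : 0 < c)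
    (hy : (τ * Real.log τ) ^ (1 / (1 - σ)) ≤ y) :
    τ ≤ y ∧
    (c * (τ * Real.log τ) ^ (σ / (1 - σ))) ^ (1 / σ) / Real.log y
        * (c * (τ * Real.log τ) ^ (σ / (1 - σ)) * y ^ (-σ)) ^ (2 - 1 / σ)
      ≤ c ^ 2 * (τ ^ (1 / (1 - σ)) * Real.log τ ^ (σ / (1 - σ)))
        * ((τ * Real.log τ) ^ (1 / (1 - σ)) / y) ^ (2 * σ - 1) ∧
    ((τ * Real.log τ) ^ (1 / (1 - σ)) / y) ^ (2 * σ - 1) ≤ errorR σ y τ := by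
  have hσ0 : 0 < σ := by linarith
  have hσ1 : 0 < 1 - σ := by linarith
  have hτ0 : 0 < τ := by linarith
  set L := Real.log τ with hLd
  have hL1 : 1 ≤ L := by
    rw [hLd, Real.le_log_iff_exp_le hτ0]; linarith [Real.exp_one_lt_d9]
  have hL0 : 0 < L := by linarith
  have hβ1 : 1 ≤ 1 / (1 - σ) := by rw [le_div_iff₀ hσ1]; linarith
  set b := (τ * L) ^ (1 / (1 - σ)) with hb
  have hb0 : 0 < b := by positivity
  have hτL : τ ≤ τ * L := le_mul_of_one_le_right hτ0.le hL1
  have hτb : τ ≤ b := by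
    refine hτL.trans ?_
    exact Real.self_le_rpow_of_one_le (by linarith) hβ1
  have hτy := hτb.trans hy
  have hy0 : 0 < y := by linarith
  have hly : L ≤ Real.log y := Real.log_le_log hτ0 hτy
  have hly0 : 0 < Real.log y := by linarith
  set q := b / y with hq
  have hq0 : 0 < q := by positivity
  have hq1 : q ≤ 1 := (div_le_one hy0).mpr hy
  have hκ : (τ * L) ^ (σ / (1 - σ)) = b ^ σ := by
    rw [hb, ← Real.rpow_mul (by positivity)]; congr 1; field_simp
  refine ⟨hτy, ?_, ?_⟩
  · have e1 : (c * b ^ σ) ^ (1 / σ) = c ^ (1 / σ) * (τ ^ (1 / (1 - σ)) * L ^ (σ / (1 - σ)) * L) := by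
      rw [Real.mul_rpow hc.le (by positivity), ← Real.rpow_mul hb0.le, mul_one_div_cancel hσ0.ne',
        Real.rpow_one, hb, Real.mul_rpow hτ0.le hL0.le, mul_assoc, ← Real.rpow_add_one hL0.ne']
      congr 3; field_simp; ring
    have e2 : c * b ^ σ * y ^ (-σ) = c * q ^ σ := by
      rw [hq, Real.div_rpow hb0.le hy0.le, Real.rpow_neg hy0.le]; ring
    have e3 : (c * q ^ σ) ^ (2 - 1 / σ) = c ^ (2 - 1 / σ) * q ^ (2 * σ - 1) := by
      rw [Real.mul_rpow hc.le (by positivity), ← Real.rpow_mul hq0.le]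
      congr 2; field_simp
    have e4 : c ^ (1 / σ) * c ^ (2 - 1 / σ) = c ^ 2 := by
      rw [← Real.rpow_add hc, ← Real.rpow_two]; congr 1; ring
    rw [hκ, e1, e2, e3]
    set N := τ ^ (1 / (1 - σ)) * L ^ (σ / (1 - σ))
    have hN : 0 < N := by positivity
    calc c ^ (1 / σ) * (N * L) / Real.log y * (c ^ (2 - 1 / σ) * q ^ (2 * σ - 1))
        = c ^ (1 / σ) * c ^ (2 - 1 / σ) * N * q ^ (2 * σ - 1) * (L / Real.log y) := by ring
      _ ≤ c ^ (1 / σ) * c ^ (2 - 1 / σ) * N * q ^ (2 * σ - 1) * 1 := by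
          gcongr
          exact (div_le_one hly0).mpr hly
      _ = _ := by rw [e4, mul_one]
  · have e1 : τ * L / y ^ (1 - σ) = q ^ (1 - σ) := by
      rw [hq, Real.div_rpow hb0.le hy0.le, hb, ← Real.rpow_mul (by positivity),
        one_div_mul_cancel hσ1.ne', Real.rpow_one]
    have e2 : (q ^ (1 - σ)) ^ ((σ - 1 / 2) / (1 - σ)) = q ^ (σ - 1 / 2) := by
      rw [← Real.rpow_mul hq0.le]; congr 1; field_simp
    calc q ^ (2 * σ - 1) ≤ q ^ (σ - 1 / 2) :=
          Real.rpow_le_rpow_of_exponent_ge hq0 hq1 (by linarith)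
      _ = (τ * L / y ^ (1 - σ)) ^ ((σ - 1 / 2) / (1 - σ)) := by rw [e1, e2]
      _ ≤ (τ * Real.log y / y ^ (1 - σ)) ^ ((σ - 1 / 2) / (1 - σ)) := by
          have : 0 ≤ (σ - 1 / 2) / (1 - σ) := div_nonneg (by linarith) hσ1.le
          gcongr
      _ = errorR σ y τ := by
          rw [errorR]; congr 1; field_simp

set_option maxHeartbeats 400000 in
/-- The tail asymptotics follow from the asymptotics of the cumulant generating functions `Λ y`
together with exponential upper and lower bounds for the tail: the upper bound is used at the saddle
point, while the lower bound provides some `s` at which the exponent is at least its minimum. -/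
theorem hasTailAsymptotic_of_cumulant_bounds {σ G B D C₀ s₀ : ℝ} (hσ : 1 / 2 < σ) (hσ' : σ < 1)
    (hG : 0 < G) (hB : 0 ≤ B) (hD : 0 ≤ D) (hC₀ : 0 < C₀) {Λ Φ : ℝ → ℝ → ℝ}
    (hΛ : ∀ y s, 0 ≤ s → 0 ≤ Λ y s)
    (hΛu : ∀ s, s₀ ≤ s → ∀ y, Λ y s
      ≤ s ^ (1 / σ) / Real.log s * G + C₀ * (s ^ (1 / σ) / (Real.log s * √(Real.log s))))
    (hΛl : ∀ s, s₀ ≤ s → ∀ y, 2 ≤ y → s ^ (1 / σ) / Real.log s * G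
      - C₀ * (s ^ (1 / σ) / (Real.log s * √(Real.log s)))
      - C₀ * (s ^ (1 / σ) / Real.log y * (s * y ^ (-σ)) ^ (2 - 1 / σ)) ≤ Λ y s)
    (hΦu : ∀ τ y s, 0 ≤ s → Φ τ y ≤ Real.exp (-(s * τ) + s * B + Λ y s))
    (hΦl : ∀ τ y s₂, 0 ≤ τ → 0 < s₂ → s₂ * (τ + D) ≤ Λ y s₂ →
      ∃ s, 0 ≤ s ∧ s ≤ s₂ ∧ Real.exp (Λ y s - s * (τ + D)) / 2 ≤ Φ τ y) :
    HasTailAsymptotic σ ((σ ^ (2 * σ) / ((1 - σ) ^ (2 * σ - 1) * G ^ σ)) ^ (1 / (1 - σ))) Φ := by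
  have hσ0 : 0 < σ := by linarith
  have hσ1 : 0 < 1 - σ := by linarith
  have h2σ : 0 < 2 * σ - 1 := by linarith
  obtain ⟨c₀, hc₀, hc₀G, hA, hmin⟩ := saddle_point hσ0 hσ' hG
  rw [hA]
  have hκ0 : 0 < σ / (1 - σ) := by positivity
  have hβ : 1 / (1 - σ) = σ / (1 - σ) + 1 := by field_simp; ring
  -- beyond `c₂` the cumulant generating function dominates the linear term
  set c₂ : ℝ := c₀ * (4 / σ) ^ (σ / (1 - σ)) with hc₂
  have h4σ : 1 ≤ 4 / σ := by rw [le_div_iff₀ hσ0]; linarith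
  have hc₀₂ : c₀ ≤ c₂ := le_mul_of_one_le_right hc₀.le (Real.one_le_rpow h4σ hκ0.le)
  have hc₂0 : 0 < c₂ := hc₀.trans_le hc₀₂
  have hc₂G : G * (c₂ ^ (1 / σ) * ((1 - σ) / σ)) = 4 * c₂ := by
    have h1 : c₂ ^ (1 / σ) = c₀ ^ (1 / σ) * ((4 / σ) ^ (σ / (1 - σ)) * (4 / σ)) := by
      rw [hc₂, Real.mul_rpow hc₀.le (by positivity), ← Real.rpow_mul (by positivity),
        ← Real.rpow_add_one (by positivity)]
      congr 2; field_simp; ring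
    calc G * (c₂ ^ (1 / σ) * ((1 - σ) / σ))
        = G * (c₀ ^ (1 / σ) * ((1 - σ) / σ)) * ((4 / σ) ^ (σ / (1 - σ)) * (4 / σ)) := by
          rw [h1]; ring
      _ = 4 * c₂ := by rw [hc₀G, hc₂]; field_simp
  set A := (1 - σ) * c₀ with hAd
  have hA0 : 0 < A := by positivity
  have hAc : A ≤ c₀ := mul_le_of_le_one_left hc₀.le (by linarith)
  obtain ⟨C₁, τ₁, hC₁, hτ₁, H⟩ := exists_scale_bounds (c₂ := c₂) hσ0 hσ' hA0 s₀
  set C₂ := G * C₁ + C₀ * C₁ with hC₂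
  have hC₂0 : 0 < C₂ := by positivity
  -- `K` makes the loss from the primes beyond `y` at most the linear term at `c₂`
  set K : ℝ := max 1 ((C₀ * c₂) ^ (1 / (2 * σ - 1))) with hK
  have hK1 : 1 ≤ K := le_max_left _ _
  have hKp : C₀ * c₂ ≤ K ^ (2 * σ - 1) := by
    calc C₀ * c₂ = ((C₀ * c₂) ^ (1 / (2 * σ - 1))) ^ (2 * σ - 1) := by
          rw [← Real.rpow_mul (by positivity), one_div_mul_cancel h2σ.ne', Real.rpow_one]
      _ ≤ _ := by gcongr; exact le_max_right _ _
  set C := (C₂ + c₀ * B + c₂ * D + C₀ * c₂ ^ 2 + 1) / A with hC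
  have hC0 : 0 < C := by positivity
  have hCA : A * C = C₂ + c₀ * B + c₂ * D + C₀ * c₂ ^ 2 + 1 := by rw [hC]; field_simp
  refine ⟨C, K, max τ₁ (max D (Real.exp ((C₂ / c₂) ^ 2))), hC0, by linarith, fun τ hτ y hy ↦ ?_⟩
  have hττ₁ := (le_max_left _ _).trans hτ
  have hτD := (le_max_left _ _).trans ((le_max_right _ _).trans hτ)
  have hτe := (le_max_right _ _).trans ((le_max_right _ _).trans hτ)
  have hτ3 : 3 ≤ τ := hτ₁.trans hττ₁
  have hτ0 : 0 < τ := by linarith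
  have Ht := H τ hττ₁
  have hLe : (C₂ / c₂) ^ 2 ≤ Real.log τ := (Real.le_log_iff_exp_le hτ0).mpr hτe
  have hL1 : 1 ≤ Real.log τ := by
    rw [Real.le_log_iff_exp_le hτ0]; linarith [Real.exp_one_lt_d9]
  have hLτ : Real.log τ ≤ τ := (Real.log_le_sub_one_of_pos hτ0).trans (by linarith)
  have htrunc := fun c hc ↦ truncation_bounds (c := c) hσ hσ' hτ3 hc hy
  set L := Real.log τ with hLd
  have hL0 : 0 < L := by linarith
  have hsL : 1 ≤ √L := Real.one_le_sqrt.mpr hL1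
  have hsLτ : √L ≤ τ := (Real.sqrt_le_iff.mpr ⟨hL0.le, by nlinarith⟩ : √L ≤ L).trans hLτ
  have hsLC : C₂ / c₂ ≤ √L := Real.le_sqrt_of_sq_le hLe
  set S := (τ * L) ^ (σ / (1 - σ)) with hS
  have hS0 : 0 < S := by positivity
  set N := τ ^ (1 / (1 - σ)) * L ^ (σ / (1 - σ)) with hN
  have hN0 : 0 < N := by positivity
  have hSN : S * τ = N := by
    rw [hS, hN, hβ, Real.rpow_add_one hτ0.ne', Real.mul_rpow hτ0.le hL0.le]; ring
  set R := N / √L with hR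
  have hR0 : 0 < R := by positivity
  have hSR : S ≤ R := by
    rw [hR, le_div_iff₀ (by positivity), ← hSN]; gcongr
  have hS1 : 1 ≤ S := Real.one_le_rpow (by nlinarith) hκ0.le
  have hR1 : 1 ≤ R := hS1.trans hSR
  set r := errorR σ y τ with hr
  obtain ⟨hτy, -, hqr⟩ := htrunc 1 one_pos
  set q := (τ * L) ^ (1 / (1 - σ)) / y with hq
  have hy0 : 0 < y := by linarith
  have hq0 : 0 < q := by positivity
  have hqp : 0 < q ^ (2 * σ - 1) := by positivity
  have hr0 : 0 < r := hqp.trans_le hqr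
  have hexp : ∀ ε, -A * τ ^ (1 / (1 - σ)) * L ^ (σ / (1 - σ)) * (1 + ε * (1 / √L + r))
      = -(A * N) - A * ε * R - A * ε * (N * r) := by
    intro ε; rw [hR, hN]; ring
  clear_value q r R N S C A c₂ K C₂
  -- bounds for the cumulant generating function on the critical scale
  have Hu : ∀ c, A ≤ c → c ≤ c₂ →
      Λ y (c * S) ≤ G * (c ^ (1 / σ) * ((1 - σ) / σ)) * N + C₂ * R := by
    intro c h1 h2
    obtain ⟨a1, a2, a3⟩ := Ht c h1 h2
    have a4 := hΛu _ a1 y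
    have a5 := mul_le_mul_of_nonneg_left (abs_le.mp a2).2 hG.le
    have a6 := mul_le_mul_of_nonneg_left a3 hC₀.le
    rw [hC₂]; linarith
  have Hl : ∀ c, A ≤ c → c ≤ c₂ →
      G * (c ^ (1 / σ) * ((1 - σ) / σ)) * N - C₂ * R - C₀ * c₂ ^ 2 * (N * q ^ (2 * σ - 1))
        ≤ Λ y (c * S) := by
    intro c h1 h2
    have hc : 0 < c := hA0.trans_le h1
    obtain ⟨a1, a2, a3⟩ := Ht c h1 h2
    have a4 := hΛl _ a1 y (by linarith)
    have a5 := mul_le_mul_of_nonneg_left (abs_le.mp a2).1 hG.le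
    have a6 := mul_le_mul_of_nonneg_left a3 hC₀.le
    have a7 := mul_le_mul_of_nonneg_left (htrunc c hc).2.1 hC₀.le
    have a8 : C₀ * (c ^ 2 * N * q ^ (2 * σ - 1)) ≤ C₀ * (c₂ ^ 2 * N * q ^ (2 * σ - 1)) := by
      gcongr
    rw [hC₂]; linarith
  constructor
  · refine (hΦu τ y (c₀ * S) (by positivity)).trans (Real.exp_le_exp.mpr ?_)
    have h1 := Hu c₀ hAc hc₀₂
    rw [hc₀G] at h1
    rw [show (1 : ℝ) - C * (1 / √L + r) = 1 + -C * (1 / √L + r) by ring, hexp]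
    have h2 : c₀ * S * τ = c₀ * N := by rw [← hSN]; ring
    have h3 : c₀ * S * B ≤ c₀ * B * R := by
      have := mul_le_mul_of_nonneg_left hSR (by positivity : 0 ≤ c₀ * B)
      linarith
    have h4 : C₂ * R + c₀ * B * R ≤ A * C * R := by
      rw [← add_mul]
      refine mul_le_mul_of_nonneg_right ?_ hR0.le
      rw [hCA]
      have : 0 ≤ c₂ * D := by positivity
      have : 0 ≤ C₀ * c₂ ^ 2 := by positivity
      linarith
    have h5 : 0 ≤ A * C * (N * r) := by positivity
    have h6 : A * N = c₀ * N - σ * c₀ * N := by rw [hAd]; ring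
    linarith
  · intro hKy
    have hqK : C₀ * c₂ ^ 2 * (N * q ^ (2 * σ - 1)) ≤ c₂ * N := by
      have h1 : q ≤ K⁻¹ := by
        rw [hq, div_le_iff₀ hy0, ← div_eq_inv_mul, le_div_iff₀ (by linarith)]
        linarith
      have h2 : q ^ (2 * σ - 1) ≤ (K ^ (2 * σ - 1))⁻¹ := by
        rw [← Real.inv_rpow (by linarith)]; gcongr
      have h3 : C₀ * c₂ * q ^ (2 * σ - 1) ≤ 1 := by
        calc C₀ * c₂ * q ^ (2 * σ - 1) ≤ K ^ (2 * σ - 1) * (K ^ (2 * σ - 1))⁻¹ := by gcongr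
          _ = 1 := mul_inv_cancel₀ (by positivity)
      calc C₀ * c₂ ^ 2 * (N * q ^ (2 * σ - 1))
          = c₂ * N * (C₀ * c₂ * q ^ (2 * σ - 1)) := by ring
        _ ≤ c₂ * N * 1 := by gcongr
        _ = c₂ * N := mul_one _
    have hCR : C₂ * R ≤ c₂ * N := by
      rw [div_le_iff₀ hc₂0] at hsLC
      rw [hR, ← mul_div_assoc, div_le_iff₀ (by positivity)]
      calc C₂ * N ≤ √L * c₂ * N := by gcongr
        _ = c₂ * N * √L := by ring
    have hs₂ : c₂ * S * (τ + D) ≤ Λ y (c₂ * S) := by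
      have h1 := Hl c₂ (hAc.trans hc₀₂) le_rfl
      rw [hc₂G] at h1
      have h2 : c₂ * S * (τ + D) ≤ c₂ * S * (τ + τ) := by gcongr
      have h3 : c₂ * S * (τ + τ) = 2 * (c₂ * N) := by rw [← hSN]; ring
      linarith
    obtain ⟨s, hs0, hss, hs⟩ := hΦl τ y (c₂ * S) hτ0.le (by positivity) hs₂
    refine le_trans ?_ hs
    have hhalf : Real.exp (Λ y s - s * (τ + D) - 1) ≤ Real.exp (Λ y s - s * (τ + D)) / 2 := by
      rw [Real.exp_sub, div_le_div_iff_of_pos_left (Real.exp_pos _) (Real.exp_pos _) two_pos]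
      linarith [Real.add_one_le_exp (1 : ℝ)]
    refine le_trans (Real.exp_le_exp.mpr ?_) hhalf
    rw [hexp]
    obtain ⟨c, rfl⟩ : ∃ c, s = c * S := ⟨s / S, by field_simp⟩
    have hc0 : 0 ≤ c := nonneg_of_mul_nonneg_left hs0 hS0
    have hcc : c ≤ c₂ := le_of_mul_le_mul_right hss hS0
    have h1 : c * S * (τ + D) ≤ c * N + c₂ * D * R := by
      have h2 : c * (S * D) ≤ c₂ * (R * D) := by gcongr
      rw [← hSN]; linarith
    have h3 : C₂ * R + c₂ * D * R + 1 ≤ A * C * R := by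
      have : C₂ * R + c₂ * D * R + R ≤ A * C * R := by
        rw [← add_mul, ← add_one_mul]
        refine mul_le_mul_of_nonneg_right ?_ hR0.le
        rw [hCA]
        have : 0 ≤ c₀ * B := by positivity
        have : 0 ≤ C₀ * c₂ ^ 2 := by positivity
        linarith
      linarith
    have h4 : C₀ * c₂ ^ 2 * (N * q ^ (2 * σ - 1)) ≤ A * C * (N * r) := by
      have h5 : C₀ * c₂ ^ 2 ≤ A * C := by
        rw [hCA]
        have : 0 ≤ c₂ * D := by positivity
        have : 0 ≤ c₀ * B := by positivity
        linarith
      gcongr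
    -- for small `c` the linear term alone is already at most `A N`
    rcases le_total c A with hcA | hcA
    · have h6 := hΛ y _ hs0
      have h7 : c * N ≤ A * N := by gcongr
      have h8 : 0 ≤ C₂ * R := by positivity
      have h9 : 0 ≤ C₀ * c₂ ^ 2 * (N * q ^ (2 * σ - 1)) := by positivity
      linarith
    · have h6 := Hl c hcA hcc
      have h7 := mul_le_mul_of_nonneg_right (hmin c hc0) hN0.le
      linarith

end TailOptimization

/-! ### Cumulant generating functions and tilting -/

section CumulantGeneratingFunctions

open Filter Topology Set

variable {Ω : Type*} [MeasurableSpace Ω] {μ : Measure Ω} {T : Ω → ℝ}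

lemma mem_interior_integrableExpSet (h : ∀ t, Integrable (fun ω ↦ Real.exp (t * T ω)) μ) (t : ℝ) :
    t ∈ interior (integrableExpSet T μ) := by
  have : integrableExpSet T μ = univ := eq_univ_of_forall h
  simp [this]

lemma analyticOnNhd_cgf_univ (h : ∀ t, Integrable (fun ω ↦ Real.exp (t * T ω)) μ) :
    AnalyticOnNhd ℝ (cgf T μ) univ :=
  fun t _ ↦ analyticAt_cgf (mem_interior_integrableExpSet h t)

lemma hasDerivAt_cgf (h : ∀ t, Integrable (fun ω ↦ Real.exp (t * T ω)) μ) (t : ℝ) :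
    HasDerivAt (cgf T μ) (deriv (cgf T μ) t) t :=
  (analyticOnNhd_cgf_univ h t (mem_univ t)).differentiableAt.hasDerivAt

lemma differentiable_deriv_cgf (h : ∀ t, Integrable (fun ω ↦ Real.exp (t * T ω)) μ) :
    Differentiable ℝ (deriv (cgf T μ)) :=
  fun t ↦ ((analyticOnNhd_cgf_univ h).deriv t (mem_univ t)).differentiableAt

lemma monotone_deriv_cgf (h : ∀ t, Integrable (fun ω ↦ Real.exp (t * T ω)) μ) :
    Monotone (deriv (cgf T μ)) := by
  refine monotone_of_deriv_nonneg (differentiable_deriv_cgf h) fun t ↦ ?_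
  have e : iteratedDeriv 2 (cgf T μ) t = deriv (deriv (cgf T μ)) t := by
    rw [iteratedDeriv_succ, iteratedDeriv_one]
  rw [← e, ← variance_tilted_mul (mem_interior_integrableExpSet h t)]
  exact variance_nonneg _ _

/-- Lower bound for a tail probability by Cramér's change of measure: if the variances of `T` under
all tilted measures are at most `D² / 2`, then tilting so that `T` has mean `a + D` makes
`a < T < a + 2 D` likely. -/
lemma exists_exp_le_measureReal_gt [IsProbabilityMeasure μ]
    (h : ∀ t, Integrable (fun ω ↦ Real.exp (t * T ω)) μ) (hmean : ∫ ω, T ω ∂μ = 0)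
    {a D s₂ : ℝ} (hD : 0 < D) (ha : 0 ≤ a) (hs₂ : 0 < s₂)
    (hvar : ∀ t, iteratedDeriv 2 (cgf T μ) t ≤ D ^ 2 / 2) (hcgf : s₂ * (a + D) ≤ cgf T μ s₂) :
    ∃ s, 0 ≤ s ∧ s ≤ s₂ ∧
      Real.exp (cgf T μ s - s * (a + 2 * D)) / 2 ≤ μ.real {ω | a < T ω} := by
  have hint := mem_interior_integrableExpSet h
  obtain ⟨ξ, hξ, hξ'⟩ := exists_hasDerivAt_eq_slope (cgf T μ) (deriv (cgf T μ)) hs₂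
    (fun x _ ↦ (hasDerivAt_cgf h x).continuousAt.continuousWithinAt)
    (fun x _ ↦ hasDerivAt_cgf h x)
  have hξD : a + D ≤ deriv (cgf T μ) ξ := by
    rw [hξ', cgf_zero, sub_zero, sub_zero, le_div_iff₀ hs₂]; linarith
  have h0 : deriv (cgf T μ) 0 = 0 := by rw [deriv_cgf_zero (hint 0), hmean, zero_div]
  obtain ⟨s, hs, hsD⟩ := intermediate_value_Icc hξ.1.le
    (differentiable_deriv_cgf h).continuous.continuousOn
    (show a + D ∈ Icc _ _ from ⟨by rw [h0]; linarith, hξD⟩)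
  refine ⟨s, hs.1, hs.2.trans hξ.2.le, ?_⟩
  -- under `μs` the mean of `T` is `a + D`
  set μs := μ.tilted fun ω ↦ s * T ω with hμs
  have : IsProbabilityMeasure μs := isProbabilityMeasure_tilted (h s)
  have hcheb := meas_ge_le_variance_div_sq (memLp_tilted_mul (hint s) 2) hD
  rw [integral_tilted_mul_self (hint s), hsD, variance_tilted_mul (hint s)] at hcheb
  have hcheb' : μs.real {ω | D ≤ |T ω - (a + D)|} ≤ 1 / 2 := by
    refine ENNReal.toReal_le_of_le_ofReal (by norm_num) (hcheb.trans (ENNReal.ofReal_le_ofReal ?_))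
    rw [div_le_iff₀ (by positivity)]
    linarith [hvar s]
  have hmeasT : AEMeasurable T μs :=
    (memLp_tilted_mul (hint s) 2).aestronglyMeasurable.aemeasurable
  have hbig : 1 / 2 ≤ μs.real {ω | |T ω - (a + D)| < D} := by
    have hnm : NullMeasurableSet {ω | D ≤ |T ω - (a + D)|} μs :=
      nullMeasurableSet_le aemeasurable_const (by fun_prop)
    have h1 := probReal_compl_eq_one_sub₀ hnm
    have h2 : {ω | D ≤ |T ω - (a + D)|}ᶜ = {ω | |T ω - (a + D)| < D} := by
      ext ω; simp
    rw [h2] at h1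
    linarith
  -- on the window the density of `μs` is at most `exp (s (a + 2 D) - cgf T μ s)`, as `0 ≤ s`
  have hle : μs.real {ω | |T ω - (a + D)| < D}
      ≤ Real.exp (s * (a + 2 * D) - cgf T μ s) * μ.real {ω | |T ω - (a + D)| < D} := by
    have h1 : μs {ω | |T ω - (a + D)| < D}
        ≤ ENNReal.ofReal (Real.exp (s * (a + 2 * D) - cgf T μ s))
          * μ {ω | |T ω - (a + D)| < D} := by
      rw [hμs, tilted_mul_apply_cgf _ (h s), ← setLIntegral_const]
      refine setLIntegral_mono measurable_const fun ω hω ↦ ?_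
      refine ENNReal.ofReal_le_ofReal (Real.exp_le_exp.mpr ?_)
      have h2 : T ω ≤ a + 2 * D := by
        have := (abs_lt.mp (show |T ω - (a + D)| < D from hω)).2; linarith
      have := mul_le_mul_of_nonneg_left h2 hs.1
      linarith
    have h2 := ENNReal.toReal_mono (by finiteness) h1
    rwa [ENNReal.toReal_mul, ENNReal.toReal_ofReal (Real.exp_pos _).le] at h2
  have hsub : μ.real {ω | |T ω - (a + D)| < D} ≤ μ.real {ω | a < T ω} :=
    measureReal_mono fun ω hω ↦ by
      have := (abs_lt.mp (show |T ω - (a + D)| < D from hω)).1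
      show a < T ω
      linarith
  have hexp : Real.exp (cgf T μ s - s * (a + 2 * D))
      * Real.exp (s * (a + 2 * D) - cgf T μ s) = 1 := by
    rw [← Real.exp_add]; simp
  calc Real.exp (cgf T μ s - s * (a + 2 * D)) / 2
      = Real.exp (cgf T μ s - s * (a + 2 * D)) * (1 / 2) := by ring
    _ ≤ Real.exp (cgf T μ s - s * (a + 2 * D))
        * (Real.exp (s * (a + 2 * D) - cgf T μ s) * μ.real {ω | |T ω - (a + D)| < D}) := by
        gcongr; exact hbig.trans hle
    _ = μ.real {ω | |T ω - (a + D)| < D} := by rw [← mul_assoc, hexp, one_mul]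
    _ ≤ _ := hsub

section Bounded

variable [IsProbabilityMeasure μ] {M : ℝ}

lemma integrable_exp_mul_of_abs_le (hm : AEMeasurable T μ) (hb : ∀ᵐ ω ∂μ, |T ω| ≤ M) (t : ℝ) :
    Integrable (fun ω ↦ Real.exp (t * T ω)) μ :=
  integrable_exp_mul_of_mem_Icc (a := -M) (b := M) hm (hb.mono fun _ h ↦ abs_le.mp h)

lemma iteratedDeriv_two_cgf_le (hm : AEMeasurable T μ) (hb : ∀ᵐ ω ∂μ, |T ω| ≤ M) (t : ℝ) :
    iteratedDeriv 2 (cgf T μ) t ≤ M ^ 2 := by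
  have h := integrable_exp_mul_of_abs_le hm hb
  rw [← variance_tilted_mul (mem_interior_integrableExpSet h t)]
  have : IsProbabilityMeasure (μ.tilted fun ω ↦ t * T ω) := isProbabilityMeasure_tilted (h t)
  have hac := tilted_absolutelyContinuous μ (fun ω ↦ t * T ω)
  refine (variance_le_sq_of_bounded (a := -M) (b := M)
    (hac.ae_le (hb.mono fun _ h ↦ abs_le.mp h)) (hm.mono_ac hac)).trans (le_of_eq ?_)
  ring

lemma cgf_le_sq_of_abs_le (hm : AEMeasurable T μ) (hb : ∀ᵐ ω ∂μ, |T ω| ≤ M)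
    (hmean : ∫ ω, T ω ∂μ = 0) (hM : 0 ≤ M) (t : ℝ) : cgf T μ t ≤ M ^ 2 * t ^ 2 := by
  have h := (hasSubgaussianMGF_of_mem_Icc_of_integral_eq_zero (a := -M) (b := M) hm
    (hb.mono fun _ h ↦ abs_le.mp h) hmean).cgf_le t
  have e : (((‖M - -M‖₊ / 2) ^ 2 : NNReal) : ℝ) = M ^ 2 := by
    push_cast
    rw [sub_neg_eq_add, Real.norm_of_nonneg (by linarith)]; ring
  rw [e] at h
  nlinarith [mul_nonneg (sq_nonneg M) (sq_nonneg t)]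

lemma cgf_le_mul_of_abs_le (hm : AEMeasurable T μ) (hb : ∀ᵐ ω ∂μ, |T ω| ≤ M) {t : ℝ}
    (ht : 0 ≤ t) : cgf T μ t ≤ M * t := by
  have h := integrable_exp_mul_of_abs_le hm hb t
  rw [cgf, Real.log_le_iff_le_exp (mgf_pos h)]
  have h1 : mgf T μ t ≤ ∫ _, Real.exp (M * t) ∂μ := by
    refine integral_mono_ae h (integrable_const _) (hb.mono fun ω hω ↦ Real.exp_le_exp.mpr ?_)
    rw [mul_comm]
    exact mul_le_mul_of_nonneg_right (le_of_abs_le hω) ht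
  simpa using h1

end Bounded

/-- Jensen's inequality. -/
lemma cgf_nonneg_of_integral_eq_zero [IsProbabilityMeasure μ] (hT : Integrable T μ)
    (h : ∀ t, Integrable (fun ω ↦ Real.exp (t * T ω)) μ)
    (hmean : ∫ ω, T ω ∂μ = 0) (t : ℝ) : 0 ≤ cgf T μ t := by
  refine Real.log_nonneg ?_
  have h1 : ∫ ω, (t * T ω + 1) ∂μ ≤ mgf T μ t :=
    integral_mono ((hT.const_mul t).add (integrable_const 1)) (h t)
      fun ω ↦ Real.add_one_le_exp _
  rw [integral_add (hT.const_mul t) (integrable_const 1), integral_const_mul, hmean] at h1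
  simpa using h1

end CumulantGeneratingFunctions

/-! ### The limiting cumulant generating function and tails of prime sums -/

section LimitCumulant

open Filter Topology Set

lemma abs_log_sub_log_le {x m ε : ℝ} (hm : 0 < m) (hε : ε ≤ 1 / 2) (h : |x - m| ≤ m * ε) :
    |Real.log x - Real.log m| ≤ 2 * ε := by
  obtain ⟨h1, h2⟩ := abs_le.mp h
  have hε0 : 0 ≤ ε := nonneg_of_mul_nonneg_right ((abs_nonneg _).trans h) hm
  have hx : 0 < x := by nlinarith
  have h3 : Real.log x - Real.log m ≤ ε := by
    rw [← Real.log_div hx.ne' hm.ne']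
    refine (Real.log_le_sub_one_of_pos (by positivity)).trans ?_
    rw [sub_le_iff_le_add, div_le_iff₀ hm]; linarith
  have h4 : Real.log m - Real.log x ≤ 2 * ε := by
    rw [← Real.log_div hm.ne' hx.ne']
    refine (Real.log_le_sub_one_of_pos (by positivity)).trans ?_
    rw [sub_le_iff_le_add, div_le_iff₀ hx]
    have h5 : m * (1 - ε) ≤ x := by linarith
    have h6 : 1 ≤ (2 * ε + 1) * (1 - ε) := by nlinarith
    calc m = m * 1 := (mul_one m).symm
      _ ≤ m * ((2 * ε + 1) * (1 - ε)) := by gcongr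
      _ = (2 * ε + 1) * (m * (1 - ε)) := by ring
      _ ≤ _ := by gcongr
  rw [abs_le]; constructor <;> linarith

variable {Ω Ω' : Type*} [MeasurableSpace Ω] [MeasurableSpace Ω'] {μ : Measure Ω}
  {ν : Measure Ω'} [IsProbabilityMeasure ν] {W : Nat.Primes → Ω → ℝ} {Z : Ω' → ℝ}

lemma exists_forall_le_log_primes_rpow {A : ℝ} (hA : 0 < A) (R : ℝ) :
    ∃ P : ℝ, ∀ p : Nat.Primes, P ≤ ((p : ℕ) : ℝ) → R ≤ Real.log (p : ℕ) ^ A := by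
  have h : Tendsto (fun x : ℝ ↦ Real.log x ^ A) atTop atTop :=
    (tendsto_rpow_atTop hA).comp Real.tendsto_log_atTop
  obtain ⟨P, hP⟩ := eventually_atTop.mp (h.eventually_ge_atTop R)
  exact ⟨P, fun p hp ↦ hP _ hp⟩

/-- In logarithmic form the (ULD) hypothesis is an additive approximation of cumulant generating
functions. -/
lemma IsULDLimit.exists_abs_cgf_sub_le (h : IsULDLimit μ W ν Z) {A : ℝ} (hA : 0 < A) :
    ∃ C P : ℝ, ∀ p : Nat.Primes, P ≤ ((p : ℕ) : ℝ) → ∀ t,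
      |cgf (W p) μ t - cgf Z ν t| ≤ C / Real.log (p : ℕ) ^ A := by
  obtain ⟨C, P, hP⟩ := h.2 A hA
  obtain ⟨P', hP'⟩ := exists_forall_le_log_primes_rpow hA (2 * C)
  refine ⟨2 * C, max P P', fun p hp t ↦ ?_⟩
  have h1 := (hP p (by exact_mod_cast (le_max_left _ _).trans hp) t).2
  have hlog : 0 < Real.log (p : ℕ) := Real.log_pos (by exact_mod_cast p.2.one_lt)
  have h2 := abs_log_sub_log_le (mgf_pos (h.1 t)) (by
    rw [div_le_iff₀ (by positivity)]; linarith [hP' p ((le_max_right _ _).trans hp)]) h1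
  rw [mul_div_assoc]
  exact h2

/-- The cumulant generating function of the limit is approximated, uniformly on the real line, by
that of some `W p`; this transfers inequalities valid for all `W p` to the limit. -/
lemma IsULDLimit.exists_abs_cgf_sub_le_of_pos (h : IsULDLimit μ W ν Z) {δ : ℝ} (hδ : 0 < δ) :
    ∃ p, ∀ t, |cgf (W p) μ t - cgf Z ν t| ≤ δ := by
  obtain ⟨C, P, hP⟩ := h.exists_abs_cgf_sub_le one_pos
  obtain ⟨P', hP'⟩ := exists_forall_le_log_primes_rpow one_pos (C / δ)
  obtain ⟨p, hp, hpp⟩ := Nat.exists_infinite_primes ⌈max P P'⌉₊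
  have hp' : max P P' ≤ (p : ℝ) := (Nat.le_ceil _).trans (by exact_mod_cast hp)
  refine ⟨⟨p, hpp⟩, fun t ↦ (hP ⟨p, hpp⟩ ((le_max_left _ _).trans hp') t).trans ?_⟩
  have h1 := hP' ⟨p, hpp⟩ ((le_max_right _ _).trans hp')
  have hlog : 0 < Real.log (p : ℕ) := Real.log_pos (by exact_mod_cast hpp.one_lt)
  rw [div_le_iff₀ hδ] at h1
  rw [div_le_iff₀ (by positivity)]
  linarith

variable [IsProbabilityMeasure μ] {M : ℝ}

lemma IsULDLimit.cgf_nonneg (h : IsULDLimit μ W ν Z) (hmeas : ∀ p, Measurable (W p))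
    (hb : ∀ p, ∀ᵐ ω ∂μ, |W p ω| ≤ M) (hmean : ∀ p, ∫ ω, W p ω ∂μ = 0) (t : ℝ) :
    0 ≤ cgf Z ν t := by
  refine le_of_forall_pos_le_add fun δ hδ ↦ ?_
  obtain ⟨p, hp⟩ := h.exists_abs_cgf_sub_le_of_pos hδ
  have hi := integrable_exp_mul_of_abs_le (hmeas p).aemeasurable (hb p)
  have := cgf_nonneg_of_integral_eq_zero (integrable_of_mem_interior_integrableExpSet
    (mem_interior_integrableExpSet hi 0)) hi (hmean p) t
  linarith [(abs_le.mp (hp t)).2]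

lemma IsULDLimit.cgf_le_mul (h : IsULDLimit μ W ν Z) (hmeas : ∀ p, Measurable (W p))
    (hb : ∀ p, ∀ᵐ ω ∂μ, |W p ω| ≤ M) {t : ℝ} (ht : 0 ≤ t) : cgf Z ν t ≤ M * t := by
  refine le_of_forall_pos_le_add fun δ hδ ↦ ?_
  obtain ⟨p, hp⟩ := h.exists_abs_cgf_sub_le_of_pos hδ
  have := cgf_le_mul_of_abs_le (hmeas p).aemeasurable (hb p) ht
  linarith [(abs_le.mp (hp t)).1]

lemma IsULDLimit.cgf_le_sq (h : IsULDLimit μ W ν Z) (hmeas : ∀ p, Measurable (W p))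
    (hb : ∀ p, ∀ᵐ ω ∂μ, |W p ω| ≤ M) (hmean : ∀ p, ∫ ω, W p ω ∂μ = 0) (hM : 0 ≤ M) (t : ℝ) :
    cgf Z ν t ≤ M ^ 2 * t ^ 2 := by
  refine le_of_forall_pos_le_add fun δ hδ ↦ ?_
  obtain ⟨p, hp⟩ := h.exists_abs_cgf_sub_le_of_pos hδ
  have := cgf_le_sq_of_abs_le (hmeas p).aemeasurable (hb p) (hmean p) hM t
  linarith [(abs_le.mp (hp t)).1]

lemma IsULDLimit.deriv_cgf_zero_eq (h : IsULDLimit μ W ν Z) (hmeas : ∀ p, Measurable (W p))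
    (hb : ∀ p, ∀ᵐ ω ∂μ, |W p ω| ≤ M) (hmean : ∀ p, ∫ ω, W p ω ∂μ = 0) :
    deriv (cgf Z ν) 0 = 0 := by
  refine IsLocalMin.deriv_eq_zero (Eventually.of_forall fun t ↦ ?_)
  rw [cgf_zero]
  exact h.cgf_nonneg hmeas hb hmean t

/-- The cumulant generating function of the limit; convexity turns the bounds for its values into
bounds for its derivative. -/
lemma IsULDLimit.isCumulantProfile (h : IsULDLimit μ W ν Z) (hmeas : ∀ p, Measurable (W p))
    (hb : ∀ p, ∀ᵐ ω ∂μ, |W p ω| ≤ M) (hmean : ∀ p, ∫ ω, W p ω ∂μ = 0) (hM : 0 ≤ M) :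
    IsCumulantProfile (cgf Z ν) (deriv (cgf Z ν)) (2 * M + 4 * M ^ 2 + 1) := by
  have hmono := monotone_deriv_cgf h.1
  have h0 := h.deriv_cgf_zero_eq hmeas hb hmean
  have key : ∀ u, 0 < u → deriv (cgf Z ν) u * u ≤ cgf Z ν (2 * u) := by
    intro u hu
    obtain ⟨ξ, hξ, e⟩ := exists_hasDerivAt_eq_slope (cgf Z ν) (deriv (cgf Z ν))
      (by linarith : u < 2 * u) (fun x _ ↦ (hasDerivAt_cgf h.1 x).continuousAt.continuousWithinAt)
      (fun x _ ↦ hasDerivAt_cgf h.1 x)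
    have h1 := hmono hξ.1.le
    rw [e, le_div_iff₀ (by linarith)] at h1
    have := h.cgf_nonneg hmeas hb hmean u
    linarith
  refine ⟨by positivity, (differentiable_deriv_cgf h.1).continuous, hasDerivAt_cgf h.1, cgf_zero,
    fun u hu ↦ by rw [← h0]; exact hmono hu, fun u hu ↦ ?_, fun u hu ↦ ?_⟩
  · rcases hu.eq_or_lt with rfl | hu
    · rw [h0]; positivity
    · have h1 := (key u hu).trans (h.cgf_le_mul hmeas hb (by linarith))
      have h2 : deriv (cgf Z ν) u ≤ 2 * M := le_of_mul_le_mul_right (by linarith) hu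
      nlinarith [sq_nonneg M]
  · rcases hu.eq_or_lt with rfl | hu
    · rw [h0, mul_zero]
    · have h1 := (key u hu).trans (h.cgf_le_sq hmeas hb hmean hM _)
      have h2 : deriv (cgf Z ν) u ≤ 4 * M ^ 2 * u :=
        le_of_mul_le_mul_right (by linarith) hu
      nlinarith

/-- The limit is centred, and Jensen's inequality is strict unless it vanishes almost surely. -/
lemma IsULDLimit.cgf_pos (h : IsULDLimit μ W ν Z) (hmeas : ∀ p, Measurable (W p))
    (hb : ∀ p, ∀ᵐ ω ∂μ, |W p ω| ≤ M) (hmean : ∀ p, ∫ ω, W p ω ∂μ = 0) (hZ : ¬ Z =ᵐ[ν] 0)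
    {u : ℝ} (hu : 0 < u) : 0 < cgf Z ν u := by
  have hint := mem_interior_integrableExpSet h.1
  have hZi : Integrable Z ν := integrable_of_mem_interior_integrableExpSet (hint 0)
  have hZ0 : ∫ x, Z x ∂ν = 0 := by
    have := deriv_cgf_zero (hint 0)
    rw [h.deriv_cgf_zero_eq hmeas hb hmean] at this
    simpa using this.symm
  refine (h.cgf_nonneg hmeas hb hmean u).lt_of_ne' fun hne ↦ hZ ?_
  have hmgf : mgf Z ν u = 1 := Real.eq_one_of_pos_of_log_eq_zero (mgf_pos (h.1 u)) hne
  have hI : Integrable (fun x ↦ Real.exp (u * Z x) - (u * Z x + 1)) ν :=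
    (h.1 u).sub ((hZi.const_mul u).add (integrable_const 1))
  have h1 : ∫ x, (Real.exp (u * Z x) - (u * Z x + 1)) ∂ν = 0 := by
    have e1 : ∫ x, Real.exp (u * Z x) ∂ν = 1 := hmgf
    have e2 : ∫ x, (u * Z x + 1) ∂ν = 1 := by
      rw [integral_add (hZi.const_mul u) (integrable_const 1), integral_const_mul, hZ0]
      simp
    refine (integral_sub (h.1 u) ((hZi.const_mul u).add (integrable_const 1))).trans ?_
    exact sub_eq_zero.mpr (e1.trans e2.symm)
  rw [integral_eq_zero_iff_of_nonneg
    (fun x ↦ sub_nonneg.mpr (Real.add_one_le_exp (u * Z x))) hI] at h1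
  filter_upwards [h1] with x hx
  by_contra hZx
  have := Real.add_one_lt_exp (mul_ne_zero hu.ne' hZx)
  simp only [Pi.zero_apply] at hx
  linarith

lemma IsULDLimit.integrableOn_cumulantIntegrand (h : IsULDLimit μ W ν Z)
    (hmeas : ∀ p, Measurable (W p)) (hb : ∀ p, ∀ᵐ ω ∂μ, |W p ω| ≤ M)
    (hmean : ∀ p, ∫ ω, W p ω ∂μ = 0) (hM : 0 ≤ M) {σ : ℝ} (hσ : 1 / 2 < σ) (hσ' : σ < 1) :
    IntegrableOn (cumulantIntegrand ν Z σ) (Ioi 0) := by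
  have hσ0 : 0 < σ := by linarith
  exact (h.isCumulantProfile hmeas hb hmean hM).integrableOn_f_div_rpow
    ((one_lt_div hσ0).mpr hσ') ((div_lt_iff₀ hσ0).mpr (by linarith))

lemma IsULDLimit.cumulantG_pos (h : IsULDLimit μ W ν Z)
    (hmeas : ∀ p, Measurable (W p)) (hb : ∀ p, ∀ᵐ ω ∂μ, |W p ω| ≤ M)
    (hmean : ∀ p, ∫ ω, W p ω ∂μ = 0) (hM : 0 ≤ M) (hZ : ¬ Z =ᵐ[ν] 0) {σ : ℝ} (hσ : 1 / 2 < σ)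
    (hσ' : σ < 1) : 0 < cumulantG ν Z σ := by
  have hpos : ∀ u ∈ Ioi (0 : ℝ), 0 < cumulantIntegrand ν Z σ u := fun u hu ↦
    div_pos (h.cgf_pos hmeas hb hmean hZ hu) (Real.rpow_pos_of_pos hu _)
  rw [cumulantG, setIntegral_pos_iff_support_of_nonneg_ae
    ((ae_restrict_mem measurableSet_Ioi).mono fun u hu ↦ (hpos u hu).le)
    (h.integrableOn_cumulantIntegrand hmeas hb hmean hM hσ hσ')]
  have hsub : Ioi (0 : ℝ) ⊆ Function.support (cumulantIntegrand ν Z σ) :=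
    fun u hu ↦ (hpos u hu).ne'
  rw [inter_eq_right.mpr hsub, Real.volume_Ioi]
  exact ENNReal.zero_lt_top

end LimitCumulant

section PrimeSumTails

open Filter Topology Set

variable {Ω Ω' : Type*} [MeasurableSpace Ω] [MeasurableSpace Ω'] {μ : Measure Ω}
  {W : Nat.Primes → Ω → ℝ} {M : ℝ}

/-- The linear approximation `∑_{p ≤ y} p^{-σ} W(p)` of `log |L|` or `arg L`. -/
noncomputable def primeSum (W : Nat.Primes → Ω → ℝ) (σ y : ℝ) (ω : Ω) : ℝ :=
  ∑ p ∈ primesUpTo y, ((p : ℕ) : ℝ) ^ (-σ) * W p ω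

lemma measurable_primeSum (hmeas : ∀ p, Measurable (W p)) (σ y : ℝ) :
    Measurable (primeSum W σ y) :=
  Finset.measurable_fun_sum _ fun p _ ↦ (hmeas p).const_mul _

lemma abs_primeSum_le (hb : ∀ p, ∀ᵐ ω ∂μ, |W p ω| ≤ M) (σ y : ℝ) :
    ∀ᵐ ω ∂μ, |primeSum W σ y ω| ≤ ∑ p ∈ primesUpTo y, ((p : ℕ) : ℝ) ^ (-σ) * M := by
  filter_upwards [ae_all_iff.mpr hb] with ω hω
  refine (Finset.abs_sum_le_sum_abs _ _).trans (Finset.sum_le_sum fun p _ ↦ ?_)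
  rw [abs_mul, abs_of_nonneg (by positivity)]
  gcongr
  exact hω p

variable [IsProbabilityMeasure μ]

lemma integrable_exp_mul_primeSum (hmeas : ∀ p, Measurable (W p))
    (hb : ∀ p, ∀ᵐ ω ∂μ, |W p ω| ≤ M) (σ y t : ℝ) :
    Integrable (fun ω ↦ Real.exp (t * primeSum W σ y ω)) μ :=
  integrable_exp_mul_of_abs_le (measurable_primeSum hmeas σ y).aemeasurable
    (abs_primeSum_le hb σ y) t

lemma integral_primeSum (hmeas : ∀ p, Measurable (W p)) (hb : ∀ p, ∀ᵐ ω ∂μ, |W p ω| ≤ M)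
    (hmean : ∀ p, ∫ ω, W p ω ∂μ = 0) (σ y : ℝ) : ∫ ω, primeSum W σ y ω ∂μ = 0 := by
  have hi : ∀ p, Integrable (W p) μ := fun p ↦ integrable_of_mem_interior_integrableExpSet
    (mem_interior_integrableExpSet
      (integrable_exp_mul_of_abs_le (hmeas p).aemeasurable (hb p)) 0)
  simp only [primeSum]
  rw [integral_finsetSum _ fun p _ ↦ (hi p).const_mul _]
  simp [integral_const_mul, hmean]

lemma cgf_primeSum_eq (hmeas : ∀ p, Measurable (W p)) (hb : ∀ p, ∀ᵐ ω ∂μ, |W p ω| ≤ M)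
    (hindep : iIndepFun W μ) (σ y t : ℝ) : cgf (primeSum W σ y) μ t
      = ∑ p ∈ primesUpTo y, cgf (fun ω ↦ ((p : ℕ) : ℝ) ^ (-σ) * W p ω) μ t := by
  have h1 : iIndepFun (fun (p : Nat.Primes) ω ↦ ((p : ℕ) : ℝ) ^ (-σ) * W p ω) μ :=
    hindep.comp (fun p x ↦ ((p : ℕ) : ℝ) ^ (-σ) * x) fun p ↦ measurable_const_mul _
  have h2 := h1.cgf_sum (t := t) (s := primesUpTo y) (fun p ↦ (hmeas p).const_mul _) fun p _ ↦ by
    simp_rw [← mul_assoc]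
    exact integrable_exp_mul_of_abs_le (hmeas p).aemeasurable (hb p) _
  rw [← h2]
  congr 1
  ext ω
  simp [primeSum]

lemma cgf_primeSum (hmeas : ∀ p, Measurable (W p)) (hb : ∀ p, ∀ᵐ ω ∂μ, |W p ω| ≤ M)
    (hindep : iIndepFun W μ) (σ y t : ℝ) : cgf (primeSum W σ y) μ t
      = ∑ p ∈ primesUpTo y, cgf (W p) μ (((p : ℕ) : ℝ) ^ (-σ) * t) := by
  rw [cgf_primeSum_eq hmeas hb hindep]
  simp only [cgf, mgf_const_mul]

lemma iteratedDeriv_two_cgf_primeSum_le (hmeas : ∀ p, Measurable (W p))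
    (hb : ∀ p, ∀ᵐ ω ∂μ, |W p ω| ≤ M) (hindep : iIndepFun W μ) {σ : ℝ} (hσ : 1 / 2 < σ) (y t : ℝ) :
    iteratedDeriv 2 (cgf (primeSum W σ y) μ) t
      ≤ M ^ 2 * ∑' p : Nat.Primes, ((p : ℕ) : ℝ) ^ (-(2 * σ)) := by
  rw [funext fun t ↦ cgf_primeSum_eq hmeas hb hindep σ y t, iteratedDeriv_fun_sum]
  · rw [← tsum_mul_left]
    have hs : Summable fun p : Nat.Primes ↦ M ^ 2 * ((p : ℕ) : ℝ) ^ (-(2 * σ)) :=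
      (Nat.Primes.summable_rpow.mpr (by linarith)).mul_left _
    refine le_trans (Finset.sum_le_sum fun p _ ↦ ?_)
      (hs.sum_le_tsum (primesUpTo y) fun p _ ↦ by positivity)
    refine (iteratedDeriv_two_cgf_le (M := ((p : ℕ) : ℝ) ^ (-σ) * M)
      ((hmeas p).const_mul _).aemeasurable ?_ t).trans (le_of_eq ?_)
    · filter_upwards [hb p] with ω hω
      rw [abs_mul, abs_of_nonneg (by positivity)]
      gcongr
    · rw [mul_pow, ← Real.rpow_mul_natCast (by positivity), mul_comm]
      congr 2; push_cast; ring
  · intro p _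
    refine (analyticOnNhd_cgf_univ (fun t ↦ ?_) t (mem_univ t)).contDiffAt
    simp_rw [← mul_assoc]
    exact integrable_exp_mul_of_abs_le (hmeas p).aemeasurable (hb p) _

/-- Tail asymptotics for random variables at bounded distance from `∑_{p ≤ y} p^{-σ} W(p)`. -/
theorem IsULDLimit.hasTailAsymptotic {ν : Measure Ω'} [IsProbabilityMeasure ν] {Z : Ω' → ℝ}
    (h : IsULDLimit μ W ν Z) (hmeas : ∀ p, Measurable (W p)) (hb : ∀ p, ∀ᵐ ω ∂μ, |W p ω| ≤ M)
    (hmean : ∀ p, ∫ ω, W p ω ∂μ = 0) (hindep : iIndepFun W μ) (hM : 0 ≤ M) (hZ : ¬ Z =ᵐ[ν] 0)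
    {σ : ℝ} (hσ : 1 / 2 < σ) (hσ' : σ < 1) {S : ℝ → Ω → ℝ} {B : ℝ} (hB : 0 ≤ B)
    (hS : ∀ y, ∀ᵐ ω ∂μ, |S y ω - primeSum W σ y ω| ≤ B) :
    HasTailAsymptotic σ (cumulantA ν Z σ) (fun τ y ↦ μ.real {ω | τ < S y ω}) := by
  have hprof := h.isCumulantProfile hmeas hb hmean hM
  have hi : ∀ p, ∀ t, Integrable (fun ω ↦ Real.exp (t * W p ω)) μ :=
    fun p ↦ integrable_exp_mul_of_abs_le (hmeas p).aemeasurable (hb p)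
  have hnn : ∀ p t, 0 ≤ cgf (W p) μ t := fun p t ↦ cgf_nonneg_of_integral_eq_zero
    (integrable_of_mem_interior_integrableExpSet (mem_interior_integrableExpSet (hi p) 0))
    (hi p) (hmean p) t
  obtain ⟨C₀, s₀, hC₀, -, H⟩ := hprof.exists_sum_bounds_of_limit (F := fun p ↦ cgf (W p) μ)
    (K' := M + M ^ 2) (by positivity) hσ hσ'
    (fun p u hu ↦ by
      have h1 := h.cgf_le_mul hmeas hb hu
      have h2 := cgf_le_mul_of_abs_le (hmeas p).aemeasurable (hb p) hu
      have h3 := h.cgf_nonneg hmeas hb hmean u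
      have h4 := hnn p u
      have h5 : 0 ≤ M ^ 2 * u := by positivity
      rw [abs_le]; constructor <;> linarith)
    (fun p u _ ↦ by
      have h1 := h.cgf_le_sq hmeas hb hmean hM u
      have h2 := cgf_le_sq_of_abs_le (hmeas p).aemeasurable (hb p) (hmean p) hM u
      have h3 := h.cgf_nonneg hmeas hb hmean u
      have h4 := hnn p u
      have h5 : 0 ≤ M * u ^ 2 := by positivity
      rw [abs_le]; constructor <;> linarith)
    (fun A hA ↦ by
      obtain ⟨C, P, hP⟩ := h.exists_abs_cgf_sub_le hA
      exact ⟨C, P, fun p hp u _ ↦ hP p hp u⟩)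
  set V := M ^ 2 * ∑' p : Nat.Primes, ((p : ℕ) : ℝ) ^ (-(2 * σ)) with hV
  have hV0 : 0 ≤ V := mul_nonneg (sq_nonneg M) (tsum_nonneg fun p ↦ by positivity)
  have hint := integrable_exp_mul_primeSum hmeas hb σ
  refine hasTailAsymptotic_of_cumulant_bounds (B := B) (D := B + 2 * (V + 1)) (C₀ := C₀) (s₀ := s₀)
    (Λ := fun y s ↦ cgf (primeSum W σ y) μ s) hσ hσ'
    (h.cumulantG_pos hmeas hb hmean hM hZ hσ hσ') hB (by linarith) hC₀ ?_ ?_ ?_ ?_ ?_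
  · intro y s _
    simp only [cgf_primeSum hmeas hb hindep]
    exact Finset.sum_nonneg fun p _ ↦ hnn p _
  · intro s hs y
    simp only [cgf_primeSum hmeas hb hindep]
    exact (H s hs y).1
  · intro s hs y hy
    simp only [cgf_primeSum hmeas hb hindep]
    exact (H s hs y).2 hy
  · intro τ y s hs
    calc μ.real {ω | τ < S y ω} ≤ μ.real {ω | τ - B ≤ primeSum W σ y ω} := by
          refine ENNReal.toReal_mono (measure_ne_top _ _) (measure_mono_ae ?_)
          filter_upwards [hS y] with ω hω hτ
          have h1 : τ < S y ω := hτ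
          show τ - B ≤ primeSum W σ y ω
          linarith [(abs_le.mp hω).2]
      _ ≤ _ := measure_ge_le_exp_cgf _ hs (hint y s)
      _ = _ := by congr 1; ring
  · intro τ y s₂ hτ hs₂ hle
    -- the windows `(τ + B, τ + B + 2 (V + 1))` are wide enough for Chebyshev's inequality
    have hV' : V ≤ (V + 1) ^ 2 / 2 := by nlinarith
    obtain ⟨s, hs0, hss, hs⟩ := exists_exp_le_measureReal_gt (hint y)
      (integral_primeSum hmeas hb hmean σ y) (a := τ + B) (D := V + 1) (by linarith) (by linarith)
      hs₂ (fun t ↦ (iteratedDeriv_two_cgf_primeSum_le hmeas hb hindep hσ y t).trans hV')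
      (le_trans (mul_le_mul_of_nonneg_left (by linarith) hs₂.le) hle)
    refine ⟨s, hs0, hss, ?_⟩
    rw [← add_assoc]
    refine hs.trans (ENNReal.toReal_mono (measure_ne_top _ _) (measure_mono_ae ?_))
    filter_upwards [hS y] with ω hω hτ
    have h1 : τ + B < primeSum W σ y ω := hτ
    show τ < S y ω
    linarith [(abs_le.mp hω).1]

end PrimeSumTails

/-! ### Euler products -/

section EulerProducts

open Filter Topology Set

variable {Ω Ω' : Type*} [MeasurableSpace Ω] [MeasurableSpace Ω'] {μ : Measure Ω}
  {d : ℕ} {M σ : ℝ} {X : Nat.Primes → Ω → Fin d → ℂ}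

lemma primes_cpow_ofReal (p : Nat.Primes) (σ : ℝ) :
    ((p : ℕ) : ℂ) ^ (σ : ℂ) = ((((p : ℕ) : ℝ) ^ σ : ℝ) : ℂ) := by
  rw [Complex.ofReal_cpow (by positivity)]; simp

lemma norm_div_cpow_sq_le {x : ℂ} (hx : ‖x‖ ≤ M) (p : Nat.Primes) (σ : ℝ) :
    ‖x / ((p : ℕ) : ℂ) ^ (σ : ℂ)‖ ^ 2 ≤ M ^ 2 * ((p : ℕ) : ℝ) ^ (-(2 * σ)) := by
  have e : (((p : ℕ) : ℝ) ^ σ) ^ 2 = ((p : ℕ) : ℝ) ^ (2 * σ) := by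
    rw [← Real.rpow_mul_natCast (by positivity)]; congr 1; push_cast; ring
  rw [primes_cpow_ofReal, norm_div, Complex.norm_real, Real.norm_of_nonneg (by positivity),
    div_pow, e, Real.rpow_neg (by positivity), ← div_eq_mul_inv]
  gcongr

lemma map_div_cpow (φ : ℂ →L[ℝ] ℝ) (x : ℂ) (p : Nat.Primes) (σ : ℝ) :
    φ (x / ((p : ℕ) : ℂ) ^ (σ : ℂ)) = ((p : ℕ) : ℝ) ^ (-σ) * φ x := by
  have e : x / ((p : ℕ) : ℂ) ^ (σ : ℂ) = (((p : ℕ) : ℝ) ^ (-σ)) • x := by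
    rw [primes_cpow_ofReal, Complex.real_smul, Real.rpow_neg (by positivity), Complex.ofReal_inv,
      div_eq_mul_inv, mul_comm]
  rw [e, map_smul, smul_eq_mul]

lemma norm_log_one_sub_inv_sub_le {z : ℂ} (hz : ‖z‖ ^ 2 ≤ 1 / 4) :
    ‖Complex.log (1 - z)⁻¹ - z‖ ≤ ‖z‖ ^ 2 := by
  have h1 : ‖z‖ ≤ 1 / 2 := abs_le_of_sq_le_sq' (by linarith) (by norm_num) |>.2
  refine (Complex.norm_log_one_sub_inv_sub_self_le (by linarith)).trans ?_
  have h2 : (1 - ‖z‖)⁻¹ ≤ 2 := by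
    rw [inv_le_comm₀ (by linarith) two_pos]; linarith
  have := mul_le_mul_of_nonneg_left h2 (sq_nonneg ‖z‖)
  linarith

/-- The logarithm of the Euler product differs from the sum `∑_{p ≤ y} p^{-σ} ∑_j X_j(p)` by a
bounded quantity. For all but finitely many primes this is the Taylor expansion of the logarithm,
with `∑ p^{-2σ}` convergent; at the remaining primes the logarithms are bounded by assumption.
The functional `φ` is the real or the imaginary part. -/
lemma exists_abs_sum_log_eulerFactor_sub_le (φ : ℂ →L[ℝ] ℝ) (hφ : ∀ z, |φ z| ≤ ‖z‖)
    (hσ : 1 / 2 < σ) (hbound : ∀ p, ∀ j, ∀ᵐ ω ∂μ, ‖X p ω j‖ ≤ M)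
    (hlog : ∀ p j, ∃ b : ℝ, ∀ᵐ ω ∂μ, |φ (Complex.log (eulerFactor X σ p j ω))| ≤ b) :
    ∃ B : ℝ, 0 ≤ B ∧ ∀ y, ∀ᵐ ω ∂μ,
      |∑ p ∈ primesUpTo y, ∑ j, φ (Complex.log (eulerFactor X σ p j ω))
        - primeSum (fun p ω ↦ ∑ j, φ (X p ω j)) σ y ω| ≤ B := by
  choose b hb using hlog
  set v : Nat.Primes → ℝ := fun p ↦ M ^ 2 * ((p : ℕ) : ℝ) ^ (-(2 * σ)) with hv
  have hvs : Summable v := (Nat.Primes.summable_rpow.mpr (by linarith)).mul_left _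
  set e : Nat.Primes → ℝ := fun p ↦ if v p ≤ 1 / 4 then d * v p
    else ∑ j : Fin d, (|b p j| + ((p : ℕ) : ℝ) ^ (-σ) * |M|) with he
  have hes : Summable e := by
    have h1 : e =ᶠ[cofinite] fun p ↦ d * v p := by
      filter_upwards [hvs.tendsto_cofinite_zero.eventually_le_const
        (by norm_num : (0 : ℝ) < 1 / 4)] with p hp
      simp only [he, if_pos hp]
    exact (summable_congr_cofinite h1).mpr (hvs.mul_left _)
  have he0 : ∀ p, 0 ≤ e p := by
    intro p
    simp only [he]
    split_ifs <;> positivity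
  refine ⟨∑' p, e p, tsum_nonneg he0, fun y ↦ ?_⟩
  have hb' := ae_all_iff.mpr fun p ↦ ae_all_iff.mpr (hb p)
  have hX' := ae_all_iff.mpr fun p ↦ ae_all_iff.mpr (hbound p)
  filter_upwards [hb', hX'] with ω hbω hXω
  rw [primeSum, ← Finset.sum_sub_distrib]
  refine ((Finset.abs_sum_le_sum_abs _ _).trans (Finset.sum_le_sum fun p _ ↦ ?_)).trans
    (hes.sum_le_tsum (primesUpTo y) fun p _ ↦ he0 p)
  rw [Finset.mul_sum, ← Finset.sum_sub_distrib]
  refine (Finset.abs_sum_le_sum_abs _ _).trans ?_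
  simp only [he]
  split_ifs with hp
  · have : ∀ j ∈ Finset.univ, |φ (Complex.log (eulerFactor X σ p j ω))
        - ((p : ℕ) : ℝ) ^ (-σ) * φ (X p ω j)| ≤ v p := by
      intro j _
      have hz := norm_div_cpow_sq_le (hXω p j) p σ
      rw [← map_div_cpow, ← map_sub]
      exact (hφ _).trans ((norm_log_one_sub_inv_sub_le (hz.trans hp)).trans hz)
    refine (Finset.sum_le_sum this).trans (le_of_eq ?_)
    simp
  · refine Finset.sum_le_sum fun j _ ↦ (abs_sub _ _).trans ?_
    rw [abs_mul, abs_of_nonneg (by positivity : 0 ≤ ((p : ℕ) : ℝ) ^ (-σ))]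
    exact add_le_add ((hbω p j).trans (le_abs_self _)) (mul_le_mul_of_nonneg_left
      ((hφ _).trans ((hXω p j).trans (le_abs_self _))) (by positivity))

/-- Tail asymptotics for the real or imaginary part of the logarithm of the Euler product. -/
theorem hasTailAsymptotic_of_log_eulerFactor [IsProbabilityMeasure μ] {ν : Measure Ω'}
    [IsProbabilityMeasure ν] {Z : Ω' → ℝ} (φ : ℂ →L[ℝ] ℝ) (hφ : ∀ z, |φ z| ≤ ‖z‖)
    (hσ : 1 / 2 < σ) (hσ' : σ < 1) (hmeas : ∀ p, Measurable (X p)) (hindep : iIndepFun X μ)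
    (hbound : ∀ p, ∀ j, ∀ᵐ ω ∂μ, ‖X p ω j‖ ≤ M) (hmean : ∀ p, ∀ j, ∫ ω, X p ω j ∂μ = 0)
    (hlog : ∀ p j, ∃ b : ℝ, ∀ᵐ ω ∂μ, |φ (Complex.log (eulerFactor X σ p j ω))| ≤ b)
    {S : ℝ → Ω → ℝ} (hS : ∀ y, ∀ᵐ ω ∂μ,
      S y ω = ∑ p ∈ primesUpTo y, ∑ j, φ (Complex.log (eulerFactor X σ p j ω)))
    (h : IsULDLimit μ (fun p ω ↦ ∑ j, φ (X p ω j)) ν Z) (hZ : ¬ Z =ᵐ[ν] 0) :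
    IntegrableOn (cumulantIntegrand ν Z σ) (Ioi 0) ∧ 0 < cumulantG ν Z σ ∧
      HasTailAsymptotic σ (cumulantA ν Z σ) (fun τ y ↦ μ.real {ω | τ < S y ω}) := by
  have hg : Measurable fun v : Fin d → ℂ ↦ ∑ j, φ (v j) := by fun_prop
  have hmeas' : ∀ p, Measurable fun ω ↦ ∑ j, φ (X p ω j) := fun p ↦ hg.comp (hmeas p)
  have hindep' : iIndepFun (fun p ω ↦ ∑ j, φ (X p ω j)) μ :=
    hindep.comp (fun _ v ↦ ∑ j, φ (v j)) fun _ ↦ hg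
  have hXi : ∀ p j, Integrable (fun ω ↦ X p ω j) μ := fun p j ↦
    Integrable.of_bound ((measurable_pi_apply j).comp (hmeas p)).aestronglyMeasurable M (hbound p j)
  have hmean' : ∀ p, ∫ ω, ∑ j, φ (X p ω j) ∂μ = 0 := by
    intro p
    rw [integral_finsetSum _ fun j _ ↦ φ.integrable_comp (hXi p j)]
    refine Finset.sum_eq_zero fun j _ ↦ ?_
    rw [φ.integral_comp_comm (hXi p j), hmean p j, map_zero]
  have hb' : ∀ p, ∀ᵐ ω ∂μ, |∑ j, φ (X p ω j)| ≤ d * |M| := by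
    intro p
    filter_upwards [ae_all_iff.mpr (hbound p)] with ω hω
    refine (Finset.abs_sum_le_sum_abs _ _).trans ((Finset.sum_le_sum fun j _ ↦
      (hφ _).trans ((hω j).trans (le_abs_self M))).trans (le_of_eq ?_))
    simp
  have hM' : 0 ≤ d * |M| := by positivity
  obtain ⟨B, hB, hSB⟩ := exists_abs_sum_log_eulerFactor_sub_le φ hφ hσ hbound hlog
  refine ⟨h.integrableOn_cumulantIntegrand hmeas' hb' hmean' hM' hσ hσ',
    h.cumulantG_pos hmeas' hb' hmean' hM' hZ hσ hσ',
    h.hasTailAsymptotic hmeas' hb' hmean' hindep' hM' hZ hσ hσ' hB fun y ↦ ?_⟩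
  filter_upwards [hS y, hSB y] with ω h1 h2
  rwa [h1]

lemma exists_abs_log_norm_eulerFactor_le {p : Nat.Primes} {j : Fin d} {δ : ℝ} (hδ : 0 < δ)
    (hσ : 0 ≤ σ) (hbound : ∀ᵐ ω ∂μ, ‖X p ω j‖ ≤ M)
    (h : ∀ᵐ ω ∂μ, δ ≤ ‖1 - X p ω j / ((p : ℕ) : ℂ) ^ (σ : ℂ)‖) :
    ∃ b : ℝ, ∀ᵐ ω ∂μ, |Real.log ‖eulerFactor X σ p j ω‖| ≤ b := by
  refine ⟨max (-Real.log δ) (Real.log (1 + |M|)), ?_⟩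
  filter_upwards [hbound, h] with ω h1 h2
  rw [eulerFactor, norm_inv, Real.log_inv, abs_neg, abs_le']
  have h3 : ‖1 - X p ω j / ((p : ℕ) : ℂ) ^ (σ : ℂ)‖ ≤ 1 + |M| := by
    refine (norm_sub_le _ _).trans ?_
    rw [norm_one, norm_div, primes_cpow_ofReal, Complex.norm_real,
      Real.norm_of_nonneg (by positivity)]
    have h4 : 1 ≤ ((p : ℕ) : ℝ) ^ σ :=
      Real.one_le_rpow (by exact_mod_cast p.2.one_lt.le) hσ
    have := div_le_self (norm_nonneg (X p ω j)) h4
    linarith [le_abs_self M]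
  exact ⟨(Real.log_le_log (hδ.trans_le h2) h3).trans (le_max_right _ _),
    (neg_le_neg (Real.log_le_log hδ h2)).trans (le_max_left _ _)⟩

end EulerProducts

theorem theorem1p9
    {Ω Ω₁ Ω₂ : Type*} [MeasurableSpace Ω] [MeasurableSpace Ω₁] [MeasurableSpace Ω₂]
    (μ : Measure Ω) [IsProbabilityMeasure μ]
    (ν₁ : Measure Ω₁) [IsProbabilityMeasure ν₁] (ν₂ : Measure Ω₂) [IsProbabilityMeasure ν₂]
    (σ : ℝ) (hσ : 1 / 2 < σ) (hσ' : σ < 1)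
    (d : ℕ) (M : ℝ) (X : Nat.Primes → Ω → Fin d → ℂ)
    (hmeas : ∀ p, Measurable (X p))
    (hindep : iIndepFun X μ)
    (hbound : ∀ p, ∀ j, ∀ᵐ ω ∂μ, ‖X p ω j‖ ≤ M)
    (hmean : ∀ p, ∀ j, ∫ ω, X p ω j ∂μ = 0)
    (Z : Ω₁ → ℝ) (hZ : Measurable Z) (Y : Ω₂ → ℝ) (hY : Measurable Y) :
    ((∀ p, ∀ j, ∃ δ : ℝ, 0 < δ ∧
        ∀ᵐ ω ∂μ, δ ≤ ‖1 - X p ω j / ((p : ℕ) : ℂ) ^ (σ : ℂ)‖) →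
      IsULDLimit μ (fun p ω => ∑ j, (X p ω j).re) ν₁ Z →
      ¬ (Z =ᵐ[ν₁] 0) →
      IntegrableOn (cumulantIntegrand ν₁ Z σ) (Set.Ioi 0) ∧ 0 < cumulantG ν₁ Z σ ∧
      HasTailAsymptotic σ (cumulantA ν₁ Z σ)
        (fun τ y => μ.real {ω | τ < Real.log ‖eulerProduct X σ y ω‖})) ∧
    (IsULDLimit μ (fun p ω => ∑ j, (X p ω j).im) ν₂ Y →
      ¬ (Y =ᵐ[ν₂] 0) →
      IntegrableOn (cumulantIntegrand ν₂ Y σ) (Set.Ioi 0) ∧ 0 < cumulantG ν₂ Y σ ∧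
      HasTailAsymptotic σ (cumulantA ν₂ Y σ)
        (fun τ y => μ.real {ω | τ < eulerArg X σ y ω})) := by
  have hσ0 : 0 ≤ σ := by linarith
  refine ⟨fun hδ hU hne ↦ ?_, fun hU hne ↦ ?_⟩
  · refine hasTailAsymptotic_of_log_eulerFactor Complex.reCLM Complex.abs_re_le_norm hσ hσ' hmeas
      hindep hbound hmean (fun p j ↦ ?_) (fun y ↦ ?_) hU hne
    · obtain ⟨δ, hδ0, h⟩ := hδ p j
      simpa only [Complex.reCLM_apply, Complex.log_re] using
        exists_abs_log_norm_eulerFactor_le hδ0 hσ0 (hbound p j) h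
    · have hne0 : ∀ p j, ∀ᵐ ω ∂μ, eulerFactor X σ p j ω ≠ 0 := by
        intro p j
        obtain ⟨δ, hδ0, h⟩ := hδ p j
        filter_upwards [h] with ω hω
        exact inv_ne_zero (norm_pos_iff.mp (hδ0.trans_le hω))
      filter_upwards [ae_all_iff.mpr fun p ↦ ae_all_iff.mpr (hne0 p)] with ω hω
      simp only [eulerProduct, norm_prod, Complex.reCLM_apply, Complex.log_re]
      rw [Real.log_prod fun p _ ↦ Finset.prod_ne_zero_iff.mpr
        fun j _ ↦ norm_ne_zero_iff.mpr (hω p j)]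
      exact Finset.sum_congr rfl fun p _ ↦ Real.log_prod
        fun j _ ↦ norm_ne_zero_iff.mpr (hω p j)
  · refine hasTailAsymptotic_of_log_eulerFactor Complex.imCLM Complex.abs_im_le_norm hσ hσ' hmeas
      hindep hbound hmean (fun p j ↦ ⟨Real.pi, ?_⟩) (fun y ↦ ?_) hU hne
    · filter_upwards with ω
      simpa only [Complex.imCLM_apply, Complex.log_im] using Complex.abs_arg_le_pi _
    · filter_upwards with ω
      simp only [eulerArg, Complex.imCLM_apply, Complex.log_im]
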